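/- **Theorem (Security of Pyramid ORAM).** *Model.* A client runs on an external memory whose cells each hold one real element (a key-value pair) or a dummy. The adversary sees the trace of all addresses read and written, with the kind of each access, and whether the client has aborted, but not the contents of cells. Hash functions are truly random functions. *Zigzag hash tables.* Let $n=2^d$. A $\mathrm{ZHT}_{n,k,c}$ consists of tables $H_1,\dots,H_k$, each with $n$ buckets of $c$ slots, and hash functions $h_1,\dots,h_k$ from keys to buckets. A *search* for a key visits all slots of the buckets $h_1(\mathrm{key}),\dots,h_k(\mathrm{key})$ and removes the element if it is there; a *dummy search* visits one uniformly random bucket in each table. To *throw* an array of cells into some of the tables, one visits for each cell one bucket in each of these tables, given by fresh random hash functions for a real element to be moved and uniformly random otherwise; an element to be moved is put in the first free slot, and the throw fails if there is none. The *oblivious setup* throws all input cells (real and dummy) into $H_1,\dots,H_k$, and then, for $j=1,\dots,k$, routes $H_j$ by $h_j$ through the probabilistic routing network and throws all cells of $H_j$ into $H_{j+1},\dots,H_k$, really moving only the elements that were not routed correctly; for $j=k$ the setup fails if there is such an element. The routing network has stages $i=1,\dots,\log_2 n$. In stage $i$ each pair of buckets whose indices differ exactly in the $i$-th lowest bit is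 re-partitioned by the $i$-th bit of the destination of its live elements, using a sorting network on the $2c$ slots; if more than $c$ live elements want the same bucket, $c$ of them chosen at random stay live and the others are marked as not routed correctly. *Pyramid ORAM.* Let $p\ge 2$ and $N\ge p$ be powers of two. Level $L_0$ is a list of $p$ cells. Level $L_i$, for $1\le i\le l=\log_2(N/p)+1$, is a $\mathrm{ZHT}_{n_i,k_i,c_i}$ with $n_i=2^{i-1}p$, so that $n_l=N$. At the start $N$ elements with distinct keys are obliviously inserted into $L_l$. An access to a stored key (a read or a write) scans $L_0$, then searches each nonempty level in turn, using dummy searches once the element has been found (and removed), and finally appends the element to $L_0$. After $mp$ accesses ($m\ge1$), let $2^v$ be the largest power of two dividing $m$: if $v<l-1$, the levels $L_0,\dots,L_v$ are emptied into a newly built $L_{v+1}$; otherwise all levels are emptied into a newly built $L_l$. Every newly built table uses the oblivious setup, on all cells (real and dummy) of the emptied levels, with new hash functions. If a setup fails, the client aborts. *Adversary and simulator.* The adversary (computationally unbounded) chooses the $N$ initial elements and then, adaptively, each access (key, and new value for a write) depending on the trace so far. A simulator is given only the public parameters $p,N,(k_i),(c_i)$, the sorting networks and the number of the current operation ($0$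 for the setup, $t$ for the $t$-th access), and produces a trace for that operation, independently of everything else. *Statement.* There is a simulator $S$ with the following properties. 1. For all parameters, every adversary and every number $T$ of accesses, the statistical distance between the adversary's view (trace and abort flag) in the real execution with $T$ accesses, and the concatenation of the $T+1$ traces simulated by $S$ (with no abort), is at most the probability that the real execution aborts. 2. Pyramid ORAM is data-oblivious with very high probability. That is, for every $s\in\mathbb N$ there is a constant $C$, depending only on $s$, such that whenever $k_i,c_i\ge C(\lfloor\log_2\log_2 n_i\rfloor+1)$ for all $1\le i\le l$ (so that $k_i,c_i=O(\log\log n_i)$ suffices), for every adversary and every $T$ this statistical distance is at most $\left(\lfloor T/p\rfloor+1\right)2^{-s}$, that is, at most $2^{-s}$ for each table setup performed. -/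

import Mathlib

noncomputable section

namespace PyramidORAM

/-! ### External memory, access traces, and randomized client programs -/

/-- Addresses of the external memory; each address holds one (possibly dummy) element.
`input i` is the `i`-th cell of the initial array, `list i` is the `i`-th cell of the list `L₀`, and
`table id j b s` is slot `s` of bucket `b` of table `H_{j+1}` of the zigzag hash table
with identifier `id` (every newly built zigzag hash table lives in newly allocated memory). -/
inductive Addr : Type where
  | input (i : ℕ) : Addr
  | list (i : ℕ) : Addr
  | table (id j b s : ℕ) : Addr
  deriving DecidableEq

/-- What the adversary sees of one access to the external memory: the address and
whether it is a read or a write. The contents are encrypted. -/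
structure Access : Type where
  addr : Addr
  isWrite : Bool

/-- Contents of a memory cell. `elem = none` is a dummy element. The tag and the priority are used
by the routing network only. -/
structure Cell (K V : Type) : Type where
  elem : Option (K × V)
  tag : Bool
  prio : ℕ

/-- The dummy cell. -/
def Cell.empty {K V : Type} : Cell K V := ⟨none, false, 0⟩

/-- The external memory. -/
abbrev Mem (K V : Type) : Type := Addr → Cell K V

/-- A randomized client program acting on the external memory. The outcome is the trace of all
memory accesses, together with the result and the final memory, or `none` if the program fails
(aborts). -/
def Prog (K V α : Type) : Type := Mem K V → PMF (List Access × Option (α × Mem K V))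

namespace Prog

variable {K V : Type}

/-- Return a value without touching the memory. -/
def ret {α : Type} (x : α) : Prog K V α := fun m => PMF.pure ([], some (x, m))

/-- Sequential composition; traces are concatenated and a failure stops the execution. -/
def seq {α β : Type} (p : Prog K V α) (f : α → Prog K V β) : Prog K V β := fun m =>
  (p m).bind fun o =>
    match o.2 with
    | none => PMF.pure (o.1, none)
    | some (x, m') => (f x m').map fun o' => (o.1 ++ o'.1, o'.2)

instance : Monad (Prog K V) where
  pure := ret
  bind := seq

/-- Read a memory cell. -/
def read (x : Addr) : Prog K V (Cell K V) := fun m => PMF.pure ([⟨x, false⟩], some (m x, m))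

/-- Write a memory cell. -/
def write (x : Addr) (y : Cell K V) : Prog K V Unit := fun m =>
  PMF.pure ([⟨x, true⟩], some ((), Function.update m x y))

/-- Draw a uniformly random element of a finite type, in private memory. -/
def sample (α : Type) [Fintype α] [Nonempty α] : Prog K V α := fun m =>
  (PMF.uniformOfFintype α).map fun x => ([], some (x, m))

/-- Abort. -/
def fail {α : Type} : Prog K V α := fun _ => PMF.pure ([], none)

end Prog

/-! ### Sorting networks -/

/-- One comparator on an array of natural numbers. -/
def compareExchange (f : ℕ → ℕ) (q : ℕ × ℕ) : ℕ → ℕ :=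
  Function.update (Function.update f q.1 (min (f q.1) (f q.2))) q.2 (max (f q.1) (f q.2))

/-- The list `w` of comparators is a sorting network for arrays of length `m`
(for instance Batcher's network). -/
def IsSortingNetwork (w : List (ℕ × ℕ)) (m : ℕ) : Prop :=
  (∀ q ∈ w, q.1 < q.2 ∧ q.2 < m) ∧
  ∀ f : ℕ → ℕ, ∀ i j : ℕ, i ≤ j → j < m →
    w.foldl compareExchange f i ≤ w.foldl compareExchange f j

/-! ### The probabilistic routing network -/

section Zigzag

variable {K V : Type}

/-- Addresses of the slots of bucket `b` of the `j`-th table. -/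
def bucketSlots (id j b c : ℕ) : List Addr := (List.range c).map (Addr.table id j b)

/-- Addresses of the slots of the `j`-th table, which has `2 ^ d` buckets of size `c`. -/
def tableSlots (id j d c : ℕ) : List Addr :=
  (List.range (2 ^ d)).flatMap fun b => bucketSlots id j b c

/-- Addresses of all slots of a zigzag hash table with `k` tables of `2 ^ d` buckets of size `c`. -/
def zhtSlots (id k d c : ℕ) : List Addr :=
  (List.range k).flatMap fun j => tableSlots id j d c

/-- Order class of a cell when a pair of buckets is partitioned by bit `i` of the destination:
`0` for live elements with bit `0`, `1` for dummies and elements tagged `false`, and `2` for live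
elements with bit `1`. -/
def cellClass (h : K → ℕ) (i : ℕ) (y : Cell K V) : ℕ :=
  match y.elem with
  | none => 1
  | some e => if y.tag then (if (h e.1).testBit i then 2 else 0) else 1

/-- Compare-and-swap of two cells of the contiguous range `loc 0, …, loc (m-1)`, ordered by class
and then by priority (a number below `m`). -/
def compareSwap (h : K → ℕ) (i m : ℕ) (loc : ℕ → Addr) (q : ℕ × ℕ) : Prog K V Unit := do
  let y ← Prog.read (loc q.1)
  let z ← Prog.read (loc q.2)
  if cellClass h i y * m + y.prio ≤ cellClass h i z * m + z.prio then do
    Prog.write (loc q.1) y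
    Prog.write (loc q.2) z
  else do
    Prog.write (loc q.1) z
    Prog.write (loc q.2) y

/-- Re-partition of the pair of buckets `b₀, b₁` of size `c` of table `j` by bit `i` of the
destination `h`. The `2 c` slots are treated as one range and sorted obliviously by class, with
uniformly random order inside a class; live elements that end up in the wrong bucket (the bucket of
their choice being full) are retagged `false`. -/
def repartition (w : List (ℕ × ℕ)) (id j c : ℕ) (h : K → ℕ) (i b₀ b₁ : ℕ) : Prog K V Unit := do
  let loc : ℕ → Addr := fun t =>
    if t < c then Addr.table id j b₀ t else Addr.table id j b₁ (t - c)
  let σ ← Prog.sample (Equiv.Perm (Fin (2 * c)))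
  (List.finRange (2 * c)).forM fun t => do
    let y ← Prog.read (loc t)
    Prog.write (loc t) { y with prio := (σ t : ℕ) }
  w.forM (compareSwap h i (2 * c) loc)
  (List.range (2 * c)).forM fun t => do
    let y ← Prog.read (loc t)
    if (cellClass h i y = 0 ∧ c ≤ t) ∨ (cellClass h i y = 2 ∧ t < c) then
      Prog.write (loc t) { y with tag := false }
    else
      Prog.write (loc t) y

/-- The routing network on table `j`: in stage `i` (from the lowest bit on), all pairs of buckets
whose indices differ exactly in bit `i` are re-partitioned. -/
def route (w : List (ℕ × ℕ)) (id j d c : ℕ) (h : K → ℕ) : Prog K V Unit :=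
  (List.range d).forM fun i =>
    ((List.range (2 ^ d)).filter fun b => !b.testBit i).forM fun b =>
      repartition w id j c h i b (b + 2 ^ i)

/-! ### Zigzag hash tables -/

/-- Visit one slot carrying a pending element: the element is put there if the slot is free;
otherwise the slot is rewritten unchanged. Returns the element if it is still pending. -/
def insertSlot (pending : Option (K × V)) (x : Addr) : Prog K V (Option (K × V)) := do
  let y ← Prog.read x
  match pending, y.elem with
  | some e, none => do
      Prog.write x ⟨some e, true, 0⟩
      pure none
  | _, _ => do
      Prog.write x y
      pure pending

/-- Throw the elements stored at the addresses `src` into the tables `js` (in this order).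
Only the elements in cells satisfying `sel` are really moved: each goes to the first free slot on
its zigzag path, which is given by new random hash functions. For every other cell, a
random path is visited and nothing is inserted. All slots of the path are always visited.
The throw fails if an element finds no free slot. -/
def throwInto [Fintype K] [DecidableEq K] (id d k c : ℕ) (js : List (Fin k)) (src : List Addr)
    (sel : Cell K V → Bool) : Prog K V Unit := do
  let g ← Prog.sample (Fin k → K → Fin (2 ^ d))
  src.forM fun x => do
    let y ← Prog.read x
    Prog.write x (if sel y then Cell.empty else y)
    let pending : Option (K × V) := if sel y then y.elem else none
    let rnd ← Prog.sample (Fin k → Fin (2 ^ d))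
    let path : Fin k → Fin (2 ^ d) :=
      match pending with
      | some e => fun j => g j e.1
      | none => rnd
    let rest ← (js.flatMap fun j : Fin k => bucketSlots id j (path j) c).foldlM insertSlot pending
    match rest with
    | none => pure ()
    | some _ => Prog.fail

/-- Data-oblivious setup of a zigzag hash table with `k` tables of `2 ^ d` buckets of
size `c`, from all the elements, real or dummy, stored at the addresses `src`. After an initial
throw into all tables, for each table in turn: it is routed according to its final
random hash function, and then all its cells are thrown into the later tables, where
only the elements that were not routed correctly (tag `false`) are really moved. Returns the hash
functions. The setup fails if one of the throws fails; for the last table, whose throw has no target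
tables, this means that some element could not be routed. -/
def build [Fintype K] [DecidableEq K] (w : List (ℕ × ℕ)) (id d k c : ℕ) (src : List Addr) :
    Prog K V (Fin k → K → Fin (2 ^ d)) := do
  throwInto id d k c (List.finRange k) src (fun _ => true)
  let h ← Prog.sample (Fin k → K → Fin (2 ^ d))
  (List.finRange k).forM fun j => do
    route w id j d c (fun key => (h j key : ℕ))
    throwInto id d k c ((List.finRange k).filter fun j' => j < j') (tableSlots id j d c)
      (fun y => !y.tag)
  pure h

/-- Visit one slot while looking for `key`: if `key` has not been found before and is stored here,
it is removed and its value is cached; otherwise the slot is rewritten unchanged. -/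
def searchSlot [DecidableEq K] (key : K) (found : Option V) (x : Addr) : Prog K V (Option V) := do
  let y ← Prog.read x
  match found, y.elem with
  | none, some e =>
      if e.1 = key then do
        Prog.write x Cell.empty
        pure (some e.2)
      else do
        Prog.write x y
        pure found
  | _, _ => do
      Prog.write x y
      pure found

/-- Search in a zigzag hash table: all slots on the zigzag path of `key` are visited, or, if the
element was found before, all slots on a random path (a dummy search). -/
def search [DecidableEq K] (id d k c : ℕ) (h : Fin k → K → Fin (2 ^ d)) (key : K)
    (found : Option V) : Prog K V (Option V) := do
  let rnd ← Prog.sample (Fin k → Fin (2 ^ d))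
  let path : Fin k → Fin (2 ^ d) :=
    match found with
    | none => fun j => h j key
    | some _ => rnd
  ((List.finRange k).flatMap fun j : Fin k => bucketSlots id j (path j) c).foldlM (searchSlot key) found

end Zigzag

/-! ### Pyramid ORAM -/

/-- Public parameters. The list `L₀` has size `p = 2 ^ logp ≥ 2`. The levels
`L₁, …, L_{depth+1}` are zigzag hash tables: level `L_{i+1}` has capacity
`2 ^ i * p = 2 ^ (logp + i)`, consists of `k i` tables with buckets of size `c i`, and is
built with the sorting network `net i` for the re-partitioning of bucket pairs. The last level
can hold all `N = 2 ^ (logp + depth)` elements. -/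
structure Params : Type where
  logp : ℕ
  depth : ℕ
  k : ℕ → ℕ
  c : ℕ → ℕ
  net : ℕ → List (ℕ × ℕ)
  one_le_logp : 1 ≤ logp
  net_sorts : ∀ i, i ≤ depth → IsSortingNetwork (net i) (2 * c i)

/-- The size `p` of the list `L₀`. -/
def Params.p (P : Params) : ℕ := 2 ^ P.logp

/-- The number `N` of elements of the ORAM. -/
def Params.N (P : Params) : ℕ := 2 ^ (P.logp + P.depth)

/-- Private state of the client: for each level `L_{i+1}` the identifier and the hash functions
of its zigzag hash table, or `none` if the level is empty. -/
abbrev ClientState (P : Params) (K : Type) : Type :=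
  (i : ℕ) → Option (ℕ × (Fin (P.k i) → K → Fin (2 ^ (P.logp + i))))

section ORAM

variable {K V : Type} [Fintype K] [DecidableEq K] (P : Params)

/-- Addresses of the cells of `L₀`. -/
def listSlots : List Addr := (List.range P.p).map Addr.list

/-- Setup: the `N` elements of the initial array are obliviously inserted into the last level; all
other levels are empty. -/
def setup : Prog K V (ClientState P K) := do
  let h ← build (P.net P.depth) 0 (P.logp + P.depth) (P.k P.depth) (P.c P.depth)
    ((List.range P.N).map Addr.input)
  pure (Function.update (fun _ => none) P.depth (some (0, h)))

/-- The `m`-th rebuild (`m ≥ 1`), performed after `m * p` accesses. If `2 ^ v` is the largest power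
of two dividing `m`, the levels `L₀, …, L_v` are emptied into `L_{v+1}`, except that
when `L_{v+1}` would be the last level or beyond, the elements of all levels, including the last,
are put into a new table that replaces the last level. All elements,
real and dummy, of these levels take part. -/
def rebuild (m : ℕ) (st : ClientState P K) : Prog K V (ClientState P K) := do
  let v := min (padicValNat 2 m) P.depth
  let src := listSlots P ++ (List.range (v + 1)).flatMap fun i =>
    match st i with
    | none => []
    | some (id, _) => zhtSlots id (P.k i) (P.logp + i) (P.c i)
  let h ← build (P.net v) m (P.logp + v) (P.k v) (P.c v) src
  pure (Function.update (fun i => if i < v then none else st i) v (some (m, h)))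

/-- The access number `t` (counted from `0`) to the element with the given key, a read if
`newVal = none` and a write otherwise. The list `L₀` is scanned and every nonempty level is searched,
with dummy searches once the element has been found; the element is then appended to `L₀`; after
every `p` accesses a rebuild takes place. Returns the value found. -/
def access (t : ℕ) (key : K) (newVal : Option V) (st : ClientState P K) :
    Prog K V (Option V × ClientState P K) := do
  let found₀ ← (listSlots P).foldlM (searchSlot key) none
  let found ← (List.range (P.depth + 1)).foldlM (fun found i =>
    match st i with
    | none => pure found
    | some (id, h) => search id (P.logp + i) (P.k i) (P.c i) h key found) found₀
  Prog.write (Addr.list (t % P.p)) ⟨(newVal <|> found).map fun v => (key, v), true, 0⟩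
  if (t + 1) % P.p = 0 then do
    let st' ← rebuild P ((t + 1) / P.p) st
    pure (found, st')
  else
    pure (found, st)

end ORAM

/-! ### The security experiment -/

/-- An adversary chooses `N` elements with distinct keys, and then, adaptively, the key of
the next access and the value to be written (`none` for a read), depending on the trace
observed so far. Accesses are to elements stored in the ORAM. -/
structure Adversary (N : ℕ) (K V : Type) : Type where
  elems : Fin N → K × V
  distinct : Function.Injective fun i => (elems i).1
  request : List Access → K × Option V
  request_mem : ∀ tr, ∃ i, (elems i).1 = (request tr).1

/-- The external memory at the start: the elements of the adversary are in the input array. -/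
def initMem {N : ℕ} {K V : Type} (A : Adversary N K V) : Mem K V
  | Addr.input i => if hi : i < N then ⟨some (A.elems ⟨i, hi⟩), true, 0⟩ else Cell.empty
  | _ => Cell.empty

/-- The setup followed by `T` accesses chosen by the adversary: the trace so far and, unless
a failure occurred, the state of the client and of the memory. -/
def experiment (P : Params) {K V : Type} [Fintype K] [DecidableEq K] (A : Adversary P.N K V) :
    ℕ → PMF (List Access × Option (ClientState P K × Mem K V))
  | 0 => setup P (initMem A)
  | T + 1 => (experiment P A T).bind fun o =>
      match o.2 with
      | none => PMF.pure (o.1, none)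
      | some (st, mem) =>
        (access P T (A.request o.1).1 (A.request o.1).2 st mem).map fun o' =>
          (o.1 ++ o'.1, o'.2.map fun z => (z.1.2, z.2))

/-- What an adversary sees: a trace and whether the execution is still running (`true`) or has been
aborted (`false`). -/
abbrev View : Type := List Access × Bool

/-- The view of the adversary in the real execution with `T` accesses. -/
def realView (P : Params) {K V : Type} [Fintype K] [DecidableEq K] (A : Adversary P.N K V)
    (T : ℕ) : PMF View :=
  (experiment P A T).map fun o => (o.1, o.2.isSome)

/-- A simulator. For the setup (operation `0`) and for each access (operations `1, 2, …`) it
produces a trace from the public parameters and the number of the operation, independently of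
everything else. -/
abbrev Simulator : Type := Params → ℕ → PMF (List Access)

/-- The concatenation of the simulated traces of the setup and of `T` accesses. -/
def simTrace (S : Simulator) (P : Params) : ℕ → PMF (List Access)
  | 0 => S P 0
  | T + 1 => (simTrace S P T).bind fun tr => (S P (T + 1)).map fun tr' => tr ++ tr'

/-- The view of the adversary in the simulation. -/
def simView (S : Simulator) (P : Params) (T : ℕ) : PMF View :=
  (simTrace S P T).map fun tr => (tr, true)

/-- The probability of an event, as a real number. -/
def prob {α : Type} (μ : PMF α) (E : Set α) : ℝ := (μ.toOuterMeasure E).toReal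

/-- No distinguisher tells `μ` from `ν` with advantage more than `ε`. -/
def Indistinguishable {α : Type} (μ ν : PMF α) (ε : ℝ) : Prop :=
  ∀ D : Set α, |prob μ D - prob ν D| ≤ ε

/-- The event that the execution has been aborted. -/
def failed : Set View := {v | v.2 = false}

end PyramidORAM

end

/-! The simulator replays the public schedule of rebuilds (`shape`) and replaces every hashed path
by a uniformly random one. The argument has two halves: successful real runs are dominated by the
simulation, and the probability of aborting is small.

Domination means that for nonnegative test functions the expectation over successful real runs is at
most the expectation over simulated traces (`W_experiment_le`). Applied to an event and to its
complement, it bounds the statistical distance by the abort probability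
(`indistinguishable_of_failProb_le`). Since only an inequality is needed, conditioning on success is
never analysed.

In a throw each stored key is hashed once by fresh functions, so its path is uniform at the moment
it is used (`avg_throw_le`), and routing has a fixed trace. Hence the simulated trace of a setup is
independent of the final hash functions (`dom_build`). For lookups, consider a key kept at level
`l`. The rebuild that put it there also emptied all smaller levels, and any access would have moved
the key to the list. So its hash values in the current tables up to level `l` have not been used
yet. `Blind` expresses that the future consults only such values. The values of the accessed key can
then be resampled, which turns its search into a dummy search (`avg_lookup`).

For the abort probability, the rebuilds follow a binary counter, so a table with `n = 2 ^ d` buckets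
receives at most `n` real elements (`LoadOk.card_le`). An element in table `a` comes from one of at
most `a + 1` throws, and after `i` routing stages its bucket has the low `i` bits of its destination
and the other bits of its starting position. A given bucket thus occurs with probability at most `(a
+ 1) / n` (`pr_canBe`). Leaving a table requires `c + 1` keys that can be in one bucket at one
stage. This is a condition on hash values alone; the sets `spillover` collect the keys concerned,
and if the last one is empty no run fails (`out_build`).

A first moment bound and Markov's inequality show that if at most `n / 2 ^ q` keys reach table `a`,
where `q = 2 ^ a - 1`, then at most `n / 2 ^ (2 * q + 1)` reach the next one, except with
probability `2⁻¹ ^ (s + a + 1)` (`pr_spill_le`). The load decays doubly exponentially, so about `log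
log n` tables suffice, and the error terms sum to at most `2⁻¹ ^ s`. Buckets of size of order `log
log n` are needed for `c!` to beat `d + 1` and `(a + 1) ^ (c + 1)`. -/

noncomputable section

namespace PyramidORAM

open scoped ENNReal

/-! ### Expectations over discrete distributions -/

section Expectation

variable {α β γ : Type*}

/-- The expectation of a nonnegative function. -/
def ex (μ : PMF α) (f : α → ℝ≥0∞) : ℝ≥0∞ := ∑' a, μ a * f a

lemma ex_pure (a : α) (f : α → ℝ≥0∞) : ex (PMF.pure a) f = f a := by
  unfold ex
  rw [tsum_eq_single a]
  · simp
  · intro b hb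
    simp [PMF.pure_apply, hb]

lemma ex_bind (μ : PMF α) (g : α → PMF β) (f : β → ℝ≥0∞) :
    ex (μ.bind g) f = ex μ fun a => ex (g a) f := by
  unfold ex
  simp only [PMF.bind_apply, ← ENNReal.tsum_mul_right, ← ENNReal.tsum_mul_left]
  rw [ENNReal.tsum_comm]
  simp only [mul_assoc]

lemma ex_map (μ : PMF α) (g : α → β) (f : β → ℝ≥0∞) : ex (μ.map g) f = ex μ fun a => f (g a) := by
  rw [PMF.map, ex_bind]
  simp only [Function.comp, ex_pure]

lemma ex_mono_support {μ : PMF α} {f g : α → ℝ≥0∞} (h : ∀ a ∈ μ.support, f a ≤ g a) :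
    ex μ f ≤ ex μ g := by
  refine ENNReal.tsum_le_tsum fun a => ?_
  by_cases ha : a ∈ μ.support
  · gcongr
    exact h a ha
  · simp [(PMF.apply_eq_zero_iff μ a).2 ha]

lemma ex_mono {μ : PMF α} {f g : α → ℝ≥0∞} (h : ∀ a, f a ≤ g a) : ex μ f ≤ ex μ g :=
  ex_mono_support fun a _ => h a

lemma ex_const (μ : PMF α) (z : ℝ≥0∞) : (ex μ fun _ => z) = z := by
  unfold ex
  rw [ENNReal.tsum_mul_right, μ.tsum_coe, one_mul]

lemma ex_add (μ : PMF α) (f g : α → ℝ≥0∞) : (ex μ fun a => f a + g a) = ex μ f + ex μ g := by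
  unfold ex
  simp only [mul_add, ENNReal.tsum_add]

lemma ex_sum {ι : Type*} (μ : PMF α) (s : Finset ι) (f : ι → α → ℝ≥0∞) :
    (ex μ fun a => ∑ i ∈ s, f i a) = ∑ i ∈ s, ex μ (f i) := by
  classical
  induction s using Finset.induction_on with
  | empty => simpa using ex_const μ 0
  | insert i s hi ih => simp only [Finset.sum_insert hi, ex_add, ih]

lemma ex_const_mul (μ : PMF α) (z : ℝ≥0∞) (f : α → ℝ≥0∞) :
    (ex μ fun a => z * f a) = z * ex μ f := by
  unfold ex
  rw [← ENNReal.tsum_mul_left]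
  exact tsum_congr fun a => by ring

lemma ex_comm (μ : PMF α) (ν : PMF β) (f : α → β → ℝ≥0∞) :
    (ex μ fun a => ex ν (f a)) = ex ν fun b => ex μ fun a => f a b := by
  unfold ex
  simp only [← ENNReal.tsum_mul_left]
  rw [ENNReal.tsum_comm]
  exact tsum_congr fun b => tsum_congr fun a => by ring

/-- The uniform average of a nonnegative function. -/
def avg [Fintype α] [Nonempty α] (f : α → ℝ≥0∞) : ℝ≥0∞ := ex (PMF.uniformOfFintype α) f

lemma avg_eq_sum [Fintype α] [Nonempty α] (f : α → ℝ≥0∞) :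
    avg f = (Fintype.card α : ℝ≥0∞)⁻¹ * ∑ a, f a := by
  unfold avg ex
  simp only [PMF.uniformOfFintype_apply, tsum_fintype, Finset.mul_sum]

lemma avg_equiv [Fintype α] [Nonempty α] [Fintype β] [Nonempty β] (e : α ≃ β) (f : β → ℝ≥0∞) :
    (avg fun a => f (e a)) = avg f := by
  rw [avg_eq_sum, avg_eq_sum, Fintype.card_congr e, e.sum_comp f]

lemma avg_prod [Fintype α] [Nonempty α] [Fintype β] [Nonempty β] (f : α → β → ℝ≥0∞) :
    (avg fun x : α × β => f x.1 x.2) = avg fun a => avg (f a) := by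
  simp only [avg_eq_sum, Fintype.card_prod, Fintype.sum_prod_type, ← Finset.mul_sum, Nat.cast_mul]
  rw [ENNReal.mul_inv (by simp) (by simp), mul_assoc]

/-- The map `(a, b) ↦ (set a b, get a)` is an involution of `α × β` and hence preserves the uniform
distribution. This is the resampling principle by which a part of a random object is treated as
freshly drawn: one index, one key of a throw, or one key in all levels. -/
lemma avg_lens [Fintype α] [Nonempty α] [Fintype β] [Nonempty β] (get : α → β) (set : α → β → α)
    (get_set : ∀ a b, get (set a b) = b) (set_get : ∀ a, set a (get a) = a)
    (set_set : ∀ a b b', set (set a b) b' = set a b') (f : α → ℝ≥0∞) :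
    avg f = avg fun b => avg fun a => f (set a b) := by
  have hinv : Function.Involutive fun x : α × β => (set x.1 x.2, get x.1) := fun x => by
    simp [get_set, set_get, set_set]
  have h1 := avg_equiv hinv.toPerm fun x : α × β => f x.1
  have h2 := avg_prod (α := α) (β := β) fun a _ => f a
  have h3 := avg_prod (α := α) (β := β) fun a b => f (set a b)
  rw [h2] at h1
  unfold avg at h1 h3 ⊢
  simp only [ex_const] at h1
  rw [← h1, ex_comm]
  exact h3

lemma avg_update {ι : Type*} {X : ι → Type*} [Fintype ι] [DecidableEq ι] [∀ i, Fintype (X i)]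
    [∀ i, Nonempty (X i)] (i : ι) (f : (∀ i, X i) → ℝ≥0∞) :
    avg f = avg fun x : X i => avg fun a => f (Function.update a i x) :=
  avg_lens (fun a => a i) (fun a x => Function.update a i x) (by simp) (by simp) (by simp) f

end Expectation

/-! ### Program logic -/

section Logic

variable {K V : Type} {α β : Type}

/-- The expected value of a function of the outcome of a run. -/
def W (μ : PMF (List Access × Option (α × Mem K V))) (z : ℝ≥0∞)
    (F : List Access → α → Mem K V → ℝ≥0∞) : ℝ≥0∞ :=
  ex μ fun o => match o.2 with
    | none => z
    | some (x, m) => F o.1 x m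

lemma W_bind (p : Prog K V α) (f : α → Prog K V β) (m : Mem K V) (z : ℝ≥0∞)
    (F : List Access → β → Mem K V → ℝ≥0∞) :
    W ((p >>= f) m) z F =
      W (p m) z fun tr x m' => W (f x m') z fun tr' => F (tr ++ tr') := by
  change W (Prog.seq p f m) z F = _
  unfold W Prog.seq
  rw [ex_bind]
  congr 1
  funext o
  rcases o with ⟨tr, _ | ⟨x, m'⟩⟩
  · simp [ex_pure]
  · simp only [ex_map]

lemma W_pure (x : α) (m : Mem K V) (z : ℝ≥0∞) (F : List Access → α → Mem K V → ℝ≥0∞) :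
    W ((pure x : Prog K V α) m) z F = F [] x m := by
  change W (Prog.ret x m) z F = _
  simp [W, Prog.ret, ex_pure]

lemma W_read (x : Addr) (m : Mem K V) (z : ℝ≥0∞) (F : List Access → Cell K V → Mem K V → ℝ≥0∞) :
    W (Prog.read x m) z F = F [⟨x, false⟩] (m x) m := by
  simp [W, Prog.read, ex_pure]

lemma W_write (x : Addr) (y : Cell K V) (m : Mem K V) (z : ℝ≥0∞)
    (F : List Access → Unit → Mem K V → ℝ≥0∞) :
    W (Prog.write x y m) z F = F [⟨x, true⟩] () (Function.update m x y) := by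
  simp [W, Prog.write, ex_pure]

lemma W_sample [Fintype α] [Nonempty α] (m : Mem K V) (z : ℝ≥0∞)
    (F : List Access → α → Mem K V → ℝ≥0∞) :
    W (Prog.sample α m) z F = avg fun x => F [] x m := by
  simp [W, Prog.sample, ex_map, avg]

lemma W_fail (m : Mem K V) (z : ℝ≥0∞) (F : List Access → α → Mem K V → ℝ≥0∞) :
    W ((Prog.fail : Prog K V α) m) z F = z := by
  simp [W, Prog.fail, ex_pure]

/-- The probability that a run fails. -/
def failProb (μ : PMF (List Access × Option (α × Mem K V))) : ℝ≥0∞ := W μ 1 fun _ _ _ => 0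

/-- Separates the two halves of the security argument: the abort probability and the successful
runs. -/
lemma W_one_eq (μ : PMF (List Access × Option (α × Mem K V)))
    (F : List Access → α → Mem K V → ℝ≥0∞) : W μ 1 F = failProb μ + W μ 0 F := by
  unfold failProb W
  rw [← ex_add]
  congr 1
  funext o
  rcases o with ⟨tr, _ | ⟨x, m'⟩⟩ <;> simp

lemma failProb_bind (p : Prog K V α) (f : α → Prog K V β) (m : Mem K V) :
    failProb ((p >>= f) m) = failProb (p m) + W (p m) 0 fun _ x m' => failProb (f x m') := by
  rw [failProb, W_bind, W_one_eq]
  rfl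

/-- The program does not fail and its outcomes satisfy `Q`. -/
def Out (p : Prog K V α) (m : Mem K V) (Q : List Access → α → Mem K V → Prop) : Prop :=
  ∀ o ∈ (p m).support, ∃ x m', o.2 = some (x, m') ∧ Q o.1 x m'

lemma Out.mono {p : Prog K V α} {m : Mem K V} {Q Q' : List Access → α → Mem K V → Prop}
    (h : Out p m Q) (hQ : ∀ tr x m', Q tr x m' → Q' tr x m') : Out p m Q' := fun o ho => by
  obtain ⟨x, m', h1, h2⟩ := h o ho
  exact ⟨x, m', h1, hQ _ _ _ h2⟩

lemma Out.bind {p : Prog K V α} {f : α → Prog K V β} {m : Mem K V}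
    {Q : List Access → β → Mem K V → Prop}
    (h : Out p m fun tr x m' => Out (f x) m' fun tr' => Q (tr ++ tr')) : Out (p >>= f) m Q := by
  intro o ho
  change o ∈ (Prog.seq p f m).support at ho
  unfold Prog.seq at ho
  obtain ⟨a, ha, hoa⟩ := (PMF.mem_support_bind_iff _ _ _).1 ho
  obtain ⟨x, m', h1, h2⟩ := h a ha
  rcases a with ⟨tr, a⟩
  simp only at h1
  subst h1
  obtain ⟨b, hb, rfl⟩ := (PMF.mem_support_map_iff _ _ _).1 hoa
  obtain ⟨x', m'', h3, h4⟩ := h2 b hb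
  exact ⟨x', m'', h3, h4⟩

lemma Out.pure {x : α} {m : Mem K V} {Q : List Access → α → Mem K V → Prop} (h : Q [] x m) :
    Out (Pure.pure x) m Q := by
  intro o ho
  change o ∈ (PMF.pure _).support at ho
  rw [PMF.mem_support_pure_iff] at ho
  subst ho
  exact ⟨x, m, rfl, h⟩

lemma Out.read {x : Addr} {m : Mem K V} {Q : List Access → Cell K V → Mem K V → Prop}
    (h : Q [⟨x, false⟩] (m x) m) : Out (Prog.read x) m Q := by
  intro o ho
  change o ∈ (PMF.pure _).support at ho
  rw [PMF.mem_support_pure_iff] at ho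
  subst ho
  exact ⟨_, _, rfl, h⟩

lemma Out.write {x : Addr} {y : Cell K V} {m : Mem K V} {Q : List Access → Unit → Mem K V → Prop}
    (h : Q [⟨x, true⟩] () (Function.update m x y)) : Out (Prog.write x y) m Q := by
  intro o ho
  change o ∈ (PMF.pure _).support at ho
  rw [PMF.mem_support_pure_iff] at ho
  subst ho
  exact ⟨_, _, rfl, h⟩

lemma Out.sample [Fintype α] [Nonempty α] {m : Mem K V} {Q : List Access → α → Mem K V → Prop}
    (h : ∀ x, Q [] x m) : Out (Prog.sample α) m Q := by
  intro o ho
  change o ∈ (PMF.map _ _).support at ho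
  obtain ⟨x, -, rfl⟩ := (PMF.mem_support_map_iff _ _ _).1 ho
  exact ⟨_, _, rfl, h x⟩

lemma Out.W_le {p : Prog K V α} {m : Mem K V} {Q : List Access → α → Mem K V → Prop}
    (h : Out p m Q) {z c : ℝ≥0∞} {F : List Access → α → Mem K V → ℝ≥0∞}
    (hF : ∀ tr x m', Q tr x m' → F tr x m' ≤ c) : W (p m) z F ≤ c := by
  rw [← ex_const (p m) c]
  refine ex_mono_support fun o ho => ?_
  obtain ⟨x, m', h1, h2⟩ := h o ho
  rw [h1]
  exact hF _ _ _ h2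

lemma Out.failProb {p : Prog K V α} {m : Mem K V} {Q : List Access → α → Mem K V → Prop}
    (h : Out p m Q) : failProb (p m) = 0 :=
  le_antisymm (h.W_le fun _ _ _ _ => le_rfl) zero_le

/-- Simulated programs, which produce a trace. -/
abbrev Sim (β : Type) : Type := PMF (List Access × β)

/-- Sequential composition of simulated programs. -/
def Sim.seq {γ : Type} (ν : Sim β) (g : β → Sim γ) : Sim γ :=
  PMF.bind ν fun o => (g o.2).map fun o' => (o.1 ++ o'.1, o'.2)

/-- Produce a fixed trace. -/
def emit (tr : List Access) : Sim Unit := PMF.pure (tr, ())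

/-- A random choice without a trace. -/
def Sim.sample (β : Type) [Fintype β] [Nonempty β] : Sim β :=
  (PMF.uniformOfFintype β).map fun x => ([], x)

/-- A loop of simulated programs. -/
def Sim.loop {ι : Type} (l : List ι) (g : ι → Sim Unit) : Sim Unit :=
  l.foldr (fun i r => (g i).seq fun _ => r) (emit [])

lemma Sim.ex_seq {γ : Type} (ν : Sim β) (g : β → Sim γ) (G : List Access × γ → ℝ≥0∞) :
    ex (ν.seq g) G = ex ν fun o => ex (g o.2) fun o' => G (o.1 ++ o'.1, o'.2) := by
  unfold Sim.seq
  rw [ex_bind]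
  simp only [ex_map]

lemma ex_emit (tr : List Access) (G : List Access × Unit → ℝ≥0∞) :
    ex (emit tr) G = G (tr, ()) := ex_pure _ _

lemma Sim.ex_sample [Fintype β] [Nonempty β] (G : List Access × β → ℝ≥0∞) :
    ex (Sim.sample β) G = avg fun x => G ([], x) := by
  unfold Sim.sample
  rw [ex_map]
  rfl

/-- The successful runs of `p` are dominated by the runs of `ν`, where corresponding results
are related by `R`. -/
def Dom (p : Prog K V α) (m : Mem K V) (ν : Sim β) (R : α → Mem K V → β → Prop) : Prop :=
  ∀ (F : List Access → α → Mem K V → ℝ≥0∞) (G : List Access → β → ℝ≥0∞),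
    (∀ tr x m' y, R x m' y → F tr x m' ≤ G tr y) → W (p m) 0 F ≤ ex ν fun o => G o.1 o.2

lemma Dom.mono {p : Prog K V α} {m : Mem K V} {ν : Sim β} {R R' : α → Mem K V → β → Prop}
    (h : Dom p m ν R) (hR : ∀ x m' y, R x m' y → R' x m' y) : Dom p m ν R' :=
  fun F G hFG => h F G fun tr x m' y hr => hFG tr x m' y (hR _ _ _ hr)

/-- `Dom` quantifies over all test functions, so the expectations of the two continuations are
admissible test functions themselves. No joint distribution has to be constructed. -/
lemma Dom.bind {α' β' : Type} {p : Prog K V α} {m : Mem K V} {ν : Sim β}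
    {R : α → Mem K V → β → Prop} (h : Dom p m ν R) {f : α → Prog K V α'} {g : β → Sim β'}
    {R' : α' → Mem K V → β' → Prop} (hfg : ∀ x m' y, R x m' y → Dom (f x) m' (g y) R') :
    Dom (p >>= f) m (ν.seq g) R' := fun F G hFG => by
  rw [W_bind, Sim.ex_seq]
  exact h _ (fun tr y => ex (g y) fun o' => G (tr ++ o'.1) o'.2) fun tr x m' y hr =>
    hfg x m' y hr _ (fun tr' y' => G (tr ++ tr') y') fun tr' x' m'' y' hr' => hFG _ _ _ _ hr'

/-- Covers everything with a fixed trace, such as routing and the scan of the list, whatever its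
private randomness does. -/
lemma Out.dom {p : Prog K V α} {m : Mem K V} {tr₀ : List Access}
    {Q : α → Mem K V → Prop} (h : Out p m fun tr x m' => tr = tr₀ ∧ Q x m') :
    Dom p m (emit tr₀) fun x m' _ => Q x m' := fun F G hFG => by
  rw [ex_emit]
  exact h.W_le fun tr x m' ⟨h1, h2⟩ => h1 ▸ hFG _ _ _ _ h2

lemma Dom.pure {x : α} {y : β} {m : Mem K V} {R : α → Mem K V → β → Prop} (h : R x m y) :
    Dom (Pure.pure x) m (PMF.pure ([], y)) R := fun F G hFG => by
  rw [W_pure, ex_pure]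
  exact hFG _ _ _ _ h

lemma Dom.sample [Fintype α] [Nonempty α] {m : Mem K V} {R : α → Mem K V → α → Prop}
    (h : ∀ x, R x m x) : Dom (Prog.sample α) m (Sim.sample α) R := fun F G hFG => by
  rw [W_sample, Sim.ex_sample]
  exact ex_mono fun x => hFG _ _ _ _ (h x)

/-- The invariant is indexed by the iterations still to be done; the suffix hypothesis lets a step
recover its position in the loop. -/
lemma Dom.loop {ι : Type} {f : ι → Prog K V PUnit} {g : ι → Sim Unit} {l : List ι}
    {I : List ι → Mem K V → Prop} {m : Mem K V} (h0 : I l m)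
    (hstep : ∀ i l' m, i :: l' <:+ l → I (i :: l') m → Dom (f i) m (g i) fun _ m' _ => I l' m') :
    Dom (l.forM f) m (Sim.loop l g) fun _ m' _ => I [] m' := by
  induction l generalizing m with
  | nil => exact Dom.pure h0
  | cons i l ih =>
    change Dom (f i >>= fun _ => l.forM f) m _ _
    exact (hstep i l m List.suffix_rfl h0).bind fun _ m' _ hm' =>
      ih hm' fun i' l' m'' hs => hstep i' l' m'' (hs.trans (List.suffix_cons i l))

lemma Out.loop {ι : Type} {f : ι → Prog K V PUnit} {tr : ι → List Access} {l : List ι}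
    {I : List ι → Mem K V → Prop} {m : Mem K V} (h0 : I l m)
    (hstep : ∀ i l' m, i :: l' <:+ l → I (i :: l') m →
      Out (f i) m fun t _ m' => t = tr i ∧ I l' m') :
    Out (l.forM f) m fun t _ m' => t = l.flatMap tr ∧ I [] m' := by
  induction l generalizing m with
  | nil => exact Out.pure ⟨rfl, h0⟩
  | cons i l ih =>
    change Out (f i >>= fun _ => l.forM f) m _
    refine Out.bind ((hstep i l m List.suffix_rfl h0).mono fun t _ m' ⟨ht, hm'⟩ => ?_)
    refine (ih hm' fun i' l' m'' hs => hstep i' l' m'' (hs.trans (List.suffix_cons i l))).mono ?_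
    rintro t' _ m'' ⟨rfl, h⟩
    exact ⟨by rw [ht, List.flatMap_cons], h⟩

/-- A variant of `Out.loop` that disregards the trace. -/
lemma Out.loop' {ι : Type} {f : ι → Prog K V PUnit} {l : List ι}
    {I : List ι → Mem K V → Prop} {m : Mem K V} (h0 : I l m)
    (hstep : ∀ i l' m, i :: l' <:+ l → I (i :: l') m → Out (f i) m fun _ _ m' => I l' m') :
    Out (l.forM f) m fun _ _ m' => I [] m' := by
  induction l generalizing m with
  | nil => exact Out.pure h0
  | cons i l ih =>
    change Out (f i >>= fun _ => l.forM f) m _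
    refine Out.bind ((hstep i l m List.suffix_rfl h0).mono fun t _ m' hm' => ?_)
    exact ih hm' fun i' l' m'' hs => hstep i' l' m'' (hs.trans (List.suffix_cons i l))

end Logic

/-! ### Elementary memory programs -/

section Memory

variable {K V : Type}

/-- The trace of reading and rewriting the given cells. -/
def touch (L : List Addr) : List Access := L.flatMap fun x => [⟨x, false⟩, ⟨x, true⟩]

/-- The key stored at an address. -/
def keyAt (m : Mem K V) (x : Addr) : Option K := (m x).elem.map Prod.fst

lemma keyAt_eq_none {m : Mem K V} {x : Addr} : keyAt m x = none ↔ (m x).elem = none := by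
  simp [keyAt]

lemma keyAt_of_elem {m : Mem K V} {x : Addr} {e : K × V} (h : (m x).elem = some e) :
    keyAt m x = some e.1 := by
  simp [keyAt, h]

lemma keyAt_eq_some {m : Mem K V} {x : Addr} {κ : K} :
    keyAt m x = some κ ↔ ∃ v, (m x).elem = some (κ, v) := by
  simp [keyAt]

/-- No key is stored twice. -/
def UniqueKeys (m : Mem K V) : Prop :=
  ∀ x y κ, keyAt m x = some κ → keyAt m y = some κ → x = y

/-- The keys in `m'` arise from those in `m` by a permutation of the addresses in `S`. -/
def Moved (S : Set Addr) (m m' : Mem K V) : Prop :=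
  ∃ π : Equiv.Perm Addr, (∀ x, x ∉ S → π x = x) ∧ ∀ x, keyAt m' x = keyAt m (π x)

lemma Moved.refl (S : Set Addr) (m : Mem K V) : Moved S m m := ⟨1, by simp, by simp⟩

lemma Moved.trans {S : Set Addr} {m m' m'' : Mem K V} (h : Moved S m m') (h' : Moved S m' m'') :
    Moved S m m'' := by
  obtain ⟨π, h1, h2⟩ := h
  obtain ⟨ρ, h3, h4⟩ := h'
  refine ⟨π * ρ, fun x hx => ?_, fun x => ?_⟩
  · simp [h3 x hx, h1 x hx]
  · simp [h4, h2]

lemma Moved.mono {S S' : Set Addr} {m m' : Mem K V} (h : Moved S m m') (hS : S ⊆ S') :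
    Moved S' m m' := by
  obtain ⟨π, h1, h2⟩ := h
  exact ⟨π, fun x hx => h1 x fun hx' => hx (hS hx'), h2⟩

lemma Moved.uniqueKeys {S : Set Addr} {m m' : Mem K V} (h : Moved S m m') (hm : UniqueKeys m) :
    UniqueKeys m' := by
  obtain ⟨π, -, h2⟩ := h
  intro x y κ hx hy
  rw [h2] at hx hy
  exact π.injective (hm _ _ _ hx hy)

lemma Moved.keyAt_of_notMem {S : Set Addr} {m m' : Mem K V} (h : Moved S m m') {x : Addr}
    (hx : x ∉ S) : keyAt m' x = keyAt m x := by
  obtain ⟨π, h1, h2⟩ := h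
  rw [h2, h1 x hx]

lemma Moved.exists_mem {S : Set Addr} {m m' : Mem K V} (h : Moved S m m') {x : Addr}
    (hx : x ∈ S) : ∃ x' ∈ S, keyAt m' x' = keyAt m x := by
  obtain ⟨π, h1, h2⟩ := h
  refine ⟨π.symm x, ?_, by simp [h2]⟩
  by_contra hc
  have := h1 _ hc
  rw [Equiv.apply_symm_apply] at this
  rw [← this] at hc
  exact hc hx

lemma out_map_cells {ι : Type} (loc : ι → Addr) (φ : ι → Cell K V → Cell K V) (l : List ι)
    (hl : (l.map loc).Nodup) (m : Mem K V) :
    Out (l.forM fun t => do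
      let y ← Prog.read (loc t)
      Prog.write (loc t) (φ t y)) m fun tr _ m' => tr = touch (l.map loc) ∧
        (∀ t ∈ l, m' (loc t) = φ t (m (loc t))) ∧ ∀ x, x ∉ l.map loc → m' x = m x := by
  induction l generalizing m with
  | nil => exact Out.pure ⟨rfl, by simp, by simp⟩
  | cons t l ih =>
    change Out ((Prog.read (loc t) >>= fun y => Prog.write (loc t) (φ t y)) >>=
      fun _ => l.forM _) m _
    refine Out.bind (Out.bind (Out.read (Out.write ?_)))
    rw [List.map_cons, List.nodup_cons] at hl
    refine (ih hl.2 _).mono ?_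
    rintro tr _ m' ⟨rfl, h1, h2⟩
    refine ⟨rfl, fun s hs => ?_, fun x hx => ?_⟩
    · rcases List.mem_cons.1 hs with rfl | hs
      · rw [h2 _ hl.1, Function.update_self]
      · have hne : loc s ≠ loc t := fun he => hl.1 (he ▸ List.mem_map_of_mem hs)
        rw [h1 s hs, Function.update_of_ne hne]
    · rw [List.map_cons, List.mem_cons, not_or] at hx
      rw [h2 x hx.2, Function.update_of_ne hx.1]

/-- The sorting key used by the comparators of the routing network. -/
def sortKey (h : K → ℕ) (i M : ℕ) (y : Cell K V) : ℕ := cellClass h i y * M + y.prio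

/-- The third clause transfers `IsSortingNetwork`, which speaks of arrays of numbers, to cells; the
second one ensures that no cell is lost or duplicated. -/
lemma out_compareSwap (h : K → ℕ) (i M : ℕ) {loc : ℕ → Addr} (hloc : Function.Injective loc)
    (q : ℕ × ℕ) (hq : q.1 ≠ q.2) (m : Mem K V) :
    Out (compareSwap h i M loc q) m fun tr _ m' =>
      tr = [⟨loc q.1, false⟩, ⟨loc q.2, false⟩, ⟨loc q.1, true⟩, ⟨loc q.2, true⟩] ∧
      (m' = m ∨ m' = fun x => m (Equiv.swap (loc q.1) (loc q.2) x)) ∧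
      (fun t => sortKey h i M (m' (loc t))) =
        compareExchange (fun t => sortKey h i M (m (loc t))) q := by
  have hne : loc q.1 ≠ loc q.2 := fun he => hq (hloc he)
  unfold compareSwap
  refine Out.bind (Out.read (Out.bind (Out.read ?_)))
  split_ifs with hle
  · refine Out.bind (Out.write (Out.write ?_))
    rw [Function.update_eq_self, Function.update_eq_self]
    refine ⟨rfl, Or.inl rfl, ?_⟩
    change sortKey h i M _ ≤ sortKey h i M _ at hle
    funext t
    simp only [compareExchange, min_eq_left hle, max_eq_right hle]
    rw [Function.update_eq_self q.1 fun t => sortKey h i M (m (loc t)),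
      Function.update_eq_self q.2 fun t => sortKey h i M (m (loc t))]
  · refine Out.bind (Out.write (Out.write ?_))
    change ¬ sortKey h i M _ ≤ sortKey h i M _ at hle
    push Not at hle
    refine ⟨rfl, Or.inr ?_, ?_⟩
    · funext x
      by_cases h2 : x = loc q.2
      · subst h2
        simp
      · by_cases h1 : x = loc q.1
        · subst h1
          simp [h2]
        · simp [h1, h2, Equiv.swap_apply_of_ne_of_ne]
    · funext t
      simp only [compareExchange, min_eq_right hle.le, max_eq_left hle.le]
      by_cases h2 : t = q.2
      · subst h2
        simp
      · by_cases h1 : t = q.1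
        · subst h1
          simp [h2, hne]
        · simp [h1, h2, hloc.eq_iff]

/-- The trace of a sorting network. -/
def sortTrace (w : List (ℕ × ℕ)) (loc : ℕ → Addr) : List Access :=
  w.flatMap fun q => [⟨loc q.1, false⟩, ⟨loc q.2, false⟩, ⟨loc q.1, true⟩, ⟨loc q.2, true⟩]

lemma out_sort (h : K → ℕ) (i M : ℕ) {loc : ℕ → Addr} (hloc : Function.Injective loc)
    (w : List (ℕ × ℕ)) (hw : ∀ q ∈ w, q.1 < q.2 ∧ q.2 < M) (m : Mem K V) :
    Out (w.forM (compareSwap h i M loc)) m fun tr _ m' =>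
      tr = sortTrace w loc ∧
      (∃ π : Equiv.Perm Addr, (∀ x, (∀ t < M, x ≠ loc t) → π x = x) ∧ ∀ x, m' x = m (π x)) ∧
      (fun t => sortKey h i M (m' (loc t))) =
        w.foldl compareExchange (fun t => sortKey h i M (m (loc t))) := by
  induction w generalizing m with
  | nil => exact Out.pure ⟨rfl, ⟨1, by simp, by simp⟩, rfl⟩
  | cons q w ih =>
    have hq := hw q List.mem_cons_self
    refine Out.bind ((out_compareSwap h i M hloc q hq.1.ne m).mono ?_)
    rintro tr _ m₁ ⟨rfl, h1, h2⟩
    refine (ih (fun q' hq' => hw q' (List.mem_cons_of_mem _ hq')) m₁).mono ?_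
    rintro tr _ m₂ ⟨rfl, ⟨π, h3, h4⟩, h5⟩
    refine ⟨rfl, ?_, by rw [h5, h2]; rfl⟩
    rcases h1 with rfl | rfl
    · exact ⟨π, h3, h4⟩
    · refine ⟨Equiv.swap (loc q.1) (loc q.2) * π, fun x hx => ?_, fun x => h4 x⟩
      rw [Equiv.Perm.mul_apply, h3 x hx, Equiv.swap_apply_of_ne_of_ne]
      · exact hx _ (hq.1.trans hq.2)
      · exact hx _ hq.2

end Memory

/-! ### The routing network -/

section Routing

variable {K V : Type}

/-- The slots of a pair of buckets as one range. -/
def pairLoc (id j c b₀ b₁ : ℕ) : ℕ → Addr := fun t =>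
  if t < c then Addr.table id j b₀ t else Addr.table id j b₁ (t - c)

lemma pairLoc_injective (id j c : ℕ) {b₀ b₁ : ℕ} (hb : b₀ ≠ b₁) :
    Function.Injective (pairLoc id j c b₀ b₁) := by
  intro s t hst
  unfold pairLoc at hst
  split_ifs at hst with h1 h2 h2
  · simpa using hst
  · simp [hb] at hst
  · simp [hb.symm] at hst
  · simp only [Addr.table.injEq, true_and] at hst
    omega

/-- The trace of the re-partition of a pair of buckets. -/
def repartitionTrace (w : List (ℕ × ℕ)) (id j c b₀ b₁ : ℕ) : List Access :=
  touch ((List.finRange (2 * c)).map fun t : Fin (2 * c) => pairLoc id j c b₀ b₁ t) ++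
    (sortTrace w (pairLoc id j c b₀ b₁) ++
      touch ((List.range (2 * c)).map (pairLoc id j c b₀ b₁)))

lemma cellClass_eq_zero {h : K → ℕ} {i : ℕ} {y : Cell K V} :
    cellClass h i y = 0 ↔ ∃ e, y.elem = some e ∧ y.tag = true ∧ (h e.1).testBit i = false := by
  unfold cellClass
  rcases y with ⟨_ | e, tg, pr⟩
  · simp
  · rcases tg with _ | _ <;> cases hb : (h e.1).testBit i <;> simp [hb]

lemma cellClass_eq_two {h : K → ℕ} {i : ℕ} {y : Cell K V} :
    cellClass h i y = 2 ↔ ∃ e, y.elem = some e ∧ y.tag = true ∧ (h e.1).testBit i = true := by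
  unfold cellClass
  rcases y with ⟨_ | e, tg, pr⟩
  · simp
  · rcases tg with _ | _ <;> cases hb : (h e.1).testBit i <;> simp [hb]

lemma cellClass_le_two {h : K → ℕ} {i : ℕ} {y : Cell K V} : cellClass h i y ≤ 2 := by
  unfold cellClass
  rcases y with ⟨_ | e, tg, pr⟩
  · simp
  · rcases tg with _ | _ <;> cases hb : (h e.1).testBit i <;> simp [hb]

/-- Many different keys with the same `i`-th bit of the destination are live in the cells `S`. -/
def Crowded (m : Mem K V) (S : Set Addr) (h : K → ℕ) (i c : ℕ) (κ : K) : Prop :=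
  ∃ Y : Finset K, c + 1 ≤ Y.card ∧ κ ∈ Y ∧ ∀ κ' ∈ Y, (h κ').testBit i = (h κ).testBit i ∧
    ∃ x ∈ S, ∃ v, (m x).elem = some (κ', v) ∧ (m x).tag = true

/-- Unique keys turn distinct positions into distinct keys. Crowds are counted in keys because the
hash values, and with them the probabilities, belong to keys. -/
lemma crowded_of_positions {m : Mem K V} (hm : UniqueKeys m) {loc : ℕ → Addr}
    (hloc : Function.Injective loc) {M : ℕ} {h : K → ℕ} {i c : ℕ} {bv : Bool} (P : Finset ℕ)
    (hP : c + 1 ≤ P.card) (hPM : ∀ t ∈ P, t < M)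
    (hc : ∀ t ∈ P, ∃ e, (m (loc t)).elem = some e ∧ (m (loc t)).tag = true ∧
      (h e.1).testBit i = bv)
    {t : ℕ} (ht : t ∈ P) {e : K × V} (he : (m (loc t)).elem = some e) :
    Crowded m {x | ∃ t < M, x = loc t} h i c e.1 := by
  classical
  have hc' : ∀ t : P, ∃ e, (m (loc t)).elem = some e ∧ (m (loc t)).tag = true ∧
      (h e.1).testBit i = bv := fun t => hc t t.2
  choose f hf1 hf2 hf3 using hc'
  have hfe : f ⟨t, ht⟩ = e := Option.some_injective _ ((hf1 ⟨t, ht⟩).symm.trans he)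
  have hinj : Function.Injective fun t : P => (f t).1 := fun s s' hss => by
    have h1 := keyAt_of_elem (hf1 s)
    have h2 := keyAt_of_elem (hf1 s')
    exact Subtype.ext (hloc (hm _ _ (f s).1 h1 (h2.trans (by simp at hss; simp [hss]))))
  refine ⟨Finset.univ.image fun t : P => (f t).1, ?_, ?_, ?_⟩
  · rw [Finset.card_image_of_injective _ hinj, Finset.card_univ, Fintype.card_coe]
    exact hP
  · exact Finset.mem_image.2 ⟨⟨t, ht⟩, Finset.mem_univ _, by rw [hfe]⟩
  · intro κ' hκ'
    obtain ⟨s, -, rfl⟩ := Finset.mem_image.1 hκ'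
    refine ⟨by rw [hf3 s, ← hfe, hf3], loc s, ⟨s, hPM s s.2, rfl⟩, (f s).2, hf1 s, hf2 s⟩

/-- After sorting, live elements with bit 0 form an initial segment of the `2 * c` slots and those
with bit 1 a final segment. One of them is in the wrong half only if its class fills the right half
and at least one more slot, which gives `c + 1` competitors. The random order inside a class has no
influence on this. -/
lemma out_repartition {w : List (ℕ × ℕ)} {c : ℕ} (hw : IsSortingNetwork w (2 * c))
    (id j : ℕ) (h : K → ℕ) (i : ℕ) {b₀ b₁ : ℕ} (hb : b₀ ≠ b₁) {m : Mem K V} (hm : UniqueKeys m) :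
    Out (repartition w id j c h i b₀ b₁) m fun tr _ m' =>
      tr = repartitionTrace w id j c b₀ b₁ ∧
      Moved {x | ∃ t < 2 * c, x = pairLoc id j c b₀ b₁ t} m m' ∧
      (∀ x, x ∉ {x | ∃ t < 2 * c, x = pairLoc id j c b₀ b₁ t} → m' x = m x) ∧
      ∀ t < 2 * c, ∀ e, (m' (pairLoc id j c b₀ b₁ t)).elem = some e →
        ∃ s < 2 * c, (m (pairLoc id j c b₀ b₁ s)).elem = some e ∧
          ((m' (pairLoc id j c b₀ b₁ t)).tag = true →
            (m (pairLoc id j c b₀ b₁ s)).tag = true ∧ ((h e.1).testBit i = true ↔ c ≤ t)) ∧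
          ((m' (pairLoc id j c b₀ b₁ t)).tag = false →
            (m (pairLoc id j c b₀ b₁ s)).tag = false ∨
            (m (pairLoc id j c b₀ b₁ s)).tag = true ∧
            Crowded m {x | ∃ t < 2 * c, x = pairLoc id j c b₀ b₁ t} h i c e.1) := by
  classical
  have hloc := pairLoc_injective id j c hb
  set loc := pairLoc id j c b₀ b₁ with hlocdef
  set S : Set Addr := {x | ∃ t < 2 * c, x = loc t} with hS
  have hSmem : ∀ t < 2 * c, loc t ∈ S := fun t ht => ⟨t, ht, rfl⟩
  have hnotS : ∀ x, x ∉ S → ∀ t < 2 * c, x ≠ loc t := fun x hx t ht he => hx ⟨t, ht, he⟩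
  unfold repartition
  refine Out.bind (Out.sample fun σ => Out.bind ?_)
  have hnd : ((List.finRange (2 * c)).map fun t : Fin (2 * c) => loc t).Nodup :=
    (List.nodup_finRange _).map (hloc.comp Fin.val_injective)
  refine (out_map_cells (fun t : Fin (2 * c) => loc t)
    (fun t y => { y with prio := (σ t : ℕ) }) _ hnd m).mono ?_
  rintro tr₁ _ m₁ ⟨rfl, h1, h2⟩
  have hloc1 : ∀ t < 2 * c, m₁ (loc t) = { m (loc t) with prio := (m₁ (loc t)).prio } ∧
      (m₁ (loc t)).prio < 2 * c := fun t ht => by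
    have := h1 ⟨t, ht⟩ (List.mem_finRange _)
    simp only at this
    rw [this]
    exact ⟨rfl, (σ ⟨t, ht⟩).2⟩
  have hout1 : ∀ x, x ∉ S → m₁ x = m x := fun x hx => h2 x fun hx' => by
    obtain ⟨t, -, rfl⟩ := List.mem_map.1 hx'
    exact hx (hSmem t t.2)
  have helem1 : ∀ x, (m₁ x).elem = (m x).elem ∧ (m₁ x).tag = (m x).tag := fun x => by
    by_cases hx : x ∈ S
    · obtain ⟨t, ht, rfl⟩ := hx
      rw [(hloc1 t ht).1]
      exact ⟨rfl, rfl⟩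
    · rw [hout1 x hx]
      exact ⟨rfl, rfl⟩
  refine Out.bind ((out_sort h i (2 * c) hloc w hw.1 m₁).mono ?_)
  rintro tr₂ _ m₂ ⟨rfl, ⟨π, h3, h4⟩, h5⟩
  have hπS : ∀ x ∈ S, π x ∈ S := fun x hx => by
    by_contra hc
    have := π.injective (h3 (π x) (hnotS _ hc))
    rw [this] at hc
    exact hc hx
  -- Priorities are below `2 * c`, so the class is the leading digit of the sorting key in base `2 *
  -- c`, and sorted keys give sorted classes.
  have hsorted : ∀ s t, s ≤ t → t < 2 * c →
      cellClass h i (m₂ (loc s)) ≤ cellClass h i (m₂ (loc t)) := by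
    intro s t hst ht
    have hkey := hw.2 (fun t => sortKey h i (2 * c) (m₁ (loc t))) s t hst ht
    rw [← h5] at hkey
    simp only [sortKey] at hkey
    have hp : (m₂ (loc t)).prio < 2 * c := by
      obtain ⟨t', ht', he⟩ := hπS _ (hSmem t ht)
      rw [h4, he]
      exact (hloc1 t' ht').2
    by_contra hlt
    push Not at hlt
    have := Nat.mul_le_mul_right (2 * c) (Nat.succ_le_of_lt hlt)
    rw [Nat.succ_mul] at this
    omega
  have hmoved1 : Moved S m m₂ := by
    refine ⟨π, fun x hx => h3 x (hnotS x hx), fun x => ?_⟩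
    unfold keyAt
    rw [h4, (helem1 _).1]
  have hm₂ := hmoved1.uniqueKeys hm
  have hnd' : ((List.range (2 * c)).map loc).Nodup := List.nodup_range.map hloc
  -- Both branches write a function of the cell just read, which is the form required by
  -- `out_map_cells`.
  have hprog : ∀ t, (do
      let y ← Prog.read (loc t)
      if (cellClass h i y = 0 ∧ c ≤ t) ∨ (cellClass h i y = 2 ∧ t < c) then
        Prog.write (loc t) { y with tag := false }
      else
        Prog.write (loc t) y : Prog K V Unit) = (do
      let y ← Prog.read (loc t)
      Prog.write (loc t) (if (cellClass h i y = 0 ∧ c ≤ t) ∨ (cellClass h i y = 2 ∧ t < c) then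
        { y with tag := false } else y)) := fun t => by
    congr 1
    funext y
    split_ifs <;> rfl
  have hmap := out_map_cells loc (fun t (y : Cell K V) =>
    if (cellClass h i y = 0 ∧ c ≤ t) ∨ (cellClass h i y = 2 ∧ t < c) then
      { y with tag := false } else y) _ hnd' m₂
  simp only [← hprog] at hmap
  refine hmap.mono ?_
  rintro tr₃ _ m₃ ⟨rfl, h6, h7⟩
  have hout3 : ∀ x, x ∉ S → m₃ x = m₂ x := fun x hx => h7 x fun hx' => by
    obtain ⟨t, ht, rfl⟩ := List.mem_map.1 hx'
    exact hx (hSmem t (List.mem_range.1 ht))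
  have helem3 : ∀ x, (m₃ x).elem = (m₂ x).elem := fun x => by
    by_cases hx : x ∈ S
    · obtain ⟨t, ht, rfl⟩ := hx
      rw [h6 t (List.mem_range.2 ht)]
      split_ifs <;> rfl
    · rw [hout3 x hx]
  refine ⟨by rw [List.nil_append, repartitionTrace], ?_, ?_, ?_⟩
  · obtain ⟨ρ, h8, h9⟩ := hmoved1
    refine ⟨ρ, h8, fun x => ?_⟩
    rw [← h9]
    unfold keyAt
    rw [helem3]
  · intro x hx
    rw [hout3 x hx, h4, h3 x (hnotS x hx), hout1 x hx]
  · intro t ht e he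
    rw [helem3] at he
    obtain ⟨s, hs, hse⟩ := hπS _ (hSmem t ht)
    have hcell : m₂ (loc t) = m₁ (loc s) := by rw [h4, hse]
    have hes : (m (loc s)).elem = some e := by rw [← (helem1 _).1, ← hcell, he]
    have htag : (m₂ (loc t)).tag = (m (loc s)).tag := by rw [hcell, (helem1 _).2]
    refine ⟨s, hs, hes, ?_, ?_⟩
    · intro htr
      rw [h6 t (List.mem_range.2 ht)] at htr
      split_ifs at htr with hcond
      rw [← htag]
      refine ⟨htr, ?_⟩
      push Not at hcond
      constructor
      · intro hbit
        exact hcond.2 (cellClass_eq_two.2 ⟨e, he, htr, hbit⟩)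
      · intro hct
        by_contra hbit
        have := hcond.1 (cellClass_eq_zero.2 ⟨e, he, htr, by simpa using hbit⟩)
        omega
    · intro htr
      rw [h6 t (List.mem_range.2 ht)] at htr
      split_ifs at htr with hcond
      · right
        have hcrowd : Crowded m₂ S h i c e.1 ∧ (m₂ (loc t)).tag = true := by
          rcases hcond with ⟨h0, hct⟩ | ⟨h2', hct⟩
          -- Class 0 at a position `t ≥ c` forces class 0 on the whole first bucket, hence on `c +
          -- 1` positions. The other case is symmetric, with the second bucket and `t < c`.
          · refine ⟨crowded_of_positions hm₂ hloc (bv := false) (insert t (Finset.range c))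
              ?_ ?_ ?_ (Finset.mem_insert_self _ _) he, ?_⟩
            · rw [Finset.card_insert_of_notMem (by simpa using hct), Finset.card_range]
            · intro s hs
              rcases Finset.mem_insert.1 hs with rfl | hs
              · exact ht
              · have := Finset.mem_range.1 hs
                omega
            · intro s hs
              have hst : s ≤ t := by
                rcases Finset.mem_insert.1 hs with rfl | hs
                · exact le_rfl
                · have := Finset.mem_range.1 hs
                  omega
              refine cellClass_eq_zero.1 (Nat.le_zero.1 ?_)
              rw [← h0]
              exact hsorted s t hst ht
            · obtain ⟨_, _, h, _⟩ := cellClass_eq_zero.1 h0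
              exact h
          · refine ⟨crowded_of_positions hm₂ hloc (bv := true) (insert t (Finset.Ico c (2 * c)))
              ?_ ?_ ?_ (Finset.mem_insert_self _ _) he, ?_⟩
            · rw [Finset.card_insert_of_notMem (by simp; omega), Nat.card_Ico]
              omega
            · intro s hs
              rcases Finset.mem_insert.1 hs with rfl | hs
              · exact ht
              · exact (Finset.mem_Ico.1 hs).2
            · intro s hs
              have hst : t ≤ s ∧ s < 2 * c := by
                rcases Finset.mem_insert.1 hs with rfl | hs
                · exact ⟨le_rfl, ht⟩
                · have := Finset.mem_Ico.1 hs
                  omega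
              refine cellClass_eq_two.1 (le_antisymm cellClass_le_two ?_)
              rw [← h2']
              exact hsorted t s hst.1 hst.2
            · obtain ⟨_, _, h, _⟩ := cellClass_eq_two.1 h2'
              exact h
        refine ⟨htag ▸ hcrowd.2, ?_⟩
        obtain ⟨Y, hY1, hY2, hY3⟩ := hcrowd.1
        refine ⟨Y, hY1, hY2, fun κ' hκ' => ⟨(hY3 κ' hκ').1, ?_⟩⟩
        obtain ⟨-, x, hx, v, hv1, hv2⟩ := hY3 κ' hκ'
        refine ⟨π x, hπS x hx, v, ?_, ?_⟩
        · rw [← (helem1 _).1, ← h4, hv1]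
        · rw [← (helem1 _).2, ← h4, hv2]
      · left
        rw [← htag, htr]

end Routing

/-! ### Bits of bucket indices, and invariants of the routing network -/

section Routing

variable {K V : Type}

lemma testBit_add_two_pow {b i : ℕ} (hb : b.testBit i = false) (r : ℕ) :
    (b + 2 ^ i).testBit r = if r = i then true else b.testBit r := by
  rcases lt_trichotomy r i with h | h | h
  · rw [if_neg h.ne, add_comm, Nat.testBit_two_pow_add_gt h]
  · subst h
    rw [if_pos rfl, add_comm, Nat.testBit_two_pow_add_eq, hb]
    rfl
  · rw [if_neg h.ne']
    obtain ⟨q, rfl⟩ := Nat.exists_eq_add_of_lt h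
    have h1 : ∀ x : ℕ, x.testBit (i + q + 1) = (x / 2 ^ (i + 1)).testBit q := fun x => by
      rw [Nat.testBit_div_two_pow]
      congr 1
      omega
    rw [h1, h1]
    congr 1
    rw [Nat.testBit_eq_decide_div_mod_eq, decide_eq_false_iff_not] at hb
    rw [pow_succ, ← Nat.div_div_eq_div_mul, ← Nat.div_div_eq_div_mul,
      Nat.add_div_right _ (by positivity)]
    omega

lemma add_two_pow_lt {b i d : ℕ} (hi : i < d) (hb : b.testBit i = false) (hbd : b < 2 ^ d) :
    b + 2 ^ i < 2 ^ d := by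
  refine Nat.lt_pow_two_of_testBit _ fun r hr => ?_
  rw [testBit_add_two_pow hb, if_neg (by omega)]
  exact Nat.testBit_lt_two_pow (hbd.trans_le (Nat.pow_le_pow_right (by norm_num) hr))

/-- The index `b` with bit `i` cleared. -/
def clearBit (i b : ℕ) : ℕ := if b.testBit i then b - 2 ^ i else b

lemma clearBit_add {i b : ℕ} (hb : b.testBit i = true) : clearBit i b + 2 ^ i = b := by
  rw [clearBit, if_pos hb]
  exact Nat.sub_add_cancel (Nat.ge_two_pow_of_testBit hb)

lemma testBit_clearBit (i b : ℕ) : (clearBit i b).testBit i = false := by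
  cases hb : b.testBit i
  · rwa [clearBit, if_neg (by simp [hb])]
  · have h := clearBit_add hb
    have h2 := Nat.testBit_two_pow_add_eq (clearBit i b) i
    rw [add_comm, h, hb] at h2
    simpa using h2

lemma clearBit_of_testBit {i b : ℕ} (hb : b.testBit i = false) : clearBit i b = b := by
  rw [clearBit, if_neg (by simp [hb])]

lemma clearBit_add_two_pow {i b : ℕ} (hb : b.testBit i = false) :
    clearBit i (b + 2 ^ i) = b := by
  rw [clearBit, if_pos (by rw [testBit_add_two_pow hb, if_pos rfl]), Nat.add_sub_cancel]

lemma clearBit_le (i b : ℕ) : clearBit i b ≤ b := by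
  unfold clearBit
  split_ifs
  · exact Nat.sub_le _ _
  · exact le_rfl

/-- The cells of a table. -/
def tableSet (id j d c : ℕ) : Set Addr := {x | ∃ b < 2 ^ d, ∃ s < c, x = Addr.table id j b s}

/-- Live elements of a bucket satisfy `P` and the others satisfy `Bad`. -/
def BucketInv (m : Mem K V) (id j c b : ℕ) (P Bad : K → Prop) : Prop :=
  ∀ s < c, ∀ e, (m (Addr.table id j b s)).elem = some e →
    ((m (Addr.table id j b s)).tag = true → P e.1) ∧
    ((m (Addr.table id j b s)).tag = false → Bad e.1)

/-- The trace of the routing network. -/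
def routeTrace (w : List (ℕ × ℕ)) (id j d c : ℕ) : List Access :=
  (List.range d).flatMap fun i =>
    ((List.range (2 ^ d)).filter fun b => !b.testBit i).flatMap fun b =>
      repartitionTrace w id j c b (b + 2 ^ i)

/-- `At i b κ` is any notion of `κ` being possibly live in bucket `b` after `i` stages, and `Bad`
any property of the keys that may have lost their tag. The generality serves two purposes: correct
placement in `dom_build`, where `Bad` is trivial, and control of the overflow in `out_build`. -/
lemma out_stage {w : List (ℕ × ℕ)} {c : ℕ} (hw : IsSortingNetwork w (2 * c))
    (id j d : ℕ) (h : K → ℕ) (At : ℕ → ℕ → K → Prop) (Bad : K → Prop) {i : ℕ} (hi : i < d)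
    (htrans : ∀ b b' κ, At i b κ → b'.testBit i = (h κ).testBit i →
      (∀ r, r ≠ i → b'.testBit r = b.testBit r) → At (i + 1) b' κ)
    (hcol : ∀ b < 2 ^ d, ∀ Y : Finset K, c + 1 ≤ Y.card → (∀ κ ∈ Y, At (i + 1) b κ) →
      ∀ κ ∈ Y, Bad κ)
    {m : Mem K V} (hm : UniqueKeys m)
    (hinv : ∀ b < 2 ^ d, BucketInv m id j c b (At i b) Bad) :
    Out (((List.range (2 ^ d)).filter fun b => !b.testBit i).forM fun b =>
      repartition w id j c h i b (b + 2 ^ i)) m fun tr _ m' =>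
      tr = (((List.range (2 ^ d)).filter fun b => !b.testBit i).flatMap fun b =>
        repartitionTrace w id j c b (b + 2 ^ i)) ∧
      Moved (tableSet id j d c) m m' ∧ (∀ x, x ∉ tableSet id j d c → m' x = m x) ∧
      ∀ b < 2 ^ d, BucketInv m' id j c b (At (i + 1) b) Bad := by
  set l := (List.range (2 ^ d)).filter fun b => !b.testBit i with hl
  have hnd : l.Nodup := List.nodup_range.filter _
  have hmem : ∀ b, b ∈ l ↔ b < 2 ^ d ∧ b.testBit i = false := fun b => by simp [hl]
  -- A pair of buckets is named by its index with bit `i` cleared. Pairs still in the loop satisfy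
  -- the invariant of stage `i`, finished pairs that of stage `i + 1`.
  refine (Out.loop (tr := fun b => repartitionTrace w id j c b (b + 2 ^ i))
    (I := fun l' m' => UniqueKeys m' ∧ Moved (tableSet id j d c) m m' ∧
      (∀ x, x ∉ tableSet id j d c → m' x = m x) ∧
      ∀ b < 2 ^ d, BucketInv m' id j c b (fun κ => if clearBit i b ∈ l' then At i b κ
        else At (i + 1) b κ) Bad) ?_ ?_).mono ?_
  · refine ⟨hm, Moved.refl _ _, fun _ _ => rfl, fun b hb => ?_⟩
    have : clearBit i b ∈ l :=
      (hmem _).2 ⟨(clearBit_le i b).trans_lt hb, testBit_clearBit i b⟩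
    simpa only [this, if_true] using hinv b hb
  · rintro b₀ l' m₁ hs ⟨hm₁, hmv, hout, hb⟩
    obtain ⟨hb0, hbit⟩ := (hmem b₀).1 (hs.subset List.mem_cons_self)
    have hb0l : b₀ ∉ l' := (List.nodup_cons.1 (hs.sublist.nodup hnd)).1
    have hb1 := add_two_pow_lt hi hbit hb0
    have hbits := testBit_add_two_pow hbit
    set b₁ := b₀ + 2 ^ i with hb1def
    have hne : b₀ ≠ b₁ := by
      have : 0 < 2 ^ i := by positivity
      omega
    refine (out_repartition hw id j h i hne hm₁).mono ?_
    rintro tr _ m₂ ⟨rfl, h1, h2, h3⟩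
    have hsub : {x | ∃ t < 2 * c, x = pairLoc id j c b₀ b₁ t} ⊆ tableSet id j d c := by
      rintro x ⟨t, ht, rfl⟩
      unfold pairLoc
      split_ifs with htc
      · exact ⟨b₀, hb0, t, htc, rfl⟩
      · exact ⟨b₁, hb1, t - c, by omega, rfl⟩
    -- every live element of the pair satisfies the invariant of the stage
    have hsrc : ∀ t < 2 * c, ∀ e, (m₁ (pairLoc id j c b₀ b₁ t)).elem = some e →
        ((m₁ (pairLoc id j c b₀ b₁ t)).tag = true → ∃ b, At i b e.1 ∧
          ∀ r, r ≠ i → b₀.testBit r = b.testBit r) ∧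
        ((m₁ (pairLoc id j c b₀ b₁ t)).tag = false → Bad e.1) := by
      intro t ht e he
      unfold pairLoc at he ⊢
      by_cases htc : t < c
      · rw [if_pos htc] at he ⊢
        have := hb b₀ hb0 t htc e he
        simp only [clearBit_of_testBit hbit, List.mem_cons_self, if_true] at this
        exact ⟨fun ht => ⟨b₀, this.1 ht, fun _ _ => rfl⟩, this.2⟩
      · rw [if_neg htc] at he ⊢
        have := hb b₁ hb1 (t - c) (by omega) e he
        simp only [hb1def, clearBit_add_two_pow hbit, List.mem_cons_self, if_true] at this
        refine ⟨fun ht => ⟨b₁, this.1 ht, fun r hr => ?_⟩, this.2⟩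
        rw [hbits, if_neg hr]
    have hnext : ∀ (b' : ℕ) (κ : K), (∃ b, At i b κ ∧ ∀ r, r ≠ i → b₀.testBit r = b.testBit r) →
        b'.testBit i = (h κ).testBit i → (∀ r, r ≠ i → b'.testBit r = b₀.testBit r) →
        At (i + 1) b' κ := by
      rintro b' κ ⟨b, hb, hr⟩ hbi hr'
      exact htrans b b' κ hb hbi fun r hri => (hr' r hri).trans (hr r hri)
    -- The common bit of the competitors selects one bucket `b'` of the pair to which all of them
    -- could go, so `hcol` applies to `b'`.
    have hbad : ∀ κ, Crowded m₁ {x | ∃ t < 2 * c, x = pairLoc id j c b₀ b₁ t} h i c κ →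
        Bad κ := by
      rintro κ ⟨Y, hY1, hY2, hY3⟩
      obtain ⟨b', hb', hbi, hr⟩ : ∃ b' < 2 ^ d, b'.testBit i = (h κ).testBit i ∧
          ∀ r, r ≠ i → b'.testBit r = b₀.testBit r := by
        cases hκ : (h κ).testBit i
        · exact ⟨b₀, hb0, hbit, fun _ _ => rfl⟩
        · exact ⟨b₁, hb1, by rw [hbits, if_pos rfl], fun r hr => by rw [hbits, if_neg hr]⟩
      refine hcol b' hb' Y hY1 (fun κ' hκ' => ?_) κ hY2
      obtain ⟨hk, x, ⟨t, ht, rfl⟩, v, hv1, hv2⟩ := hY3 κ' hκ'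
      exact hnext b' κ' ((hsrc t ht _ hv1).1 hv2) (hbi.trans hk.symm) hr
    have hpair : ∀ t < 2 * c, ∀ e, (m₂ (pairLoc id j c b₀ b₁ t)).elem = some e →
        ((m₂ (pairLoc id j c b₀ b₁ t)).tag = true →
          At (i + 1) (if t < c then b₀ else b₁) e.1) ∧
        ((m₂ (pairLoc id j c b₀ b₁ t)).tag = false → Bad e.1) := by
      intro t ht e he
      obtain ⟨s, hs, hse, h4, h5⟩ := h3 t ht e he
      refine ⟨fun htag => ?_, fun htag => ?_⟩
      · obtain ⟨h6, h7⟩ := h4 htag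
        refine hnext _ _ ((hsrc s hs e hse).1 h6) ?_ ?_
        · split_ifs with htc
          · rw [hbit]
            cases hk : (h e.1).testBit i
            · rfl
            · exact absurd (h7.1 hk) (by omega)
          · rw [hbits, if_pos rfl, h7.2 (by omega)]
        · intro r hr
          split_ifs
          · rfl
          · rw [hbits, if_neg hr]
      · rcases h5 htag with h6 | ⟨-, h6⟩
        · exact (hsrc s hs e hse).2 h6
        · exact hbad _ h6
    refine ⟨rfl, h1.uniqueKeys hm₁, hmv.trans (h1.mono hsub), fun x hx => ?_, ?_⟩
    · rw [h2 x fun hx' => hx (hsub hx'), hout x hx]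
    · intro b hbd s hsc
      by_cases hcb : clearBit i b = b₀
      · intro e
        simp only [hcb, hb0l, if_false]
        revert e
        cases hbb : b.testBit i
        · rw [clearBit_of_testBit hbb] at hcb
          subst hcb
          intro e
          have := hpair s (by omega) e
          simp only [pairLoc, if_pos hsc] at this
          exact this
        · have hbe := clearBit_add hbb
          rw [hcb, ← hb1def] at hbe
          subst hbe
          intro e
          have := hpair (s + c) (by omega) e
          simp only [pairLoc, if_neg (show ¬ s + c < c by omega), Nat.add_sub_cancel] at this
          exact this
      · have hsame : m₂ (Addr.table id j b s) = m₁ (Addr.table id j b s) := by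
          refine h2 _ ?_
          rintro ⟨t, ht, hte⟩
          unfold pairLoc at hte
          split_ifs at hte
          · simp only [Addr.table.injEq, true_and] at hte
            exact hcb (by rw [hte.1, clearBit_of_testBit hbit])
          · simp only [Addr.table.injEq, true_and] at hte
            exact hcb (by rw [hte.1, clearBit_add_two_pow hbit])
        have := hb b hbd s hsc
        rw [hsame]
        simpa only [List.mem_cons, hcb, false_or] using this
  · rintro tr _ m' ⟨rfl, h1, h2, h3, h4⟩
    exact ⟨rfl, h2, h3, by simpa using h4⟩

lemma out_route {w : List (ℕ × ℕ)} {c : ℕ} (hw : IsSortingNetwork w (2 * c))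
    (id j d : ℕ) (h : K → ℕ) (At : ℕ → ℕ → K → Prop) (Bad : K → Prop)
    (htrans : ∀ i < d, ∀ b b' κ, At i b κ → b'.testBit i = (h κ).testBit i →
      (∀ r, r ≠ i → b'.testBit r = b.testBit r) → At (i + 1) b' κ)
    (hcol : ∀ i < d, ∀ b < 2 ^ d, ∀ Y : Finset K, c + 1 ≤ Y.card →
      (∀ κ ∈ Y, At (i + 1) b κ) → ∀ κ ∈ Y, Bad κ)
    {m : Mem K V} (hm : UniqueKeys m)
    (hinv : ∀ b < 2 ^ d, BucketInv m id j c b (At 0 b) Bad) :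
    Out (route w id j d c h) m fun tr _ m' =>
      tr = routeTrace w id j d c ∧
      Moved (tableSet id j d c) m m' ∧ (∀ x, x ∉ tableSet id j d c → m' x = m x) ∧
      ∀ b < 2 ^ d, BucketInv m' id j c b (At d b) Bad := by
  -- The number of remaining iterations determines the current stage.
  have hsuff : ∀ i l', i :: l' <:+ List.range d → i + (i :: l').length = d := by
    rintro i l' ⟨l, hl⟩
    have h1 := congrArg List.length hl
    have h2 := congrArg (fun l => l[l.length - (l'.length + 1)]?) hl
    simp only [List.length_append, List.length_cons, List.length_range] at h1 h2
    rw [Nat.add_sub_cancel, List.getElem?_append_right le_rfl, Nat.sub_self,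
      List.getElem?_cons_zero, List.getElem?_range (by omega)] at h2
    simp only [Option.some.injEq] at h2
    simp only [List.length_cons]
    omega
  unfold route
  refine (Out.loop (tr := fun i => ((List.range (2 ^ d)).filter fun b => !b.testBit i).flatMap
      fun b => repartitionTrace w id j c b (b + 2 ^ i))
    (I := fun l' m' => UniqueKeys m' ∧ Moved (tableSet id j d c) m m' ∧
      (∀ x, x ∉ tableSet id j d c → m' x = m x) ∧
      ∀ b < 2 ^ d, BucketInv m' id j c b (At (d - l'.length) b) Bad) ?_ ?_).mono ?_
  · refine ⟨hm, Moved.refl _ _, fun _ _ => rfl, fun b hb => ?_⟩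
    simpa using hinv b hb
  · rintro i l' m₁ hs ⟨hm₁, hmv, hout, hb⟩
    have hlen := hsuff i l' hs
    have hid : i < d := by simp at hlen; omega
    rw [show d - (i :: l').length = i by omega] at hb
    refine (out_stage hw id j d h At Bad hid (htrans i hid) (hcol i hid) hm₁ hb).mono ?_
    rintro tr _ m₂ ⟨rfl, h1, h2, h3⟩
    refine ⟨rfl, h1.uniqueKeys hm₁, hmv.trans h1, fun x hx => by rw [h2 x hx, hout x hx], ?_⟩
    rw [show d - l'.length = i + 1 by simp at hlen; omega]
    exact h3
  · rintro tr _ m' ⟨rfl, h1, h2, h3, h4⟩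
    exact ⟨rfl, h2, h3, by simpa using h4⟩

end Routing

/-! ### Throwing elements into tables -/

section Throw

variable {K V : Type}

lemma out_insert_none (L : List Addr) (m : Mem K V) :
    Out (L.foldlM insertSlot none) m fun tr rest m' => tr = touch L ∧ rest = none ∧ m' = m := by
  induction L generalizing m with
  | nil => exact Out.pure ⟨rfl, rfl, rfl⟩
  | cons x L ih =>
    rw [List.foldlM_cons]
    refine Out.bind ?_
    unfold insertSlot
    refine Out.bind (Out.read (Out.bind (Out.write (Out.pure ?_))))
    rw [Function.update_eq_self]
    refine (ih m).mono ?_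
    rintro tr rest m' ⟨rfl, rfl, rfl⟩
    exact ⟨rfl, rfl, rfl⟩

lemma out_insertSlot_of_full {e : K × V} {x : Addr} {m : Mem K V} (hx : (m x).elem ≠ none) :
    Out (insertSlot (some e) x) m fun tr rest m' => tr = touch [x] ∧ rest = some e ∧ m' = m := by
  unfold insertSlot
  refine Out.bind (Out.read ?_)
  split
  · rename_i h
    exact absurd h hx
  · refine Out.bind (Out.write (Out.pure ?_))
    rw [Function.update_eq_self]
    exact ⟨rfl, rfl, rfl⟩

lemma out_insert_full {e : K × V} {L : List Addr} {m : Mem K V}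
    (hL : ∀ x ∈ L, (m x).elem ≠ none) :
    Out (L.foldlM insertSlot (some e)) m fun tr rest m' =>
      tr = touch L ∧ rest = some e ∧ m' = m := by
  induction L with
  | nil => exact Out.pure ⟨rfl, rfl, rfl⟩
  | cons x L ih =>
    rw [List.foldlM_cons]
    refine Out.bind ((out_insertSlot_of_full (hL x List.mem_cons_self)).mono ?_)
    rintro tr rest m' ⟨rfl, rfl, rfl⟩
    refine (ih fun y hy => hL y (List.mem_cons_of_mem _ hy)).mono ?_
    rintro tr rest m' ⟨rfl, rfl, rfl⟩
    exact ⟨rfl, rfl, rfl⟩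

lemma out_insert_free {e : K × V} {pre post : List Addr} {y : Addr} {m : Mem K V}
    (hpre : ∀ x ∈ pre, (m x).elem ≠ none) (hy : (m y).elem = none) :
    Out ((pre ++ y :: post).foldlM insertSlot (some e)) m fun tr rest m' =>
      tr = touch (pre ++ y :: post) ∧ rest = none ∧
        m' = Function.update m y ⟨some e, true, 0⟩ := by
  induction pre with
  | nil =>
    rw [List.nil_append, List.foldlM_cons]
    refine Out.bind ?_
    unfold insertSlot
    refine Out.bind (Out.read ?_)
    rw [hy]
    refine Out.bind (Out.write (Out.pure ?_))
    refine (out_insert_none post _).mono ?_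
    rintro tr rest m' ⟨rfl, rfl, rfl⟩
    exact ⟨rfl, rfl, rfl⟩
  | cons x pre ih =>
    rw [List.cons_append, List.foldlM_cons]
    refine Out.bind ((out_insertSlot_of_full (hpre x List.mem_cons_self)).mono ?_)
    rintro tr rest m' ⟨rfl, rfl, rfl⟩
    refine (ih fun y hy => hpre y (List.mem_cons_of_mem _ hy)).mono ?_
    rintro tr rest m' ⟨rfl, rfl, rfl⟩
    exact ⟨rfl, rfl, rfl⟩

lemma exists_first {α : Type} (L : List α) (p : α → Prop) :
    (∀ x ∈ L, p x) ∨ ∃ pre y post, L = pre ++ y :: post ∧ (∀ x ∈ pre, p x) ∧ ¬ p y := by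
  induction L with
  | nil => exact Or.inl (by simp)
  | cons a L ih =>
    by_cases ha : p a
    · rcases ih with h | ⟨pre, y, post, rfl, h1, h2⟩
      · exact Or.inl (by simpa [ha] using h)
      · exact Or.inr ⟨a :: pre, y, post, rfl, by simpa [ha] using h1, h2⟩
    · exact Or.inr ⟨[], a, L, rfl, by simp, ha⟩

/-- Finds the table of a zigzag path in which the first free slot lies; the buckets of the earlier
tables on the path all belong to the full part `pre`. -/
lemma flatMap_split {α β : Type} {f : α → List β} {l : List α} {pre post : List β} {y : β}
    (h : l.flatMap f = pre ++ y :: post) :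
    ∃ l₁ a l₂, l = l₁ ++ a :: l₂ ∧ y ∈ f a ∧ ∀ a' ∈ l₁, ∀ z ∈ f a', z ∈ pre := by
  induction l generalizing pre with
  | nil => simp at h
  | cons a l ih =>
    rw [List.flatMap_cons] at h
    rcases List.append_eq_append_iff.1 h with ⟨t, h1, h2⟩ | ⟨t, h1, h2⟩
    · obtain ⟨l₁, a', l₂, rfl, h3, h4⟩ := ih h2
      refine ⟨a :: l₁, a', l₂, rfl, h3, fun b hb z hz => ?_⟩
      rw [h1]
      rcases List.mem_cons.1 hb with rfl | hb
      · exact List.mem_append_left _ hz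
      · exact List.mem_append_right _ (h4 b hb z hz)
    · cases t with
      | nil =>
        obtain ⟨l₁, a', l₂, rfl, h3, h4⟩ := ih (pre := []) (by simpa using h2.symm)
        refine ⟨a :: l₁, a', l₂, rfl, h3, fun b hb z hz => ?_⟩
        rcases List.mem_cons.1 hb with rfl | hb
        · simpa [h1] using hz
        · exact absurd (h4 b hb z hz) (by simp)
      | cons t₀ t =>
        refine ⟨[], a, l, rfl, ?_, by simp⟩
        rw [List.cons_append, List.cons.injEq] at h2
        rw [h1, h2.1]
        simp

/-- The slots on a zigzag path. -/
def pathSlots (id d k c : ℕ) (js : List (Fin k)) (row : Fin k → Fin (2 ^ d)) : List Addr :=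
  js.flatMap fun j : Fin k => bucketSlots id j (row j) c

/-- The treatment of one cell in a throw, with given hash functions. -/
def throwCell (id d k c : ℕ) (js : List (Fin k)) (sel : Cell K V → Bool)
    (g : Fin k → K → Fin (2 ^ d)) (x : Addr) : Prog K V Unit := do
  let y ← Prog.read x
  Prog.write x (if sel y then Cell.empty else y)
  let pending : Option (K × V) := if sel y then y.elem else none
  let rnd ← Prog.sample (Fin k → Fin (2 ^ d))
  let path : Fin k → Fin (2 ^ d) :=
    match pending with
    | some e => fun j => g j e.1
    | none => rnd
  let rest ← (js.flatMap fun j : Fin k => bucketSlots id j (path j) c).foldlM insertSlot pending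
  match rest with
  | none => pure ()
  | some _ => Prog.fail

lemma throwInto_eq [Fintype K] [DecidableEq K] (id d k c : ℕ) (js : List (Fin k))
    (src : List Addr) (sel : Cell K V → Bool) :
    throwInto id d k c js src sel = (do
      let g ← Prog.sample (Fin k → K → Fin (2 ^ d))
      src.forM (throwCell id d k c js sel g) : Prog K V Unit) := rfl

/-- The simulation of the treatment of one cell. -/
def throwCellSim (id d k c : ℕ) (js : List (Fin k)) (x : Addr) : Sim Unit :=
  (Sim.sample (Fin k → Fin (2 ^ d))).seq fun row =>
    emit (touch (x :: pathSlots id d k c js row))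

lemma ex_throwCellSim (id d k c : ℕ) (js : List (Fin k)) (x : Addr)
    (G : List Access × Unit → ℝ≥0∞) :
    ex (throwCellSim id d k c js x) G =
      avg fun row => G (touch (x :: pathSlots id d k c js row), ()) := by
  unfold throwCellSim
  rw [Sim.ex_seq, Sim.ex_sample]
  simp only [ex_emit, List.nil_append]

/-- With nothing pending the path is the private random one, exactly as in the simulation. -/
lemma dom_throwCell_idle {id d k c : ℕ} {js : List (Fin k)} {sel : Cell K V → Bool}
    (g : Fin k → K → Fin (2 ^ d)) {x : Addr} {m : Mem K V}
    (hx : sel (m x) = true → (m x).elem = none) :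
    Dom (throwCell id d k c js sel g x) m (throwCellSim id d k c js x) (fun _ m' _ =>
      m' = Function.update m x (if sel (m x) then Cell.empty else m x)) ∧
    Out (throwCell id d k c js sel g x) m (fun _ _ m' =>
      m' = Function.update m x (if sel (m x) then Cell.empty else m x)) := by
  have hp : (if sel (m x) then (m x).elem else none) = none := by
    split_ifs with h
    · exact hx h
    · rfl
  have key : ∀ row : Fin k → Fin (2 ^ d), Out (do
      let rest ← (pathSlots id d k c js row).foldlM insertSlot (none : Option (K × V))
      match rest with
      | none => pure ()
      | some _ => Prog.fail : Prog K V Unit)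
      (Function.update m x (if sel (m x) then Cell.empty else m x)) fun tr _ m' =>
        tr = touch (pathSlots id d k c js row) ∧
        m' = Function.update m x (if sel (m x) then Cell.empty else m x) := fun row => by
    refine Out.bind ((out_insert_none _ _).mono ?_)
    rintro tr rest m' ⟨rfl, rfl, rfl⟩
    exact Out.pure ⟨by simp, rfl⟩
  constructor
  · intro F G hFG
    rw [ex_throwCellSim]
    unfold throwCell
    simp only [W_bind, W_read, W_write, W_sample, hp]
    refine ex_mono fun row => ?_
    have := (key row).W_le (z := 0)
      (F := fun tr u m' => F (touch [x] ++ tr) u m')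
      (c := G (touch (x :: pathSlots id d k c js row)) ()) (by
        rintro tr u m' ⟨rfl, hm'⟩
        exact hFG _ _ _ _ hm')
    rw [W_bind] at this
    exact this
  · unfold throwCell
    refine Out.bind (Out.read (Out.bind (Out.write (Out.bind (Out.sample fun row => ?_)))))
    simp only [hp]
    exact (key row).mono fun _ _ _ h => h.2

/-- The hash functions matter only through the row of the pending key. The row is a separate
argument so that it can be drawn at this very moment. If no slot on the path is free, the run fails
and contributes nothing, as failures have value 0 here. -/
lemma throwCell_pending {id d k c : ℕ} {js : List (Fin k)} {sel : Cell K V → Bool}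
    {x : Addr} {m : Mem K V} {e : K × V} (hs : sel (m x) = true) (he : (m x).elem = some e)
    (row : Fin k → Fin (2 ^ d)) :
    (∃ pre y post, pathSlots id d k c js row = pre ++ y :: post ∧
      (∀ z ∈ pre, (Function.update m x Cell.empty z).elem ≠ none) ∧
      (Function.update m x Cell.empty y).elem = none ∧
      ∀ g : Fin k → K → Fin (2 ^ d), (∀ j, g j e.1 = row j) →
        Out (throwCell id d k c js sel g x) m fun tr _ m' =>
          tr = touch (x :: pathSlots id d k c js row) ∧
          m' = Function.update (Function.update m x Cell.empty) y ⟨some e, true, 0⟩) ∨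
    ((∀ z ∈ pathSlots id d k c js row, (Function.update m x Cell.empty z).elem ≠ none) ∧
      ∀ g : Fin k → K → Fin (2 ^ d), (∀ j, g j e.1 = row j) → ∀ F,
        W (throwCell id d k c js sel g x m) 0 F = 0) := by
  have hpath : ∀ g : Fin k → K → Fin (2 ^ d), (∀ j, g j e.1 = row j) →
      (js.flatMap fun j : Fin k => bucketSlots id j (g j e.1) c) = pathSlots id d k c js row :=
    fun g hg => by
      unfold pathSlots
      simp only [hg]
  rcases exists_first (pathSlots id d k c js row)
    (fun z => (Function.update m x Cell.empty z).elem ≠ none) with h | ⟨pre, y, post, h1, h2, h3⟩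
  · refine Or.inr ⟨h, fun g hg F => le_antisymm ?_ zero_le⟩
    unfold throwCell
    simp only [W_bind, W_read, W_write, W_sample, hs, he, if_true, hpath g hg]
    refine (ex_mono (g := fun _ => 0) fun _ => ?_).trans (ex_const _ _).le
    refine (out_insert_full h).W_le ?_
    rintro tr rest m' ⟨rfl, rfl, rfl⟩
    exact (W_fail _ _ _).le
  · refine Or.inl ⟨pre, y, post, h1, h2, not_not.1 h3, fun g hg => ?_⟩
    unfold throwCell
    refine Out.bind (Out.read (Out.bind (Out.write (Out.bind (Out.sample fun _ => Out.bind ?_)))))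
    simp only [hs, he, if_true, hpath g hg, h1]
    refine (out_insert_free h2 (not_not.1 h3)).mono ?_
    rintro tr rest m' ⟨rfl, rfl, rfl⟩
    refine Out.pure ⟨?_, rfl⟩
    simp [touch]

end Throw

/-! ### Simulation of a throw by lazily sampled hash functions -/

section Throw

variable {K V : Type}

/-- The cells of the tables `js`. -/
def targetSet (id d c : ℕ) {k : ℕ} (js : List (Fin k)) : Set Addr :=
  {x | ∃ j ∈ js, x ∈ tableSet id j d c}

lemma mem_pathSlots {id d k c : ℕ} {js : List (Fin k)} {row : Fin k → Fin (2 ^ d)} {x : Addr} :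
    x ∈ pathSlots id d k c js row ↔ ∃ j ∈ js, ∃ s < c, x = Addr.table id j (row j) s := by
  unfold pathSlots bucketSlots
  simp only [List.mem_flatMap, List.mem_map, List.mem_range]
  constructor
  · rintro ⟨j, hj, s, hs, rfl⟩
    exact ⟨j, hj, s, hs, rfl⟩
  · rintro ⟨j, hj, s, hs, rfl⟩
    exact ⟨j, hj, s, hs, rfl⟩

lemma pathSlots_subset {id d k c : ℕ} {js : List (Fin k)} {row : Fin k → Fin (2 ^ d)} {x : Addr}
    (hx : x ∈ pathSlots id d k c js row) : x ∈ targetSet id d c js := by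
  obtain ⟨j, hj, s, hs, rfl⟩ := mem_pathSlots.1 hx
  exact ⟨j, hj, row j, (row j).2, s, hs, rfl⟩

/-- The effect of a successful throw from `src` into the cells `T`. -/
structure ThrowPost (T : Set Addr) (sel : Cell K V → Bool) (src : List Addr) (m m' : Mem K V) :
    Prop where
  moved : Moved ({x | x ∈ src} ∪ T) m m'
  src_sel : ∀ x ∈ src, sel (m x) = true → (m' x).elem = none
  src_keep : ∀ x ∈ src, sel (m x) = false → m' x = m x
  target : ∀ x ∈ T, m' x = m x ∨ (m' x).tag = true
  other : ∀ x, x ∉ src → x ∉ T → m' x = m x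

lemma ThrowPost.nil (T : Set Addr) (sel : Cell K V → Bool) (m : Mem K V) :
    ThrowPost T sel [] m m :=
  ⟨Moved.refl _ _, by simp, by simp, fun _ _ => Or.inl rfl, fun _ _ _ => rfl⟩

lemma ThrowPost.cons {T : Set Addr} {sel : Cell K V → Bool} {x : Addr} {src : List Addr}
    {m m' m'' : Mem K V} (hsrc : ∀ y ∈ x :: src, y ∉ T) (h : ThrowPost T sel [x] m m')
    (h' : ThrowPost T sel src m' m'') : ThrowPost T sel (x :: src) m m'' := by
  -- The list of sources may repeat an address; a source cell that has been emptied stays empty.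
  have hkeep : ∀ y, (m' y).elem = none → y ∉ T → (m'' y).elem = none := fun y hy hyT => by
    by_cases hys : y ∈ src
    · cases hsel : sel (m' y)
      · rw [h'.src_keep y hys hsel, hy]
      · exact h'.src_sel y hys hsel
    · rw [h'.other y hys hyT, hy]
  refine ⟨?_, ?_, ?_, ?_, ?_⟩
  · refine (h.moved.mono ?_).trans (h'.moved.mono ?_)
    · rintro y (hy | hy)
      · exact Or.inl (by simp at hy; simp [hy])
      · exact Or.inr hy
    · rintro y (hy | hy)
      · exact Or.inl (List.mem_cons_of_mem _ hy)
      · exact Or.inr hy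
  · intro y hy hsel
    by_cases hyx : y = x
    · subst hyx
      exact hkeep y (h.src_sel y (by simp) hsel) (hsrc y hy)
    · have h1 := h.other y (by simpa using hyx) (hsrc y hy)
      have h2 : y ∈ src := by simpa [hyx] using hy
      exact h'.src_sel y h2 (by rw [h1, hsel])
  · intro y hy hsel
    have h1 : m' y = m y := by
      by_cases hyx : y = x
      · exact h.src_keep y (by simp [hyx]) hsel
      · exact h.other y (by simpa using hyx) (hsrc y hy)
    rw [← h1]
    by_cases hys : y ∈ src
    · exact h'.src_keep y hys (by rw [h1, hsel])
    · exact h'.other y hys (hsrc y hy)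
  · intro y hy
    rcases h'.target y hy with h1 | h1
    · rw [h1]
      exact h.target y hy
    · exact Or.inr h1
  · intro y hy hyT
    rw [List.mem_cons, not_or] at hy
    rw [h'.other y hy.2 hyT, h.other y (by simpa using hy.1) hyT]

lemma ThrowPost.idle {T : Set Addr} {sel : Cell K V → Bool} {x : Addr} {m : Mem K V}
    (hxT : x ∉ T) (hx : sel (m x) = true → (m x).elem = none) :
    ThrowPost T sel [x] m (Function.update m x (if sel (m x) then Cell.empty else m x)) := by
  have hne : ∀ y, y ≠ x →
      Function.update m x (if sel (m x) then Cell.empty else m x) y = m y :=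
    fun y hy => Function.update_of_ne hy _ _
  refine ⟨?_, ?_, ?_, ?_, ?_⟩
  · refine ⟨1, by simp, fun y => ?_⟩
    unfold keyAt
    by_cases hy : y = x
    · subst hy
      rw [Function.update_self]
      split_ifs with h
      · simp [Cell.empty, hx h]
      · rfl
    · rw [hne y hy]
      rfl
  · intro y hy hsel
    rw [List.mem_singleton] at hy
    subst hy
    rw [Function.update_self, hsel]
    rfl
  · intro y hy hsel
    rw [List.mem_singleton] at hy
    subst hy
    rw [Function.update_self, hsel]
    rfl
  · intro y hy
    exact Or.inl (hne y fun h => hxT (h ▸ hy))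
  · intro y hy _
    exact hne y (by simpa using hy)

lemma ThrowPost.pending {T : Set Addr} {sel : Cell K V → Bool} {x y : Addr} {m : Mem K V}
    {e : K × V} (hxT : x ∉ T) (hyT : y ∈ T) (hs : sel (m x) = true) (he : (m x).elem = some e)
    (hy : (m y).elem = none) :
    ThrowPost T sel [x] m
      (Function.update (Function.update m x Cell.empty) y ⟨some e, true, 0⟩) := by
  have hxy : x ≠ y := fun h => hxT (h ▸ hyT)
  have hne : ∀ z, z ≠ x → z ≠ y →
      Function.update (Function.update m x Cell.empty) y ⟨some e, true, 0⟩ z = m z :=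
    fun z hzx hzy => by rw [Function.update_of_ne hzy, Function.update_of_ne hzx]
  refine ⟨?_, ?_, ?_, ?_, ?_⟩
  · refine ⟨Equiv.swap x y, fun z hz => ?_, fun z => ?_⟩
    · refine Equiv.swap_apply_of_ne_of_ne ?_ ?_
      · rintro rfl
        exact hz (Or.inl (by simp))
      · rintro rfl
        exact hz (Or.inr hyT)
    · unfold keyAt
      by_cases hzy : z = y
      · subst hzy
        rw [Function.update_self, Equiv.swap_apply_right, he]
      · by_cases hzx : z = x
        · subst hzx
          rw [Function.update_of_ne hzy, Function.update_self, Equiv.swap_apply_left, hy]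
          rfl
        · rw [hne z hzx hzy, Equiv.swap_apply_of_ne_of_ne hzx hzy]
  · intro z hz _
    rw [List.mem_singleton] at hz
    subst hz
    rw [Function.update_of_ne hxy, Function.update_self]
    rfl
  · intro z hz hsel
    rw [List.mem_singleton] at hz
    subst hz
    rw [hs] at hsel
    cases hsel
  · intro z hz
    by_cases hzy : z = y
    · subst hzy
      rw [Function.update_self]
      exact Or.inr rfl
    · exact Or.inl (hne z (fun h => hxT (h ▸ hz)) hzy)
  · intro z hz hzT
    exact hne z (by simpa using hz) fun h => hzT (h ▸ hyT)

lemma Sim.loop_cons {ι : Type} (i : ι) (l : List ι) (g : ι → Sim Unit) :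
    Sim.loop (i :: l) g = (g i).seq fun _ => Sim.loop l g := rfl

/-- The simulation of a throw. -/
def throwSim (id d k c : ℕ) (js : List (Fin k)) (src : List Addr) : Sim Unit :=
  Sim.loop src (throwCellSim id d k c js)

variable [DecidableEq K]

/-- The hash functions `g`, with the values at the keys in `Z` replaced by those of `g₀`. -/
def overrideOn {k n : ℕ} (Z : Finset K) (g₀ g : Fin k → K → Fin n) : Fin k → K → Fin n :=
  fun j κ => if κ ∈ Z then g₀ j κ else g j κ

/-- The hash functions `g`, with the values at the key `κ` replaced. -/
def setRow {k n : ℕ} (κ : K) (g : Fin k → K → Fin n) (row : Fin k → Fin n) : Fin k → K → Fin n :=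
  fun j κ' => if κ' = κ then row j else g j κ'

lemma avg_setRow [Fintype K] {k d : ℕ} (κ : K) (f : (Fin k → K → Fin (2 ^ d)) → ℝ≥0∞) :
    avg f = avg fun row : Fin k → Fin (2 ^ d) => avg fun g => f (setRow κ g row) := by
  refine avg_lens (fun g j => g j κ) (setRow κ) ?_ ?_ ?_ f
  · intro g row
    funext j
    simp [setRow]
  · intro g
    funext j κ'
    unfold setRow
    split_ifs with h
    · rw [h]
    · rfl
  · intro g row row'
    funext j κ'
    unfold setRow
    split_ifs <;> rfl

/-- Drawing the row of a new key amounts to enlarging the set of keys whose values are already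
decided. -/
lemma overrideOn_setRow {k n : ℕ} {Z : Finset K} {κ : K} (hκ : κ ∉ Z) (g₀ g : Fin k → K → Fin n)
    (row : Fin k → Fin n) :
    overrideOn Z g₀ (setRow κ g row) = overrideOn (insert κ Z) (setRow κ g₀ row) g := by
  funext j κ'
  unfold overrideOn setRow
  by_cases h1 : κ' = κ
  · subst h1
    simp [hκ]
  · by_cases h2 : κ' ∈ Z <;> simp [h1, h2]

/-- Lazy sampling. The keys in `Z` have the decided values `g₀`, and all other values are still
averaged over. Since a key is stored only once, the key of the next real element is not in `Z`, and
its row is as random as a simulated path. Failing throws have value 0, so only an inequality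
results. -/
lemma avg_throw_le [Fintype K] {id d k c : ℕ} {js : List (Fin k)} {sel : Cell K V → Bool}
    {src : List Addr}
    (hsrc : ∀ x ∈ src, x ∉ targetSet id d c js) (Z : Finset K) (g₀ : Fin k → K → Fin (2 ^ d))
    {m : Mem K V} (hm : UniqueKeys m)
    (hZ : ∀ x ∈ src, ∀ e, sel (m x) = true → (m x).elem = some e → e.1 ∉ Z)
    {F : List Access → Unit → Mem K V → ℝ≥0∞} {G : List Access → ℝ≥0∞}
    (hFG : ∀ tr m', ThrowPost (targetSet id d c js) sel src m m' → F tr () m' ≤ G tr) :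
    (avg fun g => W (src.forM (throwCell id d k c js sel (overrideOn Z g₀ g)) m) 0 F) ≤
      ex (throwSim id d k c js src) fun o => G o.1 := by
  induction src generalizing Z g₀ m F G with
  | nil =>
    have : ∀ g, W (([] : List Addr).forM (throwCell id d k c js sel (overrideOn Z g₀ g)) m) 0 F =
        F [] () m := fun g => W_pure _ _ _ _
    simp only [this]
    rw [avg, ex_const]
    change _ ≤ ex (emit []) _
    rw [ex_emit]
    exact hFG _ _ (ThrowPost.nil _ _ _)
  | cons x src ih =>
    have hxT := hsrc x List.mem_cons_self
    have hsrc' : ∀ y ∈ src, y ∉ targetSet id d c js := fun y hy =>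
      hsrc y (List.mem_cons_of_mem _ hy)
    have hcons : ∀ g, W ((x :: src).forM (throwCell id d k c js sel g) m) 0 F =
        W (throwCell id d k c js sel g x m) 0 fun tr _ m' =>
          W (src.forM (throwCell id d k c js sel g) m') 0 fun tr' => F (tr ++ tr') :=
      fun g => W_bind _ _ _ _ _
    have hsim : (ex (throwSim id d k c js (x :: src)) fun o => G o.1) =
        ex (throwCellSim id d k c js x) fun o =>
          ex (throwSim id d k c js src) fun o' => G (o.1 ++ o'.1) := by
      rw [throwSim, Sim.loop_cons, Sim.ex_seq]
      rfl
    simp only [hcons]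
    rw [hsim]
    by_cases hx : sel (m x) = true → (m x).elem = none
    · have hpost := ThrowPost.idle hxT hx
      refine (ex_mono fun g => (dom_throwCell_idle (overrideOn Z g₀ g) hx).1 _
        (fun tr _ => W (src.forM (throwCell id d k c js sel (overrideOn Z g₀ g))
          (Function.update m x (if sel (m x) then Cell.empty else m x))) 0
            fun tr' => F (tr ++ tr')) ?_).trans ?_
      · rintro tr _ m' _ rfl
        exact le_rfl
      · rw [ex_comm]
        refine ex_mono fun o => ih hsrc' Z g₀ (hpost.moved.uniqueKeys hm)
          (F := fun tr' => F (o.1 ++ tr')) (G := fun tr' => G (o.1 ++ tr')) ?_ ?_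
        · intro y hy e hsel he
          by_cases hyx : y = x
          · subst hyx
            rw [hpost.src_sel y (by simp) (by
              by_contra hc
              rw [hpost.src_keep y (by simp) (by simpa using hc)] at hsel
              exact hc hsel)] at he
            cases he
          · rw [hpost.other y (by simpa using hyx) (hsrc' y hy)] at hsel he
            exact hZ y (List.mem_cons_of_mem _ hy) e hsel he
        · intro tr' m' h'
          exact hFG _ _ (hpost.cons hsrc h')
    · push Not at hx
      obtain ⟨hsel, hne⟩ := hx
      obtain ⟨e, he⟩ := Option.ne_none_iff_exists'.1 hne
      have heZ := hZ x List.mem_cons_self e hsel he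
      -- The row of the current key is drawn now and identified with the simulated random path.
      rw [avg_setRow e.1, ex_throwCellSim]
      refine ex_mono fun row => ?_
      simp only [overrideOn_setRow heZ]
      have hrow : ∀ g : Fin k → K → Fin (2 ^ d), ∀ j,
          overrideOn (insert e.1 Z) (setRow e.1 g₀ row) g j e.1 = row j := fun g j => by
        simp [overrideOn, setRow]
      rcases throwCell_pending (js := js) (c := c) (id := id) hsel he row with
        ⟨pre, y, post, hpath, -, hy, hout⟩ | ⟨-, hzero⟩
      · have hyT : y ∈ targetSet id d c js := pathSlots_subset (row := row) (by rw [hpath]; simp)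
        have hyx : y ≠ x := fun h => hxT (h ▸ hyT)
        rw [Function.update_of_ne hyx] at hy
        have hpost := ThrowPost.pending hxT hyT hsel he hy
        set m₂ := Function.update (Function.update m x Cell.empty) y ⟨some e, true, 0⟩ with hm₂
        have hx₂ : (m₂ x).elem = none := hpost.src_sel x (by simp) hsel
        have hkx : keyAt m x = some e.1 := keyAt_of_elem he
        refine (ex_mono fun g => (hout _ (hrow g)).W_le
          (c := W (src.forM (throwCell id d k c js sel
            (overrideOn (insert e.1 Z) (setRow e.1 g₀ row) g)) m₂) 0 fun tr' =>
              F (touch (x :: pathSlots id d k c js row) ++ tr')) ?_).trans ?_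
        · rintro tr _ m' ⟨rfl, rfl⟩
          exact le_rfl
        · refine ih hsrc' _ _ (hpost.moved.uniqueKeys hm)
            (F := fun tr' => F (touch (x :: pathSlots id d k c js row) ++ tr'))
            (G := fun tr' => G (touch (x :: pathSlots id d k c js row) ++ tr')) ?_ ?_
          · intro z hz e' hsel' he'
            have hzx : z ≠ x := by
              rintro rfl
              rw [hx₂] at he'
              cases he'
            rw [hpost.other z (by simpa using hzx) (hsrc' z hz)] at hsel' he'
            rw [Finset.mem_insert, not_or]
            refine ⟨fun hee => hzx ?_, hZ z (List.mem_cons_of_mem _ hz) e' hsel' he'⟩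
            exact hm _ _ e.1 (hee ▸ keyAt_of_elem he') hkx
          · intro tr' m' h'
            exact hFG _ _ (hpost.cons hsrc h')
      · simp only [hzero _ (hrow _)]
        rw [avg, ex_const]
        exact zero_le

lemma dom_throwInto [Fintype K] {id d k c : ℕ} {js : List (Fin k)} {sel : Cell K V → Bool}
    {src : List Addr}
    (hsrc : ∀ x ∈ src, x ∉ targetSet id d c js) {m : Mem K V} (hm : UniqueKeys m) :
    Dom (throwInto id d k c js src sel) m (throwSim id d k c js src)
      fun _ m' _ => ThrowPost (targetSet id d c js) sel src m m' := by
  intro F G hFG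
  rw [throwInto_eq, W_bind, W_sample]
  have h := avg_throw_le (js := js) (c := c) (sel := sel) hsrc ∅ (fun _ _ => 0) hm (by simp)
    (F := F) (G := fun tr => G tr ()) fun tr m' h => hFG tr _ m' () h
  have h0 : ∀ g : Fin k → K → Fin (2 ^ d), overrideOn ∅ (fun _ _ => 0) g = g := fun g => by
    funext j κ
    simp [overrideOn]
  simpa only [h0, List.nil_append] using h

end Throw

/-! ### The oblivious setup -/

section Build

variable {K V : Type}

lemma mem_tableSlots {id j d c : ℕ} {x : Addr} :
    x ∈ tableSlots id j d c ↔ x ∈ tableSet id j d c := by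
  unfold tableSlots bucketSlots tableSet
  simp only [List.mem_flatMap, List.mem_map, List.mem_range, Set.mem_ofPred_eq]
  constructor
  · rintro ⟨b, hb, s, hs, rfl⟩
    exact ⟨b, hb, s, hs, rfl⟩
  · rintro ⟨b, hb, s, hs, rfl⟩
    exact ⟨b, hb, s, hs, rfl⟩

/-- The cells of a zigzag hash table. -/
def zhtSet (id k d c : ℕ) : Set Addr :=
  {x | ∃ j < k, ∃ b < 2 ^ d, ∃ s < c, x = Addr.table id j b s}

lemma tableSet_subset {id d c k j : ℕ} (hj : j < k) : tableSet id j d c ⊆ zhtSet id k d c := by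
  rintro x ⟨b, hb, s, hs, rfl⟩
  exact ⟨j, hj, b, hb, s, hs, rfl⟩

lemma targetSet_subset {id d c k : ℕ} (js : List (Fin k)) :
    targetSet id d c js ⊆ zhtSet id k d c := by
  rintro x ⟨j, -, hx⟩
  exact tableSet_subset j.2 hx

lemma table_mem_targetSet {id d c k j b s : ℕ} {js : List (Fin k)} :
    Addr.table id j b s ∈ targetSet id d c js ↔
      (∃ j' ∈ js, (j' : ℕ) = j) ∧ b < 2 ^ d ∧ s < c := by
  constructor
  · rintro ⟨j', hj', b', hb', s', hs', he⟩
    simp only [Addr.table.injEq, true_and] at he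
    obtain ⟨rfl, rfl, rfl⟩ := he
    exact ⟨⟨j', hj', rfl⟩, hb', hs'⟩
  · rintro ⟨⟨j', hj', rfl⟩, hb, hs⟩
    exact ⟨j', hj', b, hb, s, hs, rfl⟩

lemma table_mem_tableSet {id d c j j' b s : ℕ} :
    Addr.table id j b s ∈ tableSet id j' d c ↔ j = j' ∧ b < 2 ^ d ∧ s < c := by
  constructor
  · rintro ⟨b', hb', s', hs', he⟩
    simp only [Addr.table.injEq, true_and] at he
    obtain ⟨rfl, rfl, rfl⟩ := he
    exact ⟨rfl, hb', hs'⟩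
  · rintro ⟨rfl, hb, hs⟩
    exact ⟨b, hb, s, hs, rfl⟩

lemma mem_of_suffix_finRange {k : ℕ} {j : Fin k} {l : List (Fin k)}
    (h : j :: l <:+ List.finRange k) (j' : Fin k) : j' ∈ l ↔ j < j' := by
  obtain ⟨l₁, hl⟩ := h
  have hp : (l₁ ++ j :: l).Pairwise (· < ·) := hl ▸ List.pairwise_lt_finRange k
  rw [List.pairwise_append, List.pairwise_cons] at hp
  constructor
  · exact fun hj' => hp.2.1.1 j' hj'
  · intro hlt
    have hmem : j' ∈ l₁ ++ j :: l := hl ▸ List.mem_finRange j'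
    rcases List.mem_append.1 hmem with h1 | h1
    · exact absurd (hp.2.2 j' h1 j List.mem_cons_self) (not_lt.2 hlt.le)
    · rcases List.mem_cons.1 h1 with rfl | h1
      · exact absurd hlt (lt_irrefl _)
      · exact h1

/-- The later tables. -/
def laterTables {k : ℕ} (j : Fin k) : List (Fin k) := (List.finRange k).filter fun j' => j < j'

lemma mem_laterTables {k : ℕ} {j j' : Fin k} : j' ∈ laterTables j ↔ j < j' := by
  simp [laterTables]

/-- One round of the oblivious setup. -/
def buildRound [Fintype K] [DecidableEq K] (w : List (ℕ × ℕ)) (id d k c : ℕ)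
    (h : Fin k → K → Fin (2 ^ d)) (j : Fin k) : Prog K V Unit := do
  route w id j d c (fun key => (h j key : ℕ))
  throwInto id d k c (laterTables j) (tableSlots id j d c) (fun y => !y.tag)

lemma build_eq [Fintype K] [DecidableEq K] (w : List (ℕ × ℕ)) (id d k c : ℕ) (src : List Addr) :
    (build w id d k c src : Prog K V _) = (do
      throwInto id d k c (List.finRange k) src (fun _ => true)
      let h ← Prog.sample (Fin k → K → Fin (2 ^ d))
      (List.finRange k).forM (buildRound w id d k c h)
      pure h) := rfl

/-- The simulation of one round of the oblivious setup. -/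
def buildRoundSim (w : List (ℕ × ℕ)) (id d k c : ℕ) (j : Fin k) : Sim Unit :=
  (emit (routeTrace w id j d c)).seq fun _ =>
    throwSim id d k c (laterTables j) (tableSlots id j d c)

/-- The simulation of the oblivious setup. -/
def buildSim (w : List (ℕ × ℕ)) (id d k c : ℕ) (src : List Addr) : Sim Unit :=
  (throwSim id d k c (List.finRange k) src).seq fun _ =>
    Sim.loop (List.finRange k) (buildRoundSim w id d k c)

/-- The effect of a successful setup with hash functions `h`. -/
structure BuildPost (id d k c : ℕ) (src : List Addr) (m : Mem K V) (h : Fin k → K → Fin (2 ^ d))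
    (m' : Mem K V) : Prop where
  moved : Moved ({x | x ∈ src} ∪ zhtSet id k d c) m m'
  src_empty : ∀ x ∈ src, (m' x).elem = none
  placed : ∀ (j : Fin k), ∀ b < 2 ^ d, ∀ s < c, ∀ κ,
    keyAt m' (Addr.table id j b s) = some κ → b = h j κ

lemma route_trans {h : K → ℕ} {i b b' : ℕ} {κ : K} (hb : ∀ r < i, b.testBit r = (h κ).testBit r)
    (hi : b'.testBit i = (h κ).testBit i) (hr : ∀ r, r ≠ i → b'.testBit r = b.testBit r) :
    ∀ r < i + 1, b'.testBit r = (h κ).testBit r := fun r hri => by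
  rcases Nat.lt_succ_iff_lt_or_eq.1 hri with h1 | rfl
  · rw [hr r h1.ne, hb r h1]
  · exact hi

lemma eq_of_testBit_lt {d a b : ℕ} (ha : a < 2 ^ d) (hb : b < 2 ^ d)
    (h : ∀ r < d, a.testBit r = b.testBit r) : a = b := by
  refine Nat.eq_of_testBit_eq fun r => ?_
  by_cases hr : r < d
  · exact h r hr
  · have hle : 2 ^ d ≤ 2 ^ r := Nat.pow_le_pow_right (by norm_num) (not_lt.1 hr)
    rw [Nat.testBit_lt_two_pow (ha.trans_le hle), Nat.testBit_lt_two_pow (hb.trans_le hle)]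

variable [Fintype K] [DecidableEq K]

/-- Every throw has its own hash functions and routing has a fixed trace, so the simulated trace
does not involve the final functions `h`, which stay uniform for later searches. The placement is
correct because an element keeps its tag only if it followed all bits of its destination, and
elements without the tag are removed from the table. -/
lemma dom_build {w : List (ℕ × ℕ)} {c : ℕ} (hw : IsSortingNetwork w (2 * c)) {id d k : ℕ}
    {src : List Addr} (hsrc : ∀ x ∈ src, x ∉ zhtSet id k d c) {m : Mem K V} (hm : UniqueKeys m)
    (hempty : ∀ x ∈ zhtSet id k d c, (m x).elem = none)
    (F : List Access → (Fin k → K → Fin (2 ^ d)) → Mem K V → ℝ≥0∞)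
    (G : List Access → (Fin k → K → Fin (2 ^ d)) → ℝ≥0∞)
    (hFG : ∀ tr h m', BuildPost id d k c src m h m' → F tr h m' ≤ G tr h) :
    W (build w id d k c src m) 0 F ≤
      avg fun h => ex (buildSim w id d k c src) fun o => G o.1 h := by
  have hmain : Dom (build w id d k c src) m
      ((throwSim id d k c (List.finRange k) src).seq fun _ =>
        (Sim.sample (Fin k → K → Fin (2 ^ d))).seq fun h =>
          (Sim.loop (List.finRange k) (buildRoundSim w id d k c)).seq fun _ =>
            PMF.pure ([], h))
      (fun h m' h' => h = h' ∧ BuildPost id d k c src m h m') := by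
    rw [build_eq]
    refine (dom_throwInto (fun x hx hT => hsrc x hx (targetSet_subset _ hT)) hm).bind
      fun _ m₁ _ hm₁ => ?_
    refine (Dom.sample (R := fun h m' h' => h = h' ∧ m' = m₁) fun h => ⟨rfl, rfl⟩).bind ?_
    rintro h _ _ ⟨rfl, rfl⟩
    -- Tables already treated hold elements only in their final buckets; in the remaining tables all
    -- elements are live.
    refine (Dom.loop (I := fun l m' => UniqueKeys m' ∧
      Moved ({x | x ∈ src} ∪ zhtSet id k d c) m m' ∧ (∀ x ∈ src, (m' x).elem = none) ∧
      (∀ j : Fin k, j ∉ l → ∀ b < 2 ^ d, ∀ s < c, ∀ κ,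
        keyAt m' (Addr.table id j b s) = some κ → b = h j κ) ∧
      (∀ j ∈ l, ∀ b < 2 ^ d, ∀ s < c, (m' (Addr.table id j b s)).elem ≠ none →
        (m' (Addr.table id j b s)).tag = true)) ?_ ?_).bind ?_
    · refine ⟨hm₁.moved.uniqueKeys hm, hm₁.moved.mono (Set.union_subset_union_right _
        (targetSet_subset _)), fun x hx => hm₁.src_sel x hx rfl, fun j hj => ?_, ?_⟩
      · exact absurd (List.mem_finRange j) hj
      · intro j _ b hb s hs hne
        rcases hm₁.target (Addr.table id j b s)
          (table_mem_targetSet.2 ⟨⟨j, List.mem_finRange j, rfl⟩, hb, hs⟩) with h1 | h1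
        · rw [h1, hempty _ ⟨j, j.2, b, hb, s, hs, rfl⟩] at hne
          exact absurd rfl hne
        · exact h1
    · rintro j l m₂ hsuf ⟨hu, hmv, hse, hpl, htag⟩
      have hlater : ∀ j', j' ∈ l ↔ j < j' := mem_of_suffix_finRange hsuf
      -- The invariant is agreement of the low bits with the destination. Nothing is claimed of
      -- elements that lose their tag: overflow matters only for the failure probability.
      have hroute := out_route hw id j d (fun key => (h j key : ℕ))
        (fun i b κ => ∀ r < i, b.testBit r = (h j κ : ℕ).testBit r) (fun _ => True)
        (fun i _ b b' κ => route_trans) (fun _ _ _ _ _ _ _ _ _ => trivial) hu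
        (fun b _ s _ e _ => ⟨fun _ r hr => absurd hr (by omega), fun _ => trivial⟩)
      refine (Out.dom (hroute.mono fun tr _ m' h => ⟨h.1, h.2⟩)).bind ?_
      rintro _ m₃ _ ⟨hmv₃, hout₃, hb₃⟩
      have hu₃ := hmv₃.uniqueKeys hu
      have hT : ∀ x ∈ tableSlots id j d c, x ∉ targetSet id d c (laterTables j) := by
        intro x hx
        obtain ⟨b, hb, s, hs, rfl⟩ := mem_tableSlots.1 hx
        rw [table_mem_targetSet]
        rintro ⟨⟨j', hj', he⟩, -, -⟩
        exact absurd (mem_laterTables.1 hj') (by rw [Fin.lt_def, he]; exact lt_irrefl _)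
      refine (dom_throwInto hT hu₃).mono ?_
      rintro _ m₄ _ hm₄
      have hsub : {x | x ∈ tableSlots id j d c} ∪ targetSet id d c (laterTables j) ⊆
          zhtSet id k d c := by
        rintro x (hx | hx)
        · exact tableSet_subset j.2 (mem_tableSlots.1 hx)
        · exact targetSet_subset _ hx
      refine ⟨hm₄.moved.uniqueKeys hu₃, (hmv.trans (hmv₃.mono ?_)).trans (hm₄.moved.mono ?_),
        ?_, ?_, ?_⟩
      · exact (tableSet_subset j.2).trans Set.subset_union_right
      · exact hsub.trans Set.subset_union_right
      · intro x hx
        have h1 := hsrc x hx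
        rw [hm₄.other x (fun hx' => h1 (hsub (Or.inl hx'))) fun hx' => h1 (hsub (Or.inr hx')),
          hout₃ x fun hx' => h1 (tableSet_subset j.2 hx')]
        exact hse x hx
      · intro j' hj' b hb s hs κ hκ
        by_cases hjj : j' = j
        · subst hjj
          have hx : Addr.table id j' b s ∈ tableSlots id j' d c :=
            mem_tableSlots.2 ⟨b, hb, s, hs, rfl⟩
          cases ht : (m₃ (Addr.table id j' b s)).tag
          · rw [keyAt_eq_none.2 (hm₄.src_sel _ hx (by simp [ht]))] at hκ
            cases hκ
          · unfold keyAt at hκ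
            rw [hm₄.src_keep _ hx (by simp [ht])] at hκ
            obtain ⟨v, hv⟩ := keyAt_eq_some.1 hκ
            exact eq_of_testBit_lt hb (h j' κ).2 ((hb₃ b hb s hs _ hv).1 ht)
        · have hj2 : j' ∉ j :: l := by simpa [hjj] using hj'
          refine hpl j' hj2 b hb s hs κ ?_
          unfold keyAt at hκ
          rw [hm₄.other, hout₃] at hκ
          · exact hκ
          · rw [table_mem_tableSet]
            exact fun hc => hjj (Fin.ext hc.1)
          · rw [mem_tableSlots, table_mem_tableSet]
            exact fun hc => hjj (Fin.ext hc.1)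
          · rw [table_mem_targetSet]
            rintro ⟨⟨j'', h1, h2⟩, -⟩
            have h3 : j'' = j' := Fin.ext h2
            subst h3
            exact hj' ((hlater _).2 (mem_laterTables.1 h1))
      · intro j' hj' b hb s hs hne
        rcases hm₄.target (Addr.table id j' b s) (table_mem_targetSet.2
          ⟨⟨j', mem_laterTables.2 ((hlater _).1 hj'), rfl⟩, hb, hs⟩) with h1 | h1
        · have h2 : m₃ (Addr.table id j' b s) = m₂ (Addr.table id j' b s) := by
            refine hout₃ _ ?_
            rw [table_mem_tableSet]
            rintro ⟨hc, -⟩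
            exact absurd ((hlater _).1 hj') (by rw [Fin.lt_def, hc]; exact lt_irrefl _)
          rw [h1, h2] at hne ⊢
          exact htag j' (List.mem_cons_of_mem _ hj') b hb s hs hne
        · exact h1
    · rintro _ m₂ _ ⟨-, hmv, hse, hpl, -⟩
      exact Dom.pure ⟨rfl, hmv, hse, fun j => hpl j (by simp)⟩
  refine (hmain F G ?_).trans (le_of_eq ?_)
  · rintro tr h m' _ ⟨rfl, hpost⟩
    exact hFG _ _ _ hpost
  · simp only [Sim.ex_seq, Sim.ex_sample, ex_pure, buildSim, List.nil_append, List.append_nil]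
    rw [avg, ex_comm]
    rfl

end Build

/-! ### Runs of the setup with good hash functions -/

section Presample

variable {K V : Type} {α : Type}

lemma W_avg {β : Type} [Fintype β] [Nonempty β] (μ : PMF (List Access × Option (α × Mem K V)))
    (z : ℝ≥0∞) (F : β → List Access → α → Mem K V → ℝ≥0∞) :
    (W μ z fun tr x m => avg fun b => F b tr x m) = avg fun b => W μ z (F b) := by
  unfold W avg
  rw [ex_comm]
  congr 1
  funext o
  rcases o with ⟨tr, _ | ⟨x, m'⟩⟩
  · exact (ex_const _ _).symm
  · rfl

lemma forM_congr {ι : Type} {l : List ι} {f g : ι → Prog K V PUnit} (h : ∀ i ∈ l, f i = g i) :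
    l.forM f = l.forM g := by
  induction l with
  | nil => rfl
  | cons i l ih =>
    change (f i >>= fun _ => l.forM f) = (g i >>= fun _ => l.forM g)
    rw [h i List.mem_cons_self, ih fun i' hi' => h i' (List.mem_cons_of_mem _ hi')]

/-- The iterations use independent choices, so all of these may be drawn before the loop. As `l` has
no repetitions, each index is consulted at most once. -/
lemma W_presample {ι X : Type} [Fintype ι] [DecidableEq ι] [Fintype X] [Nonempty X]
    {body : ι → Prog K V PUnit} {bodyT : ι → X → Prog K V PUnit} {z : ℝ≥0∞}
    (hb : ∀ i m F, W (body i m) z F = avg fun x => W (bodyT i x m) z F) {l : List ι}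
    (hl : l.Nodup) (m : Mem K V) (F : List Access → PUnit → Mem K V → ℝ≥0∞) :
    W (l.forM body m) z F = avg fun xs : ι → X => W (l.forM (fun i => bodyT i (xs i)) m) z F := by
  induction l generalizing m F with
  | nil => exact (ex_const _ _).symm
  | cons i l ih =>
    rw [List.nodup_cons] at hl
    have hcons : ∀ f : ι → Prog K V PUnit, W ((i :: l).forM f m) z F =
        W (f i m) z fun tr _ m' => W (l.forM f m') z fun tr' => F (tr ++ tr') :=
      fun f => W_bind (f i) (fun _ => l.forM f) m z F
    rw [hcons, hb, avg_update i]
    congr 1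
    funext x
    simp only [hcons]
    simp only [ih hl.2]
    rw [W_avg]
    congr 1
    funext xs
    simp only [Function.update_self]
    have : l.forM (fun i' => bodyT i' (Function.update xs i x i')) =
        l.forM fun i' => bodyT i' (xs i') := forM_congr fun i' hi' => by
      rw [Function.update_of_ne fun h => hl.1 (by rwa [h] at hi')]
    rw [this]

end Presample

/-! ### Spillover, and success of the setup for good hash functions -/

section Good

variable {K V : Type}

/-- The `c` elements of the full bucket and the element at `x`, which is outside the table, have
distinct keys. -/
lemma crowd_of_full {id j d c b : ℕ} {m : Mem K V} (hm : UniqueKeys m) {P : K → Prop}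
    (hb : b < 2 ^ d) (hinv : BucketInv m id j c b P fun _ => False) {κ : K} (hP : P κ)
    {x : Addr} (hx : keyAt m x = some κ) (hxT : x ∉ tableSet id j d c)
    (hfull : ∀ s < c, (m (Addr.table id j b s)).elem ≠ none) :
    ∃ Y : Finset K, c + 1 ≤ Y.card ∧ κ ∈ Y ∧ ∀ κ' ∈ Y, P κ' := by
  classical
  have h1 : ∀ s : Fin c, ∃ e, (m (Addr.table id j b s)).elem = some e :=
    fun s => Option.ne_none_iff_exists'.1 (hfull s s.2)
  choose f hf using h1
  have hinj : Function.Injective fun s => (f s).1 := fun s s' hss => by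
    have := hm _ _ (f s).1 (keyAt_of_elem (hf s)) ((keyAt_of_elem (hf s')).trans (by
      simp only at hss
      rw [hss]))
    simp only [Addr.table.injEq, true_and] at this
    exact Fin.ext this
  have hnot : κ ∉ Finset.univ.image fun s => (f s).1 := fun hc => by
    obtain ⟨s, -, hs⟩ := Finset.mem_image.1 hc
    refine hxT ?_
    rw [hm _ _ κ hx ((keyAt_of_elem (hf s)).trans (by rw [hs]))]
    exact ⟨b, hb, s, s.2, rfl⟩
  refine ⟨insert κ (Finset.univ.image fun s => (f s).1), ?_, Finset.mem_insert_self _ _, ?_⟩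
  · rw [Finset.card_insert_of_notMem hnot, Finset.card_image_of_injective _ hinj,
      Finset.card_univ, Fintype.card_fin]
  · intro κ' hκ'
    rcases Finset.mem_insert.1 hκ' with rfl | hκ'
    · exact hP
    · obtain ⟨s, -, rfl⟩ := Finset.mem_image.1 hκ'
      have := hinv s s.2 (f s) (hf s)
      cases ht : (m (Addr.table id j b s)).tag
      · exact (this.2 ht).elim
      · exact this.1 ht

/-- `U a` stands for the keys that may get as far as table `a`. A pending element passes a table
only if its bucket is full; with the contents of the bucket it forms a crowd of `c + 1` keys and so
belongs to the next set. As `U k` is empty, a free slot is always found. The first target table `j₀`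
is `0` in the initial throw and `j + 1` in round `j`. -/
lemma out_throw {id d k c : ℕ} {js : List (Fin k)} {sel : Cell K V → Bool} {src : List Addr}
    (hsrc : ∀ x ∈ src, x ∉ targetSet id d c js) (hjs : js.Pairwise (· < ·)) {j₀ : ℕ}
    (hj₀ : j₀ ≤ k) (hmem : ∀ j : Fin k, j ∈ js ↔ j₀ ≤ j) (g : Fin k → K → Fin (2 ^ d))
    (U : ℕ → Finset K) (At : Fin k → ℕ → K → Prop)
    (hAt : ∀ j ∈ js, ∀ κ ∈ U j, At j (g j κ) κ)
    (hcol : ∀ j ∈ js, ∀ b < 2 ^ d, ∀ Y : Finset K, c + 1 ≤ Y.card → (∀ κ ∈ Y, At j b κ) →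
      ∀ κ ∈ Y, κ ∈ U (j + 1))
    (hU : U k = ∅) {m : Mem K V} (hm : UniqueKeys m)
    (hpend : ∀ x ∈ src, ∀ e, sel (m x) = true → (m x).elem = some e → e.1 ∈ U j₀)
    (hinv : ∀ j ∈ js, ∀ b < 2 ^ d, BucketInv m id j c b (At j b) fun _ => False) :
    Out (src.forM (throwCell id d k c js sel g)) m fun _ _ m' =>
      ThrowPost (targetSet id d c js) sel src m m' ∧
      ∀ j ∈ js, ∀ b < 2 ^ d, BucketInv m' id j c b (At j b) fun _ => False := by
  induction src generalizing m with
  | nil => exact Out.pure ⟨ThrowPost.nil _ _ _, hinv⟩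
  | cons x src ih =>
    have hxT := hsrc x List.mem_cons_self
    have hsrc' : ∀ y ∈ src, y ∉ targetSet id d c js := fun y hy =>
      hsrc y (List.mem_cons_of_mem _ hy)
    change Out (throwCell id d k c js sel g x >>= fun _ => src.forM _) m _
    -- it suffices to treat the first cell
    suffices hstep : Out (throwCell id d k c js sel g x) m fun _ _ m' =>
        ThrowPost (targetSet id d c js) sel [x] m m' ∧
        ∀ j ∈ js, ∀ b < 2 ^ d, BucketInv m' id j c b (At j b) fun _ => False by
      refine Out.bind (hstep.mono ?_)
      rintro tr _ m' ⟨hpost, hinv'⟩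
      refine (ih hsrc' (hpost.moved.uniqueKeys hm) ?_ hinv').mono ?_
      · intro y hy e hsel he
        by_cases hyx : y = x
        · subst hyx
          cases hs : sel (m y)
          · rw [hpost.src_keep y (by simp) hs] at hsel he
            exact hpend y List.mem_cons_self e hsel he
          · rw [hpost.src_sel y (by simp) hs] at he
            cases he
        · rw [hpost.other y (by simpa using hyx) (hsrc' y hy)] at hsel he
          exact hpend y (List.mem_cons_of_mem _ hy) e hsel he
      · rintro tr' _ m'' ⟨h1, h2⟩
        exact ⟨hpost.cons hsrc h1, h2⟩
    by_cases hx : sel (m x) = true → (m x).elem = none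
    · refine (dom_throwCell_idle g hx).2.mono ?_
      rintro tr _ m' rfl
      refine ⟨ThrowPost.idle hxT hx, fun j hj b hb s hs => ?_⟩
      rw [Function.update_of_ne]
      · exact hinv j hj b hb s hs
      · rintro rfl
        exact hxT (table_mem_targetSet.2 ⟨⟨j, hj, rfl⟩, hb, hs⟩)
    · push Not at hx
      obtain ⟨hsel, hne⟩ := hx
      obtain ⟨e, he⟩ := Option.ne_none_iff_exists'.1 hne
      have hkx : keyAt m x = some e.1 := keyAt_of_elem he
      have hU₀ := hpend x List.mem_cons_self e hsel he
      have hsame : ∀ z ∈ targetSet id d c js, Function.update m x Cell.empty z = m z :=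
        fun z hz => Function.update_of_ne (fun h => hxT (by rwa [h] at hz)) _ _
      -- the element proceeds to table `j'` only if all earlier buckets of its path are full
      have hchain : ∀ a, j₀ ≤ a → a ≤ k → (∀ j ∈ js, (j : ℕ) < a → ∀ s < c,
          (m (Addr.table id j (g j e.1) s)).elem ≠ none) → e.1 ∈ U a := by
        intro a ha
        induction a, ha using Nat.le_induction with
        | base => exact fun _ _ => hU₀
        | succ a ha iha =>
          intro hak hfull
          have hUa := iha (by omega) fun j hj hja => hfull j hj (by omega)
          have hjm : (⟨a, by omega⟩ : Fin k) ∈ js := (hmem _).2 ha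
          obtain ⟨Y, hY1, hY2, hY3⟩ := crowd_of_full hm (g ⟨a, by omega⟩ e.1).2
            (hinv _ hjm _ (g ⟨a, by omega⟩ e.1).2) (hAt _ hjm e.1 hUa) hkx
            (fun hx => hxT ⟨_, hjm, hx⟩) (hfull _ hjm (Nat.lt_succ_self a))
          exact hcol _ hjm _ (g ⟨a, by omega⟩ e.1).2 Y hY1 hY3 e.1 hY2
      rcases throwCell_pending (js := js) (c := c) (id := id) hsel he (fun j => g j e.1) with
        ⟨pre, y, post, hpath, hpre, hy, hout⟩ | ⟨hfull, -⟩
      · have hyT : y ∈ targetSet id d c js :=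
          pathSlots_subset (row := fun j => g j e.1) (by rw [hpath]; simp)
        rw [hsame y hyT] at hy
        refine (hout g fun _ => rfl).mono ?_
        rintro tr _ m' ⟨-, rfl⟩
        have hpost := ThrowPost.pending hxT hyT hsel he hy
        refine ⟨hpost, fun j hj b hb s hs e' he' => ?_⟩
        by_cases hzy : Addr.table id j b s = y
        · rw [hzy, Function.update_self] at he' ⊢
          simp only [Option.some.injEq] at he'
          subst he'
          refine ⟨fun _ => ?_, fun h => by cases h⟩
          -- All buckets of the path in tables before `j'` were full, so `hchain` puts the key into
          -- `U j'`.
          obtain ⟨l₁, j', l₂, hjl, hyj, hl₁⟩ := flatMap_split hpath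
          have hbj : j' = j ∧ b = g j' e.1 := by
            unfold bucketSlots at hyj
            obtain ⟨s', -, hs'⟩ := List.mem_map.1 hyj
            rw [← hzy] at hs'
            simp only [Addr.table.injEq, true_and] at hs'
            exact ⟨Fin.ext hs'.1, hs'.2.1.symm⟩
          obtain ⟨rfl, rfl⟩ := hbj
          refine hAt j' hj e.1 (hchain j' ((hmem j').1 hj) j'.2.le fun j'' hj'' hlt s' hs' => ?_)
          have hj1 : j'' ∈ l₁ := by
            rw [hjl, List.pairwise_append, List.pairwise_cons] at hjs
            rw [hjl] at hj''
            rcases List.mem_append.1 hj'' with h1 | h1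
            · exact h1
            · rcases List.mem_cons.1 h1 with rfl | h1
              · exact absurd hlt (lt_irrefl _)
              · exact absurd hlt (not_lt.2 (le_of_lt (hjs.2.1.1 j'' h1)))
          have hz := hpre _ (hl₁ j'' hj1 (Addr.table id j'' (g j'' e.1) s')
            (List.mem_map.2 ⟨s', List.mem_range.2 hs', rfl⟩))
          rwa [hsame _ (table_mem_targetSet.2 ⟨⟨j'', hj'', rfl⟩, (g j'' e.1).2, hs'⟩)] at hz
        · have hzx : Addr.table id j b s ≠ x := fun h =>
            hxT (h ▸ table_mem_targetSet.2 ⟨⟨j, hj, rfl⟩, hb, hs⟩)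
          rw [Function.update_of_ne hzy, Function.update_of_ne hzx] at he' ⊢
          exact hinv j hj b hb s hs e' he'
      · have hUk := hchain k hj₀ le_rfl fun j hj _ s hs => by
          have hz := hfull _ (mem_pathSlots.2 ⟨j, hj, s, hs, rfl⟩)
          rwa [hsame _ (table_mem_targetSet.2 ⟨⟨j, hj, rfl⟩, (g j e.1).2, hs⟩)] at hz
        rw [hU] at hUk
        exact absurd hUk (Finset.notMem_empty _)

/-- The element with hash values `y` (the possible positions in its table, and the destination)
may be in bucket `b` after `i` stages of the routing of table `a`. -/
def CanBe {k n : ℕ} (y : (Fin (k + 1) → Fin n) × Fin n) (a i b : ℕ) : Prop :=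
  ∃ τ : Fin (k + 1), (τ : ℕ) ≤ a ∧
    ∀ r, b.testBit r = if r < i then (y.2 : ℕ).testBit r else (y.1 τ : ℕ).testBit r

open scoped Classical in
/-- The keys that are possibly not accommodated by table `a`. -/
def spill {k : ℕ} (d c a : ℕ) (x : K → (Fin (k + 1) → Fin (2 ^ d)) × Fin (2 ^ d))
    (U : Finset K) : Finset K :=
  U.filter fun κ => ∃ i ≤ d, ∃ b < 2 ^ d, CanBe (x κ) a i b ∧
    c + 1 ≤ (U.filter fun κ' => CanBe (x κ') a i b).card

/-- The keys that are possibly not accommodated by the first tables. -/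
def spillover {k : ℕ} (d c : ℕ) (x : Fin k → K → (Fin (k + 1) → Fin (2 ^ d)) × Fin (2 ^ d))
    (U : Finset K) : ℕ → Finset K
  | 0 => U
  | a + 1 => if h : a < k then spill d c a (x ⟨a, h⟩) (spillover d c x U a)
      else spillover d c x U a

lemma mem_spillover_succ {k d c : ℕ}
    {x : Fin k → K → (Fin (k + 1) → Fin (2 ^ d)) × Fin (2 ^ d)} {U : Finset K} (j : Fin k)
    {i b : ℕ} (hi : i ≤ d) (hb : b < 2 ^ d) {Y : Finset K} (hY : c + 1 ≤ Y.card)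
    (hYU : ∀ κ ∈ Y, κ ∈ spillover d c x U j ∧ CanBe (x j κ) j i b) :
    ∀ κ ∈ Y, κ ∈ spillover d c x U (j + 1) := by
  classical
  intro κ hκ
  rw [spillover, dif_pos j.2, spill, Finset.mem_filter]
  refine ⟨(hYU κ hκ).1, i, hi, b, hb, (hYU κ hκ).2, hY.trans (Finset.card_le_card ?_)⟩
  intro κ' hκ'
  exact Finset.mem_filter.2 (hYU κ' hκ')

/-- One round of the oblivious setup, with given hash functions. -/
def buildRoundWith (w : List (ℕ × ℕ)) (id d k c : ℕ)
    (h : Fin k → K → Fin (2 ^ d)) (j : Fin k) (g : Fin k → K → Fin (2 ^ d)) : Prog K V Unit := do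
  route w id j d c (fun key => (h j key : ℕ))
  (tableSlots id j d c).forM (throwCell id d k c (laterTables j) (fun y => !y.tag) g)

/-- `(x j κ).1 τ` is the bucket of table `j` used for `κ` by throw `τ`, where `0` is the initial
throw and `i + 1` that of round `i`. Round `i` fills only tables after `i`, so the throws that reach
table `j` satisfy `τ ≤ j`, as required in `CanBe`. The spillover is an upper bound depending on hash
values alone, so the order of events, the priorities and the paths of idle cells do not matter. -/
lemma out_build {w : List (ℕ × ℕ)} {c : ℕ} (hw : IsSortingNetwork w (2 * c)) {id d k : ℕ}
    {src : List Addr} (hsrc : ∀ x ∈ src, x ∉ zhtSet id k d c) {m : Mem K V} (hm : UniqueKeys m)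
    (hempty : ∀ x ∈ zhtSet id k d c, (m x).elem = none) {U : Finset K}
    (hU : ∀ x ∈ src, ∀ κ, keyAt m x = some κ → κ ∈ U)
    (x : Fin k → K → (Fin (k + 1) → Fin (2 ^ d)) × Fin (2 ^ d))
    (hx : spillover d c x U k = ∅) :
    Out (do
      src.forM (throwCell id d k c (List.finRange k) (fun _ => true) fun j κ => (x j κ).1 0)
      (List.finRange k).forM fun j => buildRoundWith w id d k c (fun j κ => (x j κ).2) j
        fun j' κ => (x j' κ).1 j.succ) m fun _ _ _ => True := by
  set At : Fin k → ℕ → ℕ → K → Prop := fun j i b κ =>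
    κ ∈ spillover d c x U j ∧ CanBe (x j κ) j i b with hAt
  have hcol : ∀ (j : Fin k) (i : ℕ), i ≤ d → ∀ b < 2 ^ d, ∀ Y : Finset K, c + 1 ≤ Y.card →
      (∀ κ ∈ Y, At j i b κ) → ∀ κ ∈ Y, κ ∈ spillover d c x U (j + 1) :=
    fun j i hi b hb Y hY h => mem_spillover_succ j hi hb hY h
  have hAt0 : ∀ (j : Fin k) (τ : Fin (k + 1)), (τ : ℕ) ≤ j → ∀ κ ∈ spillover d c x U j,
      At j 0 ((x j κ).1 τ) κ := fun j τ hτ κ hκ => ⟨hκ, τ, hτ, fun r => by simp⟩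
  refine Out.bind ((out_throw (fun y hy hT => hsrc y hy (targetSet_subset _ hT))
    (List.pairwise_lt_finRange k) (Nat.zero_le k) (fun j => by simp) _ (spillover d c x U)
    (fun j => At j 0) (fun j _ κ hκ => hAt0 j 0 (Nat.zero_le _) κ hκ)
    (fun j _ => hcol j 0 (Nat.zero_le d)) hx hm
    (fun y hy e _ he => hU y hy _ (keyAt_of_elem he)) ?_).mono ?_)
  · intro j _ b hb s hs e he
    rw [hempty _ ⟨j, j.2, b, hb, s, hs, rfl⟩] at he
    cases he
  rintro tr _ m₁ ⟨hpost, hinv⟩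
  refine (Out.loop' (I := fun (l : List (Fin k)) m' => UniqueKeys m' ∧
    ∀ j ∈ l, ∀ b < 2 ^ d, BucketInv m' id j c b (At j 0 b) fun _ => False)
    ⟨hpost.moved.uniqueKeys hm, hinv⟩ ?_).mono fun _ _ _ _ => trivial
  rintro j l m₂ hsuf ⟨hu, hb⟩
  have hlater : ∀ j', j' ∈ l ↔ j < j' := mem_of_suffix_finRange hsuf
  refine Out.bind ((out_route hw id j d (fun key => ((x j key).2 : ℕ)) (At j)
    (fun κ => κ ∈ spillover d c x U (j + 1)) ?_ (fun i hi => hcol j (i + 1) hi) hu ?_).mono ?_)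
  -- Stage `i` exchanges bit `i` of the starting position for that of the destination; the throw `τ`
  -- from which the element came stays the same.
  · rintro i hi b b' κ ⟨h1, τ, hτ, h2⟩ h3 h4
    refine ⟨h1, τ, hτ, fun r => ?_⟩
    rcases lt_trichotomy r i with h | rfl | h
    · rw [h4 r h.ne, h2, if_pos h, if_pos (by omega)]
    · rw [h3, if_pos (Nat.lt_succ_self r)]
    · rw [h4 r h.ne', h2, if_neg (by omega), if_neg (by omega)]
  · intro b hbd s hs e he
    have := hb j List.mem_cons_self b hbd s hs e he
    exact ⟨this.1, fun h => (this.2 h).elim⟩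
  rintro tr₂ _ m₃ ⟨-, hmv₃, hout₃, hb₃⟩
  have hu₃ := hmv₃.uniqueKeys hu
  have hT : ∀ y ∈ tableSlots id j d c, y ∉ targetSet id d c (laterTables j) := by
    intro y hy
    obtain ⟨b, hb, s, hs, rfl⟩ := mem_tableSlots.1 hy
    rw [table_mem_targetSet]
    rintro ⟨⟨j', hj', he⟩, -, -⟩
    exact absurd (mem_laterTables.1 hj') (by rw [Fin.lt_def, he]; exact lt_irrefl _)
  refine (out_throw hT ((List.pairwise_lt_finRange k).filter _) (j₀ := j + 1) j.2
    (fun j' => mem_laterTables) _ (spillover d c x U) (fun j => At j 0)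
    (fun j' hj' κ hκ => hAt0 j' j.succ (mem_laterTables.1 hj') κ hκ)
    (fun j _ => hcol j 0 (Nat.zero_le d)) hx hu₃ ?_ ?_).mono ?_
  · intro y hy e hsel he
    obtain ⟨b, hbd, s, hs, rfl⟩ := mem_tableSlots.1 hy
    exact (hb₃ b hbd s hs e he).2 (by simpa using hsel)
  · intro j' hj' b hbd s hs
    have hjl : j' ∈ l := (hlater j').2 (mem_laterTables.1 hj')
    rw [hout₃]
    · exact hb j' (List.mem_cons_of_mem _ hjl) b hbd s hs
    · rw [table_mem_tableSet]
      rintro ⟨hc, -⟩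
      exact absurd ((hlater _).1 hjl) (by rw [Fin.lt_def, hc]; exact lt_irrefl _)
  · rintro tr₃ _ m₄ ⟨h1, h2⟩
    exact ⟨h1.moved.uniqueKeys hu₃, fun j' hj' =>
      h2 j' (mem_laterTables.2 ((hlater j').1 hj'))⟩

end Good

/-! ### Reduction of the failure probability to the spillover of random hash values -/

section FailProb

variable {K V : Type}

/-- Hash values of all keys for one table: the possible positions and the destination. -/
abbrev TableHash (K : Type) (k d : ℕ) : Type := K → (Fin (k + 1) → Fin (2 ^ d)) × Fin (2 ^ d)

lemma W_le_one {α : Type} {μ : PMF (List Access × Option (α × Mem K V))}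
    {F : List Access → α → Mem K V → ℝ≥0∞} (hF : ∀ tr x m, F tr x m ≤ 1) : W μ 1 F ≤ 1 := by
  refine (ex_mono (g := fun _ => 1) fun o => ?_).trans (ex_const _ _).le
  rcases o with ⟨tr, _ | ⟨x, m'⟩⟩
  · exact le_rfl
  · exact hF _ _ _

/-- The hash functions of a setup: those of the initial throw, the final ones, and those of
the throws of the rounds, arranged by table. -/
def buildHashEquiv (K : Type) (k n : ℕ) :
    ((Fin k → K → Fin n) × (Fin k → K → Fin n) × (Fin k → Fin k → K → Fin n)) ≃
      (Fin k → K → (Fin (k + 1) → Fin n) × Fin n) where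
  toFun q j κ := (Fin.cons (q.1 j κ) fun i => q.2.2 i j κ, q.2.1 j κ)
  invFun x := (fun j κ => (x j κ).1 0, fun j κ => (x j κ).2, fun i j κ => (x j κ).1 i.succ)
  left_inv q := by simp
  right_inv x := by
    funext j κ
    refine Prod.ext ?_ rfl
    funext i
    refine Fin.cases ?_ (fun i => ?_) i <;> simp

variable [Fintype K] [DecidableEq K]

/-- All hash functions can be drawn in advance. They are regrouped by table instead of by throw,
because the analysis reveals the tables one after another. -/
lemma failProb_build_eq (w : List (ℕ × ℕ)) (id d k c : ℕ) (src : List Addr) (m : Mem K V) :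
    failProb (build w id d k c src m) = avg fun x : Fin k → TableHash K k d =>
      failProb ((do
        src.forM (throwCell id d k c (List.finRange k) (fun _ => true) fun j κ => (x j κ).1 0)
        (List.finRange k).forM fun j => buildRoundWith w id d k c (fun j κ => (x j κ).2) j
          fun j' κ => (x j' κ).1 j.succ : Prog K V Unit) m) := by
  have hround : ∀ (h : Fin k → K → Fin (2 ^ d)) (j : Fin k) (m : Mem K V)
      (F : List Access → Unit → Mem K V → ℝ≥0∞),
      W (buildRound w id d k c h j m) 1 F =
        avg fun g => W (buildRoundWith w id d k c h j g m) 1 F := by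
    intro h j m F
    unfold buildRound buildRoundWith
    simp only [throwInto_eq, W_bind, W_sample, List.nil_append]
    rw [W_avg]
  rw [← avg_equiv (buildHashEquiv K k (2 ^ d)), avg_prod fun g₀ q => failProb ((do
        src.forM (throwCell id d k c (List.finRange k) (fun _ => true)
          fun j κ => (buildHashEquiv K k (2 ^ d) (g₀, q) j κ).1 0)
        (List.finRange k).forM fun j => buildRoundWith w id d k c
          (fun j κ => (buildHashEquiv K k (2 ^ d) (g₀, q) j κ).2) j
          fun j' κ => (buildHashEquiv K k (2 ^ d) (g₀, q) j' κ).1 j.succ : Prog K V Unit) m)]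
  unfold failProb
  rw [build_eq, throwInto_eq]
  simp only [W_bind, W_sample, W_pure]
  congr 1
  funext g₀
  rw [avg_prod fun h gs => W (src.forM (throwCell id d k c (List.finRange k) (fun _ => true)
          fun j κ => (buildHashEquiv K k (2 ^ d) (g₀, h, gs) j κ).1 0) m) 1 fun tr _ m' =>
        W ((List.finRange k).forM (fun j => buildRoundWith w id d k c
          (fun j κ => (buildHashEquiv K k (2 ^ d) (g₀, h, gs) j κ).2) j
          fun j' κ => (buildHashEquiv K k (2 ^ d) (g₀, h, gs) j' κ).1 j.succ) m') 1
            fun _ _ _ => 0]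
  simp only [buildHashEquiv, Equiv.coe_fn_mk, Fin.cons_zero, Fin.cons_succ]
  simp only [W_presample (hround _) (List.nodup_finRange k), W_avg]

lemma failProb_build_le {w : List (ℕ × ℕ)} {c : ℕ} (hw : IsSortingNetwork w (2 * c)) {id d k : ℕ}
    {src : List Addr} (hsrc : ∀ x ∈ src, x ∉ zhtSet id k d c) {m : Mem K V} (hm : UniqueKeys m)
    (hempty : ∀ x ∈ zhtSet id k d c, (m x).elem = none) {U : Finset K}
    (hU : ∀ x ∈ src, ∀ κ, keyAt m x = some κ → κ ∈ U) :
    failProb (build w id d k c src m) ≤ avg fun x : Fin k → TableHash K k d =>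
      if spillover d c x U k = ∅ then 0 else 1 := by
  rw [failProb_build_eq]
  refine ex_mono fun x => ?_
  split_ifs with hx
  · exact (out_build hw hsrc hm hempty hU x hx).failProb.le
  · exact W_le_one fun _ _ _ => zero_le

end FailProb

/-! ### The failure probability of the setup -/

section Probability

open scoped Classical in
/-- The indicator of a proposition. -/
def ind (P : Prop) : ℝ≥0∞ := if P then 1 else 0

lemma ind_pos {P : Prop} (h : P) : ind P = 1 := if_pos h

lemma ind_neg {P : Prop} (h : ¬ P) : ind P = 0 := if_neg h

lemma ind_eq (P : Prop) [Decidable P] : ind P = if P then 1 else 0 := by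
  split_ifs with h
  · exact ind_pos h
  · exact ind_neg h

lemma ind_and (P Q : Prop) : ind (P ∧ Q) = ind P * ind Q := by
  by_cases hP : P <;> by_cases hQ : Q <;> simp [ind, hP, hQ]

/-- The probability of an event under the uniform distribution. -/
def pr {α : Type*} [Fintype α] [Nonempty α] (P : α → Prop) : ℝ≥0∞ := avg fun a => ind (P a)

lemma pr_mono {α : Type*} [Fintype α] [Nonempty α] {P Q : α → Prop} (h : ∀ a, P a → Q a) :
    pr P ≤ pr Q := by
  refine ex_mono fun a => ?_
  by_cases hP : P a
  · rw [ind_pos hP, ind_pos (h a hP)]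
  · rw [ind_neg hP]
    exact zero_le

lemma pr_forall {K Y : Type} [Fintype K] [DecidableEq K] [Fintype Y] [Nonempty Y] (P : Y → Prop)
    (A : Finset K) : (pr fun x : K → Y => ∀ κ ∈ A, P (x κ)) = pr P ^ A.card := by
  classical
  induction A using Finset.induction_on with
  | empty => simp [pr, avg, ex_const, ind]
  | insert κ A hκ ih =>
    rw [Finset.card_insert_of_notMem hκ, pow_succ', ← ih]
    unfold pr
    rw [avg_update κ]
    have h1 : ∀ (y : Y) (x : K → Y),
        ind (∀ κ' ∈ insert κ A, P (Function.update x κ y κ')) =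
          ind (∀ κ' ∈ A, P (x κ')) * ind (P y) := by
      intro y x
      have h2 : (∀ κ' ∈ A, P (Function.update x κ y κ')) ↔ ∀ κ' ∈ A, P (x κ') :=
        forall₂_congr fun κ' hκ' => by
          rw [Function.update_of_ne fun h => hκ (by rwa [h] at hκ')]
      rw [← ind_and, and_comm, Finset.forall_mem_insert, Function.update_self, h2]
    simp only [h1]
    unfold avg
    simp only [mul_comm _ (ind (P _)), ex_const_mul]
    simp only [mul_comm (ind (P _)), ex_const_mul]
    rw [mul_comm]

lemma pr_or_le {α : Type*} [Fintype α] [Nonempty α] (P Q : α → Prop) :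
    (pr fun a => P a ∨ Q a) ≤ pr P + pr Q := by
  unfold pr avg
  rw [← ex_add]
  refine ex_mono fun a => ?_
  by_cases hP : P a
  · simp [hP, ind]
  · by_cases hQ : Q a <;> simp [hP, hQ, ind]

lemma pr_eq_card {α : Type*} [Fintype α] [Nonempty α] (P : α → Prop) [DecidablePred P] :
    pr P = (Fintype.card α : ℝ≥0∞)⁻¹ * ((Finset.univ.filter P).card : ℝ≥0∞) := by
  unfold pr
  rw [avg_eq_sum, Finset.card_filter]
  push_cast
  simp only [ind_eq]

/-- Each of the `d` bits of `b` prescribes one bit of one of two independent uniform numbers. In the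
count, at every place one of the two bits agrees with that of `b`, so the xor of all three is the
unconstrained bit; storing these bits at `τ` frees the destination to encode an arbitrary number. -/
lemma pr_canBe_fixed {k d : ℕ} (τ : Fin (k + 1)) (i : ℕ) {b : ℕ} (hb : b < 2 ^ d) :
    (pr fun y : (Fin (k + 1) → Fin (2 ^ d)) × Fin (2 ^ d) => ∀ r, b.testBit r =
      if r < i then (y.2 : ℕ).testBit r else (y.1 τ : ℕ).testBit r) * (2 ^ d : ℕ) ≤ 1 := by
  classical
  rw [pr_eq_card]
  set A := Finset.univ.filter fun y : (Fin (k + 1) → Fin (2 ^ d)) × Fin (2 ^ d) =>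
    ∀ r, b.testBit r = if r < i then (y.2 : ℕ).testBit r else (y.1 τ : ℕ).testBit r with hA
  have hcard : A.card * 2 ^ d ≤ Fintype.card ((Fin (k + 1) → Fin (2 ^ d)) × Fin (2 ^ d)) := by
    have hn : (Finset.univ : Finset (Fin (2 ^ d))).card = 2 ^ d := Finset.card_fin _
    rw [← Finset.card_univ]
    refine (congrArg (A.card * ·) hn).ge.trans ?_
    rw [← Finset.card_product]
    -- the free bits of the two numbers involved can be stored in one number
    have hlt : ∀ y : (Fin (k + 1) → Fin (2 ^ d)) × Fin (2 ^ d),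
        ((y.1 τ : ℕ) ^^^ (y.2 : ℕ)) ^^^ b < 2 ^ d := fun y =>
      Nat.xor_lt_two_pow (Nat.xor_lt_two_pow (y.1 τ).2 y.2.2) hb
    refine Finset.card_le_card_of_injOn
      (fun q => (Function.update q.1.1 τ ⟨_, hlt q.1⟩, q.2)) (fun _ _ => Finset.mem_univ _) ?_
    rintro ⟨⟨f, q⟩, t⟩ h1 ⟨⟨f', q'⟩, t'⟩ h2 heq
    simp only [Finset.coe_product, Set.mem_prod, Finset.mem_coe, hA, Finset.mem_filter,
      Finset.mem_univ, true_and, and_true] at h1 h2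
    simp only [Prod.mk.injEq] at heq
    obtain ⟨heq, rfl⟩ := heq
    have hw : ((f τ : ℕ) ^^^ (q : ℕ)) ^^^ b = ((f' τ : ℕ) ^^^ (q' : ℕ)) ^^^ b := by
      have := congrFun heq τ
      rw [Function.update_self, Function.update_self] at this
      exact congrArg Fin.val this
    have hw' : ∀ r, ((f τ : ℕ).testBit r ^^ (q : ℕ).testBit r) =
        ((f' τ : ℕ).testBit r ^^ (q' : ℕ).testBit r) := fun r => by
      have := congrArg (fun w => Nat.testBit w r) hw
      simpa only [Nat.testBit_xor, Bool.xor_left_inj] using this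
    have hbits : ∀ r, (f τ : ℕ).testBit r = (f' τ : ℕ).testBit r ∧
        (q : ℕ).testBit r = (q' : ℕ).testBit r := fun r => by
      have e1 := h1 r
      have e2 := h2 r
      have e3 := hw' r
      by_cases hr : r < i
      · rw [if_pos hr] at e1 e2
        rw [← e1, ← e2, Bool.xor_left_inj] at e3
        exact ⟨e3, e1.symm.trans e2⟩
      · rw [if_neg hr] at e1 e2
        rw [← e1, ← e2, Bool.xor_right_inj] at e3
        exact ⟨e1.symm.trans e2, e3⟩
    have hf : f = f' := by
      funext τ'
      by_cases hτ : τ' = τ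
      · subst hτ
        exact Fin.ext (Nat.eq_of_testBit_eq fun r => (hbits r).1)
      · have := congrFun heq τ'
        rwa [Function.update_of_ne hτ, Function.update_of_ne hτ] at this
    have hq : q = q' := Fin.ext (Nat.eq_of_testBit_eq fun r => (hbits r).2)
    rw [hf, hq]
  rw [mul_assoc, ← Nat.cast_mul]
  refine (ENNReal.inv_mul_le_iff (by simp) (ENNReal.natCast_ne_top _)).2 ?_
  rw [mul_one]
  exact_mod_cast hcard

/-- Union bound over the at most `a + 1` throws that can have put the element into table `a`. -/
lemma pr_canBe {k d : ℕ} (a i : ℕ) {b : ℕ} (hb : b < 2 ^ d) :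
    (pr fun y : (Fin (k + 1) → Fin (2 ^ d)) × Fin (2 ^ d) => CanBe y a i b) * (2 ^ d : ℕ) ≤
      (a + 1 : ℕ) := by
  classical
  set Q : Fin (k + 1) → (Fin (k + 1) → Fin (2 ^ d)) × Fin (2 ^ d) → Prop := fun τ y =>
    ∀ r, b.testBit r = if r < i then (y.2 : ℕ).testBit r else (y.1 τ : ℕ).testBit r with hQ
  set S := Finset.univ.filter fun τ : Fin (k + 1) => (τ : ℕ) ≤ a with hS
  have h1 : pr (fun y : (Fin (k + 1) → Fin (2 ^ d)) × Fin (2 ^ d) => CanBe y a i b) ≤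
      ∑ τ ∈ S, pr (Q τ) := by
    unfold pr avg
    rw [← ex_sum]
    refine ex_mono fun y => ?_
    by_cases h : CanBe y a i b
    · obtain ⟨τ, hτ, hy⟩ := id h
      refine le_trans ?_ (Finset.single_le_sum (fun _ _ => zero_le)
        (Finset.mem_filter.2 ⟨Finset.mem_univ τ, hτ⟩))
      rw [ind_pos h, ind_pos hy]
    · rw [ind_neg h]
      exact zero_le
  have hcard : S.card ≤ a + 1 := by
    rw [← Finset.card_range (a + 1)]
    exact Finset.card_le_card_of_injOn (fun τ => (τ : ℕ))
      (fun τ hτ => Finset.mem_coe.2 (Finset.mem_range.2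
        (Nat.lt_succ_of_le (Finset.mem_filter.1 hτ).2)))
      (Fin.val_injective.injOn)
  calc _ ≤ (∑ τ ∈ S, pr (Q τ)) * (2 ^ d : ℕ) := by gcongr
    _ = ∑ τ ∈ S, pr (Q τ) * (2 ^ d : ℕ) := Finset.sum_mul _ _ _
    _ ≤ ∑ _τ ∈ S, 1 := Finset.sum_le_sum fun τ _ => pr_canBe_fixed τ i hb
    _ = (S.card : ℝ≥0∞) := by simp
    _ ≤ _ := by exact_mod_cast hcard

variable {K : Type}

/-- The size of a crowd is bounded by `c + 1` times the number of its subsets with `c + 1` elements.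
The latter is a sum of indicators whose expectations factor over independent keys. -/
lemma card_spill_le {k d c a : ℕ} (x : TableHash K k d) (U : Finset K) :
    ((spill d c a x U).card : ℝ≥0∞) ≤ ∑ i ∈ Finset.range (d + 1), ∑ b ∈ Finset.range (2 ^ d),
      ((c + 1 : ℕ) : ℝ≥0∞) * ∑ A ∈ U.powersetCard (c + 1),
        ind (∀ κ ∈ A, CanBe (x κ) a i b) := by
  classical
  set Z : ℕ → ℕ → Finset K := fun i b => U.filter fun κ => CanBe (x κ) a i b with hZ
  have h1 : spill d c a x U ⊆ (Finset.range (d + 1)).biUnion fun i =>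
      (Finset.range (2 ^ d)).biUnion fun b => if c + 1 ≤ (Z i b).card then Z i b else ∅ := by
    intro κ hκ
    obtain ⟨hU, i, hi, b, hb, hcan, hc⟩ := Finset.mem_filter.1 hκ
    refine Finset.mem_biUnion.2 ⟨i, Finset.mem_range.2 (by omega), Finset.mem_biUnion.2
      ⟨b, Finset.mem_range.2 hb, ?_⟩⟩
    rw [if_pos]
    · exact Finset.mem_filter.2 ⟨hU, hcan⟩
    · convert hc
  have h2 : ∀ i b, (if c + 1 ≤ (Z i b).card then Z i b else ∅).card ≤
      (c + 1) * (Z i b).card.choose (c + 1) := by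
    intro i b
    split_ifs with h
    -- A crowd of `z = t + c + 1` keys satisfies `z ≤ z * (z - 1).choose c = (c + 1) * z.choose (c +
    -- 1)`.
    · obtain ⟨t, ht⟩ := Nat.exists_eq_add_of_le' h
      rw [ht, ← add_assoc, mul_comm, ← Nat.add_one_mul_choose_eq]
      exact Nat.le_mul_of_pos_right _ (Nat.choose_pos (by omega))
    · simp
  have h3 : ∀ i b, (((Z i b).card.choose (c + 1) : ℕ) : ℝ≥0∞) = ∑ A ∈ U.powersetCard (c + 1),
      ind (∀ κ ∈ A, CanBe (x κ) a i b) := by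
    intro i b
    have h4 : (Z i b).powersetCard (c + 1) =
        (U.powersetCard (c + 1)).filter fun A => ∀ κ ∈ A, CanBe (x κ) a i b := by
      ext A
      simp only [hZ, Finset.mem_powersetCard, Finset.mem_filter, Finset.subset_iff]
      constructor
      · rintro ⟨h, h'⟩
        exact ⟨⟨fun κ hκ => (h hκ).1, h'⟩, fun κ hκ => (h hκ).2⟩
      · rintro ⟨⟨h, h'⟩, h''⟩
        exact ⟨fun κ hκ => ⟨h hκ, h'' κ hκ⟩, h'⟩
    rw [← Finset.card_powersetCard, h4, Finset.card_filter]
    push_cast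
    simp only [ind_eq]
  have h5 : (spill d c a x U).card ≤ ∑ i ∈ Finset.range (d + 1), ∑ b ∈ Finset.range (2 ^ d),
      (c + 1) * (Z i b).card.choose (c + 1) :=
    (Finset.card_le_card h1).trans (Finset.card_biUnion_le.trans (Finset.sum_le_sum fun i _ =>
      Finset.card_biUnion_le.trans (Finset.sum_le_sum fun b _ => h2 i b)))
  refine (Nat.cast_le.2 h5).trans (le_of_eq ?_)
  simp only [Nat.cast_sum, Nat.cast_mul, h3]

lemma avg_card_spill_le [Fintype K] [DecidableEq K] {k d c a : ℕ} (U : Finset K) {p : ℝ≥0∞}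
    (hp : ∀ i, ∀ b < 2 ^ d, (pr fun y : (Fin (k + 1) → Fin (2 ^ d)) × Fin (2 ^ d) =>
      CanBe y a i b) ≤ p) :
    (avg fun x : TableHash K k d => ((spill d c a x U).card : ℝ≥0∞)) ≤
      ((d + 1 : ℕ) : ℝ≥0∞) * (((2 ^ d : ℕ) : ℝ≥0∞) * (((c + 1 : ℕ) : ℝ≥0∞) *
        ((U.card.choose (c + 1) : ℕ) * p ^ (c + 1)))) := by
  classical
  refine (ex_mono fun x => card_spill_le x U).trans ?_
  simp only [ex_sum, ex_const_mul]
  have h1 : ∀ i, ∀ b < 2 ^ d, ∀ A ∈ U.powersetCard (c + 1),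
      (ex (PMF.uniformOfFintype (TableHash K k d)) fun x =>
        ind (∀ κ ∈ A, CanBe (x κ) a i b)) ≤ p ^ (c + 1) := by
    intro i b hb A hA
    have h2 := pr_forall (K := K) (fun y : (Fin (k + 1) → Fin (2 ^ d)) × Fin (2 ^ d) =>
      CanBe y a i b) A
    rw [(Finset.mem_powersetCard.1 hA).2] at h2
    exact h2.le.trans (pow_le_pow_left' (hp i b hb) _)
  calc _ ≤ ∑ _i ∈ Finset.range (d + 1), ∑ _b ∈ Finset.range (2 ^ d),
        ((c + 1 : ℕ) : ℝ≥0∞) * ∑ _A ∈ U.powersetCard (c + 1), p ^ (c + 1) := by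
        refine Finset.sum_le_sum fun i _ => Finset.sum_le_sum fun b hb => ?_
        gcongr with A hA
        exact h1 i b (Finset.mem_range.1 hb) A hA
    _ = _ := by
        simp only [Finset.sum_const, Finset.card_range, Finset.card_powersetCard, nsmul_eq_mul]

end Probability

/-! ### Doubly exponential decay of the spillover -/

section Probability

/-- `c ^ c / c!` is a term of the exponential series at `c`, and `e < 3`. -/
lemma pow_self_le_factorial (c : ℕ) : c ^ c ≤ 3 ^ c * c.factorial := by
  have h1 := Real.pow_div_factorial_le_exp (c : ℝ) (Nat.cast_nonneg c) c
  rw [div_le_iff₀ (by positivity)] at h1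
  have h2 : Real.exp (c : ℝ) ≤ 3 ^ c := by
    rw [← mul_one (c : ℝ), Real.exp_nat_mul]
    exact pow_le_pow_left₀ (Real.exp_pos 1).le Real.exp_one_lt_three.le c
  have h3 : (c : ℝ) ^ c ≤ 3 ^ c * c.factorial := h1.trans (by gcongr)
  exact_mod_cast h3

/-- As `c ≥ 12 * L ≥ 6 * (L + 1)`, one has `c! ≥ (c / 3) ^ c ≥ (2 * (L + 1)) ^ c`. The surplus `2 ^
c` absorbs the remaining factors, since `L + 1 ≤ 2 ^ L` and `3 * L + s + 2 ≤ c`. -/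
lemma factorial_large {s L c : ℕ} (hL : 1 ≤ L) (hc : 12 * (s + 1) * L ≤ c) :
    2 ^ L * (L + 1) ^ (c + 1) * 2 ^ (s + L + 2) ≤ c.factorial := by
  have hc6 : 6 * (L + 1) ≤ c := by nlinarith
  have hc2 : L + L + (s + L + 2) ≤ c := by nlinarith
  have h1 : 3 ^ c * (2 ^ c * (L + 1) ^ c) ≤ 3 ^ c * c.factorial := by
    refine le_trans ?_ (pow_self_le_factorial c)
    rw [← mul_pow, ← mul_pow]
    refine Nat.pow_le_pow_left ?_ c
    omega
  refine le_trans ?_ (Nat.le_of_mul_le_mul_left h1 (by positivity))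
  have h2 : L + 1 ≤ 2 ^ L := Nat.lt_two_pow_self
  calc 2 ^ L * (L + 1) ^ (c + 1) * 2 ^ (s + L + 2)
      = 2 ^ L * (L + 1) * 2 ^ (s + L + 2) * (L + 1) ^ c := by ring
    _ ≤ 2 ^ L * 2 ^ L * 2 ^ (s + L + 2) * (L + 1) ^ c := by gcongr
    _ = 2 ^ (L + L + (s + L + 2)) * (L + 1) ^ c := by ring
    _ ≤ 2 ^ c * (L + 1) ^ c := by gcongr; norm_num

/-- The bound on the number of elements that reach table `a`. -/
def loadBound (d a : ℕ) : ℕ := 2 ^ d / 2 ^ (2 ^ a - 1)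

variable {K : Type}

/-- Makes the set of keys reaching table `a` independent of the hash values of table `a`. -/
lemma spillover_congr {k d c : ℕ} {x x' : Fin k → TableHash K k d} (U : Finset K) {a : ℕ}
    (h : ∀ j : Fin k, (j : ℕ) < a → x j = x' j) : spillover d c x U a = spillover d c x' U a := by
  induction a with
  | zero => rfl
  | succ a ih =>
    unfold spillover
    rw [ih fun j hj => h j (by omega)]
    split_ifs with ha
    · rw [h ⟨a, ha⟩ (Nat.lt_succ_self a)]
    · rfl

lemma spillover_subset {k d c : ℕ} (x : Fin k → TableHash K k d) (U : Finset K) {a b : ℕ}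
    (hab : a ≤ b) : spillover d c x U b ⊆ spillover d c x U a := by
  induction b, hab using Nat.le_induction with
  | base => exact subset_rfl
  | succ b _ ih =>
    rw [spillover]
    split_ifs
    · classical
      exact fun κ hκ => ih (Finset.mem_filter.1 (by simpa only [spill] using hκ)).1
    · exact ih

variable [Fintype K] [DecidableEq K]

/-- Put `n = 2 ^ d` and `q = 2 ^ a - 1`. With at most `n / 2 ^ q` keys, the expected spill is at
most `(d + 1) * n * (a + 1) ^ (c + 1) / (2 ^ (q * (c + 1)) * c!)`, and Markov's inequality compares
it with `n / 2 ^ (2 * q + 1)`. As `c + 1 ≥ 2`, the power of two in the denominator pays for `2 ^ (2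
* q)`, and `c!` pays for the rest. The estimates are multiplied out and cancelled at the end to
avoid divisions. -/
lemma pr_spill_le {k d c a s : ℕ} {U : Finset K} (hU : U.card ≤ loadBound d a) (hc : 1 ≤ c)
    (hfact : (d + 1) * (a + 1) ^ (c + 1) * 2 ^ (s + a + 2) ≤ c.factorial) :
    (pr fun x : TableHash K k d => loadBound d (a + 1) < (spill d c a x U).card) ≤
      2⁻¹ ^ (s + a + 1) := by
  set q := 2 ^ a - 1 with hq
  set M := loadBound d (a + 1) with hM
  set n : ℝ≥0∞ := ((2 ^ d : ℕ) : ℝ≥0∞) with hn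
  have hn0 : n ≠ 0 := by simp [hn]
  have hnt : n ≠ ∞ := ENNReal.natCast_ne_top _
  set p : ℝ≥0∞ := ((a + 1 : ℕ) : ℝ≥0∞) / n with hp
  have hpn : n * p = ((a + 1 : ℕ) : ℝ≥0∞) := ENNReal.mul_div_cancel hn0 hnt
  have hcan : ∀ i, ∀ b < 2 ^ d, (pr fun y : (Fin (k + 1) → Fin (2 ^ d)) × Fin (2 ^ d) =>
      CanBe y a i b) ≤ p := fun i b hb =>
    (ENNReal.le_div_iff_mul_le (Or.inl hn0) (Or.inl hnt)).2 (pr_canBe a i hb)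
  have havg := avg_card_spill_le (c := c) U hcan
  set P := pr fun x : TableHash K k d => M < (spill d c a x U).card with hP
  have hmarkov : ((M + 1 : ℕ) : ℝ≥0∞) * P ≤
      avg fun x : TableHash K k d => ((spill d c a x U).card : ℝ≥0∞) := by
    rw [hP, pr, avg, ← ex_const_mul]
    refine ex_mono fun x => ?_
    by_cases h : M < (spill d c a x U).card
    · rw [ind_pos h, mul_one]
      exact_mod_cast h
    · rw [ind_neg h, mul_zero]
      exact zero_le
  have hUq : U.card * 2 ^ q ≤ 2 ^ d :=
    (Nat.mul_le_mul_right _ hU).trans (Nat.div_mul_le_self _ _)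
  -- `2 ^ (a + 1) - 1 = 2 * q + 1`, and `M + 1` makes up for the rounding in `loadBound`. The odd
  -- factor 2 is the reason for the exponent `s + a + 2` in `hfact`.
  have hMq : 2 ^ d ≤ (M + 1) * 2 ^ (2 * q + 1) := by
    have h1 : 2 ^ (a + 1) - 1 = 2 * q + 1 := by
      have : 1 ≤ 2 ^ a := Nat.one_le_two_pow
      rw [pow_succ]
      omega
    have h2 := Nat.lt_mul_div_succ (2 ^ d) (b := 2 ^ (2 ^ (a + 1) - 1)) (by positivity)
    rw [h1, mul_comm] at h2
    rw [hM, loadBound, h1]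
    exact h2.le
  have hchoose : (c + 1) * U.card.choose (c + 1) * c.factorial ≤ U.card ^ (c + 1) := by
    have h1 := Nat.descFactorial_le_pow U.card (c + 1)
    rw [Nat.descFactorial_eq_factorial_mul_choose, Nat.factorial_succ] at h1
    linarith
  have hcf : (c.factorial : ℝ≥0∞) ≠ 0 := by exact_mod_cast c.factorial_ne_zero
  -- combine the estimates
  have hmain : ((c.factorial * (2 ^ q) ^ (c + 1) : ℕ) : ℝ≥0∞) *
      (((M + 1 : ℕ) : ℝ≥0∞) * (P * ((2 ^ (s + a + 1) : ℕ) : ℝ≥0∞))) ≤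
      ((c.factorial * (2 ^ q) ^ (c + 1) : ℕ) : ℝ≥0∞) * (((M + 1 : ℕ) : ℝ≥0∞) * 1) := by
    calc _ = ((c.factorial * (2 ^ q) ^ (c + 1) * 2 ^ (s + a + 1) : ℕ) : ℝ≥0∞) *
          (((M + 1 : ℕ) : ℝ≥0∞) * P) := by push_cast; ring
      _ ≤ ((c.factorial * (2 ^ q) ^ (c + 1) * 2 ^ (s + a + 1) : ℕ) : ℝ≥0∞) *
          (((d + 1 : ℕ) : ℝ≥0∞) * (n * (((c + 1 : ℕ) : ℝ≥0∞) *
            ((U.card.choose (c + 1) : ℕ) * p ^ (c + 1))))) := by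
          exact mul_le_mul' le_rfl (hmarkov.trans havg)
      _ = ((2 ^ (s + a + 1) * (d + 1) * (2 ^ q) ^ (c + 1) *
            ((c + 1) * U.card.choose (c + 1) * c.factorial) : ℕ) : ℝ≥0∞) *
            (n * p ^ (c + 1)) := by
          push_cast; ring
      _ ≤ ((2 ^ (s + a + 1) * (d + 1) * (2 ^ q) ^ (c + 1) * U.card ^ (c + 1) : ℕ) : ℝ≥0∞) *
            (n * p ^ (c + 1)) := by gcongr
      _ = ((2 ^ (s + a + 1) * (d + 1) : ℕ) : ℝ≥0∞) * n *
            (((U.card * 2 ^ q : ℕ) : ℝ≥0∞) * p) ^ (c + 1) := by push_cast; ring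
      _ ≤ ((2 ^ (s + a + 1) * (d + 1) : ℕ) : ℝ≥0∞) * ((M + 1) * 2 ^ (2 * q + 1) : ℕ) *
            (n * p) ^ (c + 1) := by
          rw [hn]
          gcongr
      _ = (((d + 1) * (a + 1) ^ (c + 1) * 2 ^ (s + a + 2) * (2 ^ (2 * q) * (M + 1)) : ℕ) :
            ℝ≥0∞) := by rw [hpn]; push_cast; ring
      _ ≤ ((c.factorial * (2 ^ (q * (c + 1)) * (M + 1)) : ℕ) : ℝ≥0∞) := by
          refine Nat.cast_le.2 (Nat.mul_le_mul hfact (Nat.mul_le_mul_right _ ?_))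
          refine Nat.pow_le_pow_right (by norm_num) ?_
          rw [mul_comm]
          exact Nat.mul_le_mul_left q (by omega)
      _ = _ := by push_cast; ring
  have h1 := (ENNReal.mul_le_mul_iff_right (by
    exact_mod_cast (Nat.mul_pos c.factorial_pos (by positivity)).ne')
    (ENNReal.natCast_ne_top _)).1 hmain
  have h2 := (ENNReal.mul_le_mul_iff_right (by exact_mod_cast (Nat.succ_pos M).ne')
    (ENNReal.natCast_ne_top _)).1 h1
  rw [← ENNReal.inv_pow]
  have h3 : ((2 ^ (s + a + 1) : ℕ) : ℝ≥0∞) = 2 ^ (s + a + 1) := by push_cast; rfl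
  rw [h3] at h2
  rw [← one_mul (2 ^ (s + a + 1) : ℝ≥0∞)⁻¹, ← div_eq_mul_inv]
  exact (ENNReal.le_div_iff_mul_le (Or.inl (by positivity)) (Or.inl (by simp))).2 h2

/-- Table `a` contributes an error `2⁻¹ ^ (s + a + 1)`. The second summand on the left is the unused
tail of this geometric series, which makes the induction close. -/
lemma pr_spillover_le {k d c s L : ℕ} {U : Finset K} (hU : U.card ≤ 2 ^ d) (hd : d < 2 ^ L)
    (hL : 1 ≤ L) (hk : L + 1 ≤ k) (hc : 12 * (s + 1) * L ≤ c) {a : ℕ} (ha : a ≤ L + 1) :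
    (pr fun x : Fin k → TableHash K k d => loadBound d a < (spillover d c x U a).card) +
      2⁻¹ ^ (s + a) ≤ 2⁻¹ ^ s := by
  induction a with
  | zero =>
    have h0 : (pr fun x : Fin k → TableHash K k d =>
        loadBound d 0 < (spillover d c x U 0).card) = 0 := by
      unfold pr avg
      have : ∀ x : Fin k → TableHash K k d, ¬ loadBound d 0 < (spillover d c x U 0).card :=
        fun x => by simpa [loadBound, spillover] using hU
      simp only [ind_neg (this _), ex_const]
    rw [h0, zero_add, add_zero]
  | succ a ih =>
    have hak : a < k := by omega
    have hfact : (d + 1) * (a + 1) ^ (c + 1) * 2 ^ (s + a + 2) ≤ c.factorial := by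
      refine le_trans ?_ (factorial_large hL hc)
      have h1 : a ≤ L := by omega
      have h2 : d + 1 ≤ 2 ^ L := hd
      gcongr
      norm_num
    have hstep : (pr fun x : Fin k → TableHash K k d =>
        (spillover d c x U a).card ≤ loadBound d a ∧
          loadBound d (a + 1) < (spillover d c x U (a + 1)).card) ≤ 2⁻¹ ^ (s + a + 1) := by
      unfold pr
      -- Table `a` is drawn separately from the others; the set of keys reaching it is then fixed,
      -- and `pr_spill_le` applies.
      rw [avg_update ⟨a, hak⟩]
      unfold avg
      rw [ex_comm]
      refine (ex_mono (g := fun _ => 2⁻¹ ^ (s + a + 1)) fun x => ?_).trans (ex_const _ _).le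
      have hsp : ∀ y, spillover d c (Function.update x ⟨a, hak⟩ y) U a = spillover d c x U a :=
        fun y => spillover_congr U fun j hj => Function.update_of_ne
          (fun h => absurd hj (by rw [h]; exact lt_irrefl _)) _ _
      have hsp' : ∀ y, spillover d c (Function.update x ⟨a, hak⟩ y) U (a + 1) =
          spill d c a y (spillover d c x U a) := fun y => by
        rw [spillover, dif_pos hak, hsp, Function.update_self]
      simp only [hsp, hsp']
      by_cases h : (spillover d c x U a).card ≤ loadBound d a
      · have hc1 : 1 ≤ c := by nlinarith
        have h1 := pr_spill_le (k := k) h hc1 hfact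
        exact le_trans (pr_mono fun y hy => hy.2) h1
      · simp only [h, false_and, ind_neg not_false]
        rw [ex_const]
        exact zero_le
    calc _ ≤ ((pr fun x : Fin k → TableHash K k d =>
            loadBound d a < (spillover d c x U a).card) + 2⁻¹ ^ (s + a + 1)) +
              2⁻¹ ^ (s + (a + 1)) := by
          gcongr
          refine le_trans (pr_mono fun x hx => ?_) ((pr_or_le _ _).trans
            (add_le_add_right hstep _))
          by_cases h : loadBound d a < (spillover d c x U a).card
          · exact Or.inl h
          · exact Or.inr ⟨not_lt.1 h, hx⟩
      _ = (pr fun x : Fin k → TableHash K k d =>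
            loadBound d a < (spillover d c x U a).card) + 2⁻¹ ^ (s + a) := by
          rw [add_assoc, ← add_assoc s a 1, ← two_mul, pow_succ', ← mul_assoc,
            ENNReal.mul_inv_cancel (by norm_num) (by norm_num), one_mul]
      _ ≤ _ := ih (by omega)

variable {V : Type}

/-- The load bound vanishes after `L + 1` tables, since `d < 2 ^ L` gives `2 ^ (L + 1) - 1 > d`;
after `L` tables it could still be 1, for `d + 1 = 2 ^ L`. Further tables do no harm because the
spillover only shrinks. -/
lemma failProb_build_small {w : List (ℕ × ℕ)} {c : ℕ} (hw : IsSortingNetwork w (2 * c))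
    {id d k s : ℕ} {src : List Addr} (hsrc : ∀ x ∈ src, x ∉ zhtSet id k d c) {m : Mem K V}
    (hm : UniqueKeys m) (hempty : ∀ x ∈ zhtSet id k d c, (m x).elem = none) {U : Finset K}
    (hU : ∀ x ∈ src, ∀ κ, keyAt m x = some κ → κ ∈ U) (hcard : U.card ≤ 2 ^ d)
    (hk : 12 * (s + 1) * (Nat.log 2 d + 1) ≤ k) (hc : 12 * (s + 1) * (Nat.log 2 d + 1) ≤ c) :
    failProb (build w id d k c src m) ≤ 2⁻¹ ^ s := by
  refine (failProb_build_le hw hsrc hm hempty hU).trans ?_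
  set L := Nat.log 2 d + 1 with hL
  have hL1 : 1 ≤ L := by omega
  have hd : d < 2 ^ L := Nat.lt_pow_succ_log_self (by norm_num) d
  have hLk : L + 1 ≤ k := by nlinarith
  refine le_trans ?_ ((le_self_add).trans
    (pr_spillover_le (s := s) hcard hd hL1 hLk hc (a := L + 1) le_rfl))
  refine ex_mono fun x => ?_
  split_ifs with h
  · exact zero_le
  · rw [ind_pos]
    have h0 : loadBound d (L + 1) = 0 := by
      refine Nat.div_eq_of_lt (Nat.pow_lt_pow_right (by norm_num) ?_)
      rw [pow_succ]
      omega
    rw [h0]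
    exact Finset.card_pos.2 ((Finset.nonempty_iff_ne_empty.2 h).mono (spillover_subset x U hLk))

end Probability

/-! ### Searching -/

section Search

lemma Out.foldlM_true {K V α ι : Type} {f : α → ι → Prog K V α}
    (hf : ∀ a i m, Out (f a i) m fun _ _ _ => True) (l : List ι) (a : α) (m : Mem K V) :
    Out (l.foldlM f a) m fun _ _ _ => True := by
  induction l generalizing a m with
  | nil => exact Out.pure trivial
  | cons i l ih =>
    rw [List.foldlM_cons]
    exact Out.bind ((hf a i m).mono fun _ a' m' _ => ih a' m')

variable {K V : Type} [DecidableEq K]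

/-- The memory during a search: the cell `x₀` is emptied once the element has been found. -/
def erased (m : Mem K V) (x₀ : Addr) (r : Option V) : Mem K V :=
  match r with
  | none => m
  | some _ => Function.update m x₀ Cell.empty

lemma out_searchSlot {m : Mem K V} (hm : UniqueKeys m) {x₀ : Addr} {κ : K}
    (hx₀ : keyAt m x₀ = some κ) (r : Option V) (x : Addr) :
    Out (searchSlot κ r x) (erased m x₀ r) fun tr r' m' =>
      tr = touch [x] ∧ m' = erased m x₀ r' ∧ (r'.isSome ↔ r.isSome ∨ x = x₀) := by
  unfold searchSlot
  refine Out.bind (Out.read ?_)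
  cases r with
  | some v =>
    refine Out.bind (Out.write (Out.pure ?_))
    rw [Function.update_eq_self]
    exact ⟨rfl, rfl, by simp⟩
  | none =>
    unfold erased
    cases he : (m x).elem with
    | none =>
      refine Out.bind (Out.write (Out.pure ?_))
      rw [Function.update_eq_self]
      refine ⟨rfl, rfl, ?_⟩
      have : x ≠ x₀ := fun h => by
        rw [← h, keyAt_eq_none.2 he] at hx₀
        cases hx₀
      simpa using this
    | some e =>
      have hk := keyAt_of_elem he
      dsimp only
      split_ifs with heq
      · refine Out.bind (Out.write (Out.pure ?_))
        rw [heq] at hk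
        have hxx := hm _ _ _ hk hx₀
        subst hxx
        exact ⟨rfl, rfl, by simp⟩
      · refine Out.bind (Out.write (Out.pure ?_))
        rw [Function.update_eq_self]
        refine ⟨rfl, rfl, ?_⟩
        have : x ≠ x₀ := fun h => by
          rw [← h, hk] at hx₀
          exact heq (Option.some.inj hx₀)
        simpa using this

/-- Since the key occurs only at `x₀`, the memory during a search is determined by whether that cell
has been met. -/
lemma out_searchSlots {m : Mem K V} (hm : UniqueKeys m) {x₀ : Addr} {κ : K}
    (hx₀ : keyAt m x₀ = some κ) (L : List Addr) (r : Option V) :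
    Out (L.foldlM (searchSlot κ) r) (erased m x₀ r) fun tr r' m' =>
      tr = touch L ∧ m' = erased m x₀ r' ∧ (r'.isSome ↔ r.isSome ∨ x₀ ∈ L) := by
  induction L generalizing r with
  | nil => exact Out.pure ⟨rfl, rfl, by simp⟩
  | cons x L ih =>
    rw [List.foldlM_cons]
    refine Out.bind ((out_searchSlot hm hx₀ r x).mono ?_)
    rintro tr r₁ m₁ ⟨rfl, rfl, h1⟩
    refine (ih r₁).mono ?_
    rintro tr r₂ m₂ ⟨rfl, rfl, h2⟩
    refine ⟨rfl, rfl, ?_⟩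
    rw [h2, h1, List.mem_cons, or_assoc, eq_comm (a := x)]

lemma out_searchSlot_true (κ : K) (r : Option V) (x : Addr) (m : Mem K V) :
    Out (searchSlot κ r x) m fun _ _ _ => True := by
  unfold searchSlot
  refine Out.bind (Out.read ?_)
  split
  · split_ifs
    · exact Out.bind (Out.write (Out.pure trivial))
    · exact Out.bind (Out.write (Out.pure trivial))
  · exact Out.bind (Out.write (Out.pure trivial))

lemma out_search_true (id d k c : ℕ) (h : Fin k → K → Fin (2 ^ d)) (κ : K) (r : Option V)
    (m : Mem K V) : Out (search id d k c h κ r) m fun _ _ _ => True :=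
  Out.bind (Out.sample fun _ => Out.foldlM_true (out_searchSlot_true κ) _ _ _)

/-- The simulation of a search. -/
def searchSim (id d k c : ℕ) (row : Option (Fin k → Fin (2 ^ d))) : Sim Unit :=
  (Sim.sample (Fin k → Fin (2 ^ d))).seq fun rnd =>
    emit (touch (pathSlots id d k c (List.finRange k) (row.getD rnd)))

/-- A missing row stands for a random path. Before the element is found, the simulated search still
follows the real hash values; these are randomized only later, by `avg_lookup`. -/
lemma dom_search {m : Mem K V} (hm : UniqueKeys m) {x₀ : Addr} {κ : K}
    (hx₀ : keyAt m x₀ = some κ) (id d k c : ℕ) (h : Fin k → K → Fin (2 ^ d)) (r : Option V) :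
    Dom (search id d k c h κ r) (erased m x₀ r)
      (searchSim id d k c (if r.isSome then none else some fun j => h j κ))
      fun r' m' _ => m' = erased m x₀ r' ∧ (r'.isSome ↔ r.isSome ∨
        x₀ ∈ pathSlots id d k c (List.finRange k) fun j => h j κ) := by
  unfold search searchSim
  refine (Dom.sample (R := fun x m' y => x = y ∧ m' = erased m x₀ r) fun x => ⟨rfl, rfl⟩).bind ?_
  rintro rnd _ _ ⟨rfl, rfl⟩
  cases r with
  | none => exact (out_searchSlots hm hx₀ _ none).dom
  | some v =>
    refine Dom.mono ((out_searchSlots hm hx₀ _ (some v)).dom) ?_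
    rintro r' m' _ ⟨h1, h2⟩
    exact ⟨h1, by simpa using h2⟩

end Search

/-! ### The state of the pyramid -/

section Pyramid

variable {K V : Type} (P : Params)

/-- Hash functions for all levels. -/
abbrev Tape (K : Type) : Type :=
  (i : Fin (P.depth + 1)) → Fin (P.k i) → K → Fin (2 ^ (P.logp + i))

/-- The level built by the `m`-th rebuild. -/
def rebuildLevel (m : ℕ) : ℕ := min (padicValNat 2 m) P.depth

lemma rebuildLevel_lt (m : ℕ) : rebuildLevel P m < P.depth + 1 :=
  Nat.lt_succ_of_le (min_le_right _ _)

/-- The identifiers of the nonempty levels after a rebuild of level `v`. -/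
def reshape (v id : ℕ) (sh : ℕ → Option ℕ) : ℕ → Option ℕ :=
  Function.update (fun i => if i < v then none else sh i) v (some id)

/-- The identifiers of the nonempty levels after `t` accesses. -/
def shape : ℕ → ℕ → Option ℕ
  | 0 => Function.update (fun _ => none) P.depth (some 0)
  | t + 1 => if (t + 1) % P.p = 0 then
      reshape (rebuildLevel P ((t + 1) / P.p)) ((t + 1) / P.p) (shape t)
    else shape t

/-- The client state with given identifiers and hash functions. -/
def clientState (sh : ℕ → Option ℕ) (τ : Tape P K) : ClientState P K := fun i =>
  if hi : i < P.depth + 1 then (sh i).map fun id => (id, τ ⟨i, hi⟩) else none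

variable {P}

lemma clientState_apply (sh : ℕ → Option ℕ) (τ : Tape P K) (i : Fin (P.depth + 1)) :
    clientState P sh τ i = (sh i).map fun id => (id, τ i) := dif_pos i.2

/-- The client state splits into a public shape and a tape of hash functions, and a rebuild acts on
each of them separately. An emptied level keeps its stale functions on the tape, hidden by the
shape. -/
lemma clientState_reshape (sh : ℕ → Option ℕ) (τ : Tape P K) (v : Fin (P.depth + 1)) (id : ℕ)
    (h : Fin (P.k v) → K → Fin (2 ^ (P.logp + v))) :
    Function.update (fun i => if i < (v : ℕ) then none else clientState P sh τ i) v
      (some (id, h)) = clientState P (reshape v id sh) (Function.update τ v h) := by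
  funext i
  by_cases hi : i < P.depth + 1
  · lift i to Fin (P.depth + 1) using hi
    rw [clientState_apply]
    by_cases hiv : i = v
    · subst hiv
      simp [reshape]
    · have hiv' : (i : ℕ) ≠ v := fun h => hiv (Fin.ext h)
      rw [Function.update_of_ne hiv', Function.update_of_ne hiv, reshape,
        Function.update_of_ne hiv', clientState_apply]
      split_ifs <;> rfl
  · have hiv : i ≠ v := fun h => hi (h ▸ v.2)
    rw [Function.update_of_ne hiv, clientState, clientState, dif_neg hi, dif_neg hi, ite_self]

variable (P)

/-- Identifiers are unique and bounded, and only levels up to the last are nonempty. -/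
structure ShapeOk (sh : ℕ → Option ℕ) (q : ℕ) : Prop where
  le : ∀ {i id}, sh i = some id → id ≤ q
  inj : ∀ {i i' id}, sh i = some id → sh i' = some id → i = i'
  depth : ∀ {i id}, sh i = some id → i < P.depth + 1

variable {P}

lemma reshape_self (v id : ℕ) (sh : ℕ → Option ℕ) : reshape v id sh v = some id :=
  Function.update_self _ _ _

lemma reshape_eq_some {v id id' i : ℕ} {sh : ℕ → Option ℕ} (h : reshape v id sh i = some id') :
    (i = v ∧ id' = id) ∨ (v < i ∧ sh i = some id') := by
  unfold reshape at h
  by_cases hi : i = v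
  · subst hi
    rw [Function.update_self] at h
    exact Or.inl ⟨rfl, (Option.some.inj h).symm⟩
  · rw [Function.update_of_ne hi] at h
    split_ifs at h with hlt
    exact Or.inr ⟨by omega, h⟩

lemma reshape_of_lt {v id i : ℕ} {sh : ℕ → Option ℕ} (h : v < i) :
    reshape v id sh i = sh i := by
  unfold reshape
  rw [Function.update_of_ne h.ne', if_neg (by omega)]

lemma ShapeOk.reshape {sh : ℕ → Option ℕ} {q v : ℕ} (h : ShapeOk P sh q) (hv : v < P.depth + 1) :
    ShapeOk P (reshape v (q + 1) sh) (q + 1) := by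
  refine ⟨fun h1 => ?_, fun h1 h2 => ?_, fun h1 => ?_⟩
  · rcases reshape_eq_some h1 with ⟨-, rfl⟩ | ⟨-, h1⟩
    · exact le_rfl
    · exact (h.le h1).trans (Nat.le_succ q)
  · rcases reshape_eq_some h1 with ⟨h3, h4⟩ | ⟨-, h3⟩ <;>
      rcases reshape_eq_some h2 with ⟨h5, h6⟩ | ⟨-, h5⟩
    · exact h3.trans h5.symm
    · exact absurd (h.le h5) (by omega)
    · exact absurd (h.le h3) (by omega)
    · exact h.inj h3 h5
  · rcases reshape_eq_some h1 with ⟨rfl, -⟩ | ⟨-, h1⟩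
    · exact hv
    · exact h.depth h1

lemma shape_succ_of_mod {t : ℕ} (ht : (t + 1) % P.p = 0) :
    shape P (t + 1) = reshape (rebuildLevel P (t / P.p + 1)) (t / P.p + 1) (shape P t) := by
  rw [shape, if_pos ht, Nat.succ_div_of_dvd (Nat.dvd_of_mod_eq_zero ht)]

lemma shapeOk_shape (t : ℕ) : ShapeOk P (shape P t) (t / P.p) := by
  induction t with
  | zero =>
    have key : ∀ {i id}, shape P 0 i = some id → i = P.depth ∧ id = 0 := fun {i id} h => by
      unfold shape at h
      by_cases hi : i = P.depth
      · subst hi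
        rw [Function.update_self] at h
        exact ⟨rfl, (Option.some.inj h).symm⟩
      · rw [Function.update_of_ne hi] at h
        cases h
    exact ⟨fun h => (key h).2.le.trans (Nat.zero_le _), fun h h' => (key h).1.trans (key h').1.symm,
      fun h => by rw [(key h).1]; exact Nat.lt_succ_self _⟩
  | succ t ih =>
    by_cases ht : (t + 1) % P.p = 0
    · rw [shape_succ_of_mod ht, Nat.succ_div_of_dvd (Nat.dvd_of_mod_eq_zero ht)]
      exact ih.reshape (rebuildLevel_lt P _)
    · rw [shape, if_neg ht, Nat.succ_div_of_not_dvd fun h => ht (Nat.mod_eq_zero_of_dvd h)]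
      exact ih

variable (P)

/-- The cell `x` is a possible place for the key `κ` when it is stored in the list (`l = 0`) or in
level `i` (`l = i + 1`). -/
def Located (sh : ℕ → Option ℕ) (τ : Tape P K) (κ : K) : ℕ → Addr → Prop
  | 0, x => x ∈ listSlots P
  | i + 1, x => ∃ hi : i < P.depth + 1, ∃ id, sh i = some id ∧
      x ∈ pathSlots id (P.logp + i) (P.k i) (P.c i) (List.finRange _) fun j => τ ⟨i, hi⟩ j κ

/-- Bounds for the number of keys in the list and in the levels but the last, after `q` rebuilds. -/
def LoadOk (U : Finset K) (n q : ℕ) (loc : K → ℕ) : Prop :=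
  (U.filter fun κ => loc κ = 0).card ≤ n ∧
    ∀ i < P.depth, (U.filter fun κ => loc κ = i + 1).card ≤ q / 2 ^ i % 2 * 2 ^ (P.logp + i)

/-- The memory after `q` rebuilds and `n` further accesses stores the keys `U`, and each key `κ` is
at a possible place in the list or in a level, as indicated by `loc κ`. -/
structure Good (U : Finset K) (sh : ℕ → Option ℕ) (n q : ℕ) (loc : K → ℕ) (τ : Tape P K)
    (m : Mem K V) : Prop where
  unique : UniqueKeys m
  keys : ∀ x κ, keyAt m x = some κ → κ ∈ U
  located : ∀ κ ∈ U, ∃ x, keyAt m x = some κ ∧ Located P sh τ κ (loc κ) x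
  fresh : ∀ id j b s, q < id → keyAt m (Addr.table id j b s) = none
  list_empty : ∀ i, n ≤ i → keyAt m (Addr.list i) = none
  load : LoadOk P U n q loc

variable {P}

lemma mem_pathSlots_table {id d k c j b s : ℕ} {id' : ℕ} {js : List (Fin k)}
    {row : Fin k → Fin (2 ^ d)} (h : Addr.table id j b s ∈ pathSlots id' d k c js row) :
    id = id' := by
  obtain ⟨j', -, s', -, he⟩ := mem_pathSlots.1 h
  simp only [Addr.table.injEq] at he
  exact he.1

lemma mem_listSlots {x : Addr} : x ∈ listSlots P ↔ ∃ i < P.p, x = Addr.list i := by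
  simp [listSlots, eq_comm]

/-- A key stored in a table is recorded at the level of this table. -/
lemma Located.eq_level {sh : ℕ → Option ℕ} {q : ℕ} (hsh : ShapeOk P sh q) {τ : Tape P K} {κ : K}
    {l id j b s i : ℕ} (h : Located P sh τ κ l (Addr.table id j b s)) (hi : sh i = some id) :
    l = i + 1 := by
  cases l with
  | zero =>
    obtain ⟨i', -, he⟩ := mem_listSlots.1 h
    cases he
  | succ l =>
    obtain ⟨_, id', h1, h2⟩ := h
    have := mem_pathSlots_table h2
    subst this
    rw [hsh.inj hi h1]

lemma Located.eq_zero {sh : ℕ → Option ℕ} {τ : Tape P K} {κ : K} {l i : ℕ}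
    (h : Located P sh τ κ l (Addr.list i)) : l = 0 := by
  cases l with
  | zero => rfl
  | succ l =>
    obtain ⟨_, id', h1, h2⟩ := h
    obtain ⟨j', -, s', -, he⟩ := mem_pathSlots.1 h2
    cases he

/-- The effect on `loc` of an access to the key `κ`, without the rebuild. -/
def touchLoc [DecidableEq K] (loc : K → ℕ) (κ : K) : K → ℕ := Function.update loc κ 0

/-- The effect on `loc` of a rebuild of level `v`. -/
def rebuildLoc (v : ℕ) (loc : K → ℕ) : K → ℕ := fun κ => if loc κ ≤ v + 1 then v + 1 else loc κ

/-- The accessed key leaves its place for the list, so only the bound for the list grows. -/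
lemma LoadOk.touch [DecidableEq K] {U : Finset K} {n q : ℕ} {loc : K → ℕ}
    (h : LoadOk P U n q loc) (κ : K) : LoadOk P U (n + 1) q (touchLoc loc κ) := by
  refine ⟨?_, fun i hi => le_trans (Finset.card_le_card ?_) (h.2 i hi)⟩
  · refine (Finset.card_le_card (t := insert κ (U.filter fun κ => loc κ = 0)) ?_).trans
      ((Finset.card_insert_le _ _).trans (Nat.add_le_add_right h.1 1))
    intro κ' hκ'
    rw [Finset.mem_filter] at hκ'
    unfold touchLoc at hκ'
    rw [Finset.mem_insert, Finset.mem_filter]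
    by_cases hk : κ' = κ
    · exact Or.inl hk
    · rw [Function.update_of_ne hk] at hκ'
      exact Or.inr hκ'
  · intro κ' hκ'
    rw [Finset.mem_filter] at hκ' ⊢
    unfold touchLoc at hκ'
    by_cases hk : κ' = κ
    · subst hk
      rw [Function.update_self] at hκ'
      omega
    · rwa [Function.update_of_ne hk] at hκ'

/-- The bits of the counter beyond the rebuilt level are not reached by the carry. -/
lemma rebuildLevel_div {q i : ℕ} (hi : rebuildLevel P (q + 1) < i) (hid : i ≤ P.depth) :
    (q + 1) / 2 ^ i = q / 2 ^ i := by
  refine Nat.succ_div_of_not_dvd fun h => ?_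
  have := (padicValNat_dvd_iff_le (p := 2) (by omega : q + 1 ≠ 0)).1 h
  unfold rebuildLevel at hi
  omega

/-- Incrementing the binary counter `q` carries up to its lowest zero bit, which is the 2-adic
valuation of `q + 1`. With `LoadOk`, this shows that a level other than the last holds no key just
before it is built. -/
lemma rebuildLevel_odd {q : ℕ} (h : rebuildLevel P (q + 1) < P.depth) :
    q / 2 ^ rebuildLevel P (q + 1) % 2 = 0 ∧ (q + 1) / 2 ^ rebuildLevel P (q + 1) % 2 = 1 := by
  have hv : rebuildLevel P (q + 1) = padicValNat 2 (q + 1) := by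
    unfold rebuildLevel at h ⊢
    omega
  rw [hv]
  have h1 : 2 ^ padicValNat 2 (q + 1) ∣ q + 1 := pow_padicValNat_dvd
  have h2 : ¬ 2 ^ (padicValNat 2 (q + 1) + 1) ∣ q + 1 :=
    pow_succ_padicValNat_not_dvd (by omega)
  have h3 : (q + 1) / 2 ^ padicValNat 2 (q + 1) % 2 = 1 := by
    rw [pow_succ] at h2
    obtain ⟨a, ha⟩ := h1
    have hpos : 0 < 2 ^ padicValNat 2 (q + 1) := by positivity
    have h4 : (q + 1) / 2 ^ padicValNat 2 (q + 1) = a :=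
      Nat.div_eq_of_eq_mul_right hpos ha
    rw [h4]
    by_contra hc
    obtain ⟨b, hb⟩ : 2 ∣ a := by omega
    exact h2 ⟨b, by rw [mul_assoc, ← hb]; exact ha⟩
  refine ⟨?_, h3⟩
  rw [Nat.succ_div_of_dvd h1] at h3
  omega

/-- The elements that take part in a rebuild fit into the new level. -/
lemma LoadOk.card_le {U : Finset K} {n q : ℕ} {loc : K → ℕ} (h : LoadOk P U n q loc)
    (hn : n ≤ P.p) (hU : U.card ≤ P.N) :
    (U.filter fun κ => loc κ ≤ rebuildLevel P (q + 1) + 1).card ≤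
      2 ^ (P.logp + rebuildLevel P (q + 1)) := by
  set v := rebuildLevel P (q + 1) with hv
  have hstep : ∀ j, (U.filter fun κ => loc κ ≤ j + 1).card ≤
      (U.filter fun κ => loc κ ≤ j).card + (U.filter fun κ => loc κ = j + 1).card := fun j => by
    classical
    refine (Finset.card_le_card fun κ hκ => ?_).trans (Finset.card_union_le _ _)
    simp only [Finset.mem_union, Finset.mem_filter] at hκ ⊢
    rcases Nat.le_succ_iff.1 hκ.2 with h1 | h1
    · exact Or.inl ⟨hκ.1, h1⟩
    · exact Or.inr ⟨hκ.1, h1⟩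
  -- The list and the first `j` levels together hold at most `p + (p + 2 * p + … + 2 ^ (j - 1) * p)
  -- = 2 ^ j * p` keys.
  have hsum : ∀ j ≤ P.depth, (U.filter fun κ => loc κ ≤ j).card ≤ 2 ^ (P.logp + j) := by
    intro j
    induction j with
    | zero =>
      intro _
      simp only [Nat.le_zero]
      exact h.1.trans hn
    | succ j ih =>
      intro hj
      refine (hstep j).trans ((Nat.add_le_add (ih (by omega)) (h.2 j hj)).trans ?_)
      have : q / 2 ^ j % 2 ≤ 1 := by omega
      rw [← add_assoc, pow_succ, mul_two]
      exact Nat.add_le_add_left ((Nat.mul_le_mul_right _ this).trans (one_mul _).le) _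
  -- Before the last level, the level to be built contributes nothing, its counter bit being 0. The
  -- last level has room for all keys.
  rcases (show v ≤ P.depth from min_le_right _ _).lt_or_eq with hlt | heq
  · refine (hstep v).trans ?_
    have h1 := h.2 v hlt
    rw [(rebuildLevel_odd hlt).1, zero_mul] at h1
    have h2 := hsum v hlt.le
    omega
  · rw [heq]
    exact (Finset.card_filter_le _ _).trans hU

lemma LoadOk.rebuild {U : Finset K} {n q : ℕ} {loc : K → ℕ} (h : LoadOk P U n q loc)
    (hn : n ≤ P.p) (hU : U.card ≤ P.N) :
    LoadOk P U 0 (q + 1) (rebuildLoc (rebuildLevel P (q + 1)) loc) := by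
  have hcard := h.card_le hn hU
  set v := rebuildLevel P (q + 1) with hv
  refine ⟨?_, fun i hi => ?_⟩
  · rw [Finset.filter_eq_empty_iff.2, Finset.card_empty]
    intro κ _ hc
    rw [rebuildLoc] at hc
    split_ifs at hc
    omega
  · rcases lt_trichotomy i v with hiv | hiv | hiv
    · rw [Finset.filter_eq_empty_iff.2, Finset.card_empty]
      · exact Nat.zero_le _
      intro κ _
      simp only [rebuildLoc]
      split_ifs <;> omega
    · rw [hiv, (rebuildLevel_odd (show v < P.depth from hiv ▸ hi)).2, one_mul]
      refine le_trans (Finset.card_le_card fun κ hκ => ?_) hcard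
      rw [Finset.mem_filter] at hκ ⊢
      unfold rebuildLoc at hκ
      split_ifs at hκ with hc
      · exact ⟨hκ.1, hc⟩
      · exact ⟨hκ.1, hκ.2.le⟩
    · rw [rebuildLevel_div hiv hi.le]
      refine le_trans (Finset.card_le_card fun κ hκ => ?_) (h.2 i hi)
      rw [Finset.mem_filter] at hκ ⊢
      unfold rebuildLoc at hκ
      split_ifs at hκ with hc
      · omega
      · exact hκ

end Pyramid

/-! ### Accesses -/

section Lookup

variable {K V : Type}

lemma Dom.foldlM {α ι : Type} {f : α → ι → Prog K V α} {g : ι → Sim Unit} {l : List ι}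
    {I : List ι → α → Mem K V → Prop} {a : α} {m : Mem K V} (h0 : I l a m)
    (hstep : ∀ i l' a m, i :: l' <:+ l → I (i :: l') a m →
      Dom (f a i) m (g i) fun a' m' _ => I l' a' m') :
    Dom (l.foldlM f a) m (Sim.loop l g) fun a' m' _ => I [] a' m' := by
  induction l generalizing a m with
  | nil => exact Dom.pure h0
  | cons i l ih =>
    rw [List.foldlM_cons]
    exact (hstep i l a m List.suffix_rfl h0).bind fun a' m' _ hm' =>
      ih hm' fun i' l' a'' m'' hs => hstep i' l' a'' m'' (hs.trans (List.suffix_cons i l))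

variable [DecidableEq K] {P : Params}

variable (P) in
/-- The search in one level. -/
def levelSearch (st : ClientState P K) (κ : K) (found : Option V) (i : ℕ) :
    Prog K V (Option V) :=
  match st i with
  | none => pure found
  | some (id, h) => search id (P.logp + i) (P.k i) (P.c i) h κ found

variable (P) in
/-- An access without the rebuild. -/
def lookup (t : ℕ) (κ : K) (newVal : Option V) (st : ClientState P K) :
    Prog K V (Option V) := do
  let found₀ ← (listSlots P).foldlM (searchSlot κ) none
  let found ← (List.range (P.depth + 1)).foldlM (levelSearch P st κ) found₀
  Prog.write (Addr.list (t % P.p)) ⟨(newVal <|> found).map fun v => (κ, v), true, 0⟩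
  pure found

lemma W_access [Fintype K] (t : ℕ) (κ : K) (newVal : Option V) (st : ClientState P K)
    (m : Mem K V) (z : ℝ≥0∞) (F : List Access → Option V × ClientState P K → Mem K V → ℝ≥0∞) :
    W (access P t κ newVal st m) z F =
      W (lookup P t κ newVal st m) z fun tr found m' =>
        if (t + 1) % P.p = 0 then
          W (rebuild P ((t + 1) / P.p) st m') z fun tr' st' => F (tr ++ tr') (found, st')
        else F tr (found, st) m' := by
  unfold access lookup
  simp only [W_bind, W_write, W_pure]
  congr 1
  funext tr r m₁
  change W (List.foldlM (levelSearch P st κ) r _ _) z _ = _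
  congr 1
  funext tr' r' m₂
  split_ifs with h
  · rw [W_bind]
    simp only [W_pure, List.append_assoc, List.append_nil]
  · simp only [W_pure, List.append_nil]

lemma out_lookup_true (t : ℕ) (κ : K) (newVal : Option V) (st : ClientState P K) (m : Mem K V) :
    Out (lookup P t κ newVal st) m fun _ _ _ => True := by
  unfold lookup
  refine Out.bind ((Out.foldlM_true (out_searchSlot_true κ) _ _ _).mono fun _ r m₁ _ => ?_)
  refine Out.bind ((Out.foldlM_true (fun r i m => ?_) _ _ _).mono fun _ r m₁ _ => ?_)
  · unfold levelSearch
    split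
    · exact Out.pure trivial
    · exact out_search_true _ _ _ _ _ _ _ _
  · exact Out.bind (Out.write (Out.pure trivial))

variable (P) in
/-- The simulation of the search in one level, on a given or on a random path. -/
def levelSim (sh : ℕ → Option ℕ) (i : Fin (P.depth + 1))
    (row : Option (Fin (P.k i) → Fin (2 ^ (P.logp + i)))) : Sim Unit :=
  match sh i with
  | none => emit []
  | some id => searchSim id (P.logp + i) (P.k i) (P.c i) row

variable (P) in
/-- The simulation of an access without the rebuild, on given or on random paths. -/
def lookupSim (sh : ℕ → Option ℕ) (t : ℕ)
    (rows : (i : Fin (P.depth + 1)) → Option (Fin (P.k i) → Fin (2 ^ (P.logp + i)))) :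
    Sim Unit :=
  (emit (touch (listSlots P))).seq fun _ =>
    (Sim.loop (List.finRange (P.depth + 1)) fun i => levelSim P sh i (rows i)).seq fun _ =>
      emit [⟨Addr.list (t % P.p), true⟩]

/-- The paths on which a key is searched. -/
def searchRows (τ : Tape P K) (κ : K) (l : ℕ) (i : Fin (P.depth + 1)) :
    Option (Fin (P.k i) → Fin (2 ^ (P.logp + i))) :=
  if l ≤ i then none else some fun j => τ i j κ

/-- Only keys and their places are tracked, so the values `v` and `w` play no role. The list cell
that is overwritten held no element, by `list_empty`. -/
lemma Good.found {U : Finset K} {sh : ℕ → Option ℕ} {n q : ℕ} {loc : K → ℕ} {τ : Tape P K}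
    {m : Mem K V} (h : Good P U sh n q loc τ m) {κ : K} (hκ : κ ∈ U) (hn : n < P.p) {x₀ : Addr}
    (hx₀ : keyAt m x₀ = some κ) (v w : V) :
    Good P U sh (n + 1) q (touchLoc loc κ) τ
      (Function.update (erased m x₀ (some w)) (Addr.list n) ⟨some (κ, v), true, 0⟩) := by
  have hat : ∀ x, keyAt (Function.update (erased m x₀ (some w)) (Addr.list n)
      ⟨some (κ, v), true, 0⟩) x =
      if x = Addr.list n then some κ else if x = x₀ then none else keyAt m x := fun x => by
    unfold keyAt erased
    by_cases h1 : x = Addr.list n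
    · subst h1
      simp
    · by_cases h2 : x = x₀
      · subst h2
        simp [h1, Cell.empty]
      · simp [h1, h2]
  have hsome : ∀ x κ', keyAt (Function.update (erased m x₀ (some w)) (Addr.list n)
      ⟨some (κ, v), true, 0⟩) x = some κ' →
      (x = Addr.list n ∧ κ' = κ) ∨ (κ' ≠ κ ∧ keyAt m x = some κ') := fun x κ' hx => by
    rw [hat] at hx
    split_ifs at hx with h1 h2
    · exact Or.inl ⟨h1, (Option.some.inj hx).symm⟩
    · refine Or.inr ⟨?_, hx⟩
      rintro rfl
      exact h2 (h.unique _ _ _ hx hx₀)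
  refine ⟨fun x y κ' hx hy => ?_, fun x κ' hx => ?_, fun κ' hκ' => ?_, fun id j b s hid => ?_,
    fun i hi => ?_, h.load.touch κ⟩
  · rcases hsome _ _ hx with ⟨h1, h2⟩ | ⟨h1, h2⟩ <;>
      rcases hsome _ _ hy with ⟨h3, h4⟩ | ⟨h3, h4⟩
    · exact h1.trans h3.symm
    · exact absurd h2 h3
    · exact absurd h4 h1
    · exact h.unique _ _ _ h2 h4
  · rcases hsome _ _ hx with ⟨-, rfl⟩ | ⟨-, h2⟩
    · exact hκ
    · exact h.keys _ _ h2
  · by_cases hk : κ' = κ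
    · subst hk
      refine ⟨Addr.list n, by rw [hat, if_pos rfl], ?_⟩
      rw [touchLoc, Function.update_self]
      exact mem_listSlots.2 ⟨n, hn, rfl⟩
    · obtain ⟨x, hx, hl⟩ := h.located κ' hκ'
      refine ⟨x, ?_, ?_⟩
      · have h1 : x ≠ Addr.list n := fun he => by
          rw [he, h.list_empty n le_rfl] at hx
          cases hx
        have h2 : x ≠ x₀ := fun he => by
          rw [he, hx₀] at hx
          exact hk (Option.some.inj hx).symm
        rw [hat, if_neg h1, if_neg h2, hx]
      · rw [touchLoc, Function.update_of_ne hk]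
        exact hl
  · rw [hat, if_neg (by simp), h.fresh id j b s hid, ite_self]
  · rw [hat, if_neg (by rw [Addr.list.injEq]; omega), h.list_empty i (by omega), ite_self]

/-- The recorded place of the key decides where real searches turn into dummy searches: nonempty
levels up to and including that place use the row of the key on the tape. -/
lemma dom_lookup {U : Finset K} {sh : ℕ → Option ℕ} {t q : ℕ} {loc : K → ℕ} {τ : Tape P K}
    {m : Mem K V} (hsh : ShapeOk P sh q) (h : Good P U sh (t % P.p) q loc τ m) {κ : K} (hκ : κ ∈ U)
    (newVal : Option V) :
    Dom (lookup P t κ newVal (clientState P sh τ)) m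
      (lookupSim P sh t (searchRows τ κ (loc κ)))
      fun _ m' _ => Good P U sh (t % P.p + 1) q (touchLoc loc κ) τ m' := by
  have hp : 0 < P.p := by unfold Params.p; positivity
  obtain ⟨x₀, hx₀, hl⟩ := h.located κ hκ
  have hl0 : x₀ ∈ listSlots P ↔ loc κ = 0 := by
    constructor
    · intro hx
      obtain ⟨i, -, rfl⟩ := mem_listSlots.1 hx
      exact hl.eq_zero
    · intro h0
      rw [h0] at hl
      exact hl
  unfold lookup lookupSim
  refine (out_searchSlots h.unique hx₀ (listSlots P) none).dom.bind ?_
  rintro r m₁ - ⟨rfl, hr⟩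
  rw [hl0] at hr
  have hrange : List.range (P.depth + 1) = (List.finRange (P.depth + 1)).map Fin.val := by simp
  rw [hrange, List.foldlM_map]
  -- The element has been found if and only if its recorded place is the list or a level already
  -- visited.
  refine (Dom.foldlM (I := fun l r m' => m' = erased m x₀ r ∧
    (r.isSome ↔ loc κ = 0 ∨ ∃ i : Fin (P.depth + 1), i ∉ l ∧ loc κ = i + 1)) ?_ ?_).bind ?_
  · refine ⟨rfl, hr.trans ?_⟩
    simp
  · rintro i l r m₂ hsuf ⟨rfl, hr⟩
    have hmem := mem_of_suffix_finRange hsuf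
    have hr' : r.isSome ↔ loc κ ≤ i := by
      rw [hr]
      constructor
      · rintro (h0 | ⟨i', hi', h0⟩)
        · omega
        · rw [List.mem_cons, hmem, not_or, Fin.ext_iff, Fin.lt_def] at hi'
          omega
      · intro hle
        rcases Nat.eq_zero_or_pos (loc κ) with h0 | h0
        · exact Or.inl h0
        · refine Or.inr ⟨⟨loc κ - 1, by omega⟩, ?_, ?_⟩
          · rw [List.mem_cons, hmem, not_or, Fin.ext_iff, Fin.lt_def]
            exact ⟨by simp only; omega, by simp only; omega⟩
          · simp only
            omega
    have hnext : ∀ r' : Option V, (r'.isSome ↔ r.isSome ∨ loc κ = i + 1) →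
        (r'.isSome ↔ loc κ = 0 ∨ ∃ i : Fin (P.depth + 1), i ∉ l ∧ loc κ = i + 1) := by
      intro r' h1
      rw [h1, hr, or_assoc]
      refine or_congr_right ⟨?_, ?_⟩
      · rintro (⟨i', hi', h0⟩ | h0)
        · exact ⟨i', fun hc => hi' (List.mem_cons_of_mem _ hc), h0⟩
        · exact ⟨i, by rw [hmem]; exact lt_irrefl _, h0⟩
      · rintro ⟨i', hi', h0⟩
        by_cases hii : i' = i
        · subst hii
          exact Or.inr h0
        · exact Or.inl ⟨i', by simp [hii, hi'], h0⟩
    unfold levelSearch levelSim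
    rw [clientState_apply]
    cases hi : sh i with
    | none =>
      refine Dom.mono (Out.dom (Q := fun r' m' => r' = r ∧ m' = erased m x₀ r)
        (Out.pure ⟨rfl, rfl, rfl⟩)) ?_
      rintro r' m' - ⟨rfl, rfl⟩
      refine ⟨rfl, hnext _ ?_⟩
      have : loc κ ≠ i + 1 := fun hc => by
        rw [hc] at hl
        obtain ⟨_, id, h1, -⟩ := hl
        rw [hi] at h1
        cases h1
      simp [this]
    | some id =>
      have hrow : searchRows τ κ (loc κ) i = if r.isSome then none else some fun j => τ i j κ := by
        unfold searchRows
        simp only [hr']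
      rw [hrow]
      refine (dom_search h.unique hx₀ id _ _ _ (τ i) r).mono ?_
      rintro r' m' - ⟨rfl, h1⟩
      refine ⟨rfl, hnext _ (h1.trans (or_congr_right ⟨fun hx => ?_, fun h0 => ?_⟩))⟩
      · obtain ⟨j, -, s, -, rfl⟩ := mem_pathSlots.1 hx
        exact hl.eq_level hsh hi
      · rw [h0] at hl
        obtain ⟨_, id', h2, h3⟩ := hl
        rw [hi] at h2
        cases h2
        exact h3
  · rintro r m₂ - ⟨rfl, hr⟩
    have hsome : r.isSome := by
      refine hr.2 ?_
      rcases hlc : loc κ with _ | l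
      · exact Or.inl rfl
      · rw [hlc] at hl
        obtain ⟨hi, -⟩ := hl
        exact Or.inr ⟨⟨l, hi⟩, by simp, rfl⟩
    obtain ⟨w, rfl⟩ := Option.isSome_iff_exists.1 hsome
    refine (Out.dom (Q := fun _ m' => Good P U sh (t % P.p + 1) q (touchLoc loc κ) τ m') ?_)
    refine Out.bind (Out.write (Out.pure ⟨rfl, ?_⟩))
    cases newVal with
    | none => exact h.found hκ (Nat.mod_lt _ hp) hx₀ w w
    | some v => exact h.found hκ (Nat.mod_lt _ hp) hx₀ v w

end Lookup

/-! ### Averages over the hash functions used by an access -/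

section Average

variable {K : Type}

/-- The counterpart of `W_presample` for simulations, with choices whose type depends on the index.
-/
lemma ex_loop_presample {ι : Type} {X : ι → Type} [Fintype ι] [DecidableEq ι]
    [∀ i, Fintype (X i)] [∀ i, Nonempty (X i)] {g : ι → Sim Unit} {gT : ∀ i, X i → Sim Unit}
    (hg : ∀ i F, ex (g i) F = avg fun x => ex (gT i x) F) {l : List ι} (hl : l.Nodup)
    (F : List Access × Unit → ℝ≥0∞) :
    (avg fun xs : ∀ i, X i => ex (Sim.loop l fun i => gT i (xs i)) F) = ex (Sim.loop l g) F := by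
  induction l generalizing F with
  | nil =>
    exact ex_const _ (ex (emit []) F)
  | cons i l ih =>
    rw [List.nodup_cons] at hl
    rw [Sim.loop_cons, Sim.ex_seq, hg, avg_update i]
    congr 1
    funext x
    rw [← funext fun o : List Access × Unit => ih hl.2 fun o' => F (o.1 ++ o'.1, o'.2)]
    unfold avg
    rw [ex_comm]
    congr 1
    funext xs
    rw [Sim.loop_cons, Sim.ex_seq, Function.update_self]
    have : (Sim.loop l fun i' => gT i' (Function.update xs i x i')) =
        Sim.loop l fun i' => gT i' (xs i') := by
      unfold Sim.loop
      refine List.foldr_ext _ _ _ fun i' hi' r => ?_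
      have hne : i' ≠ i := fun h => hl.1 (by rwa [h] at hi')
      simp only [Function.update_of_ne hne]
    rw [this]

variable {P : Params}

lemma ex_levelSim (sh : ℕ → Option ℕ) (i : Fin (P.depth + 1)) (l : ℕ)
    (F : List Access × Unit → ℝ≥0∞) :
    ex (levelSim P sh i none) F =
      avg fun x => ex (levelSim P sh i (if l ≤ i then none else some x)) F := by
  split_ifs
  · exact (ex_const _ _).symm
  · unfold levelSim
    split
    · exact (ex_const _ _).symm
    · unfold searchSim
      simp only [Sim.ex_seq, Sim.ex_sample, ex_emit, Option.getD_none, Option.getD_some]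
      congr 1
      funext x
      exact (ex_const _ _).symm

variable [DecidableEq K]

/-- Change the hash values of one key in all levels. -/
def setColumn (κ : K) (τ : Tape P K) (x : (i : Fin (P.depth + 1)) → Fin (P.k i) →
    Fin (2 ^ (P.logp + i))) : Tape P K := fun i j => Function.update (τ i j) κ (x i j)

/-- The heart of the simulation of lookups. As the future does not depend on the hash values of `κ`,
these can be resampled, and they serve only to choose the searched paths. The paths become uniform
and independent of the rest of the tape. -/
lemma avg_lookup [Fintype K] (sh : ℕ → Option ℕ) (t : ℕ) (κ : K) (l : ℕ)
    (Φ : List Access → Tape P K → ℝ≥0∞) (hΦ : ∀ tr τ x, Φ tr (setColumn κ τ x) = Φ tr τ) :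
    (avg fun τ => ex (lookupSim P sh t (searchRows τ κ l)) fun o => Φ o.1 τ) =
      ex (lookupSim P sh t fun _ => none) fun o => avg (Φ o.1) := by
  rw [avg_lens (fun (τ : Tape P K) i j => τ i j κ) (setColumn κ)
    (fun τ x => by funext i j; simp [setColumn]) (fun τ => by funext i j; simp [setColumn])
    (fun τ x x' => by funext i j; simp [setColumn])]
  have hrows : ∀ (τ : Tape P K) x, searchRows (setColumn κ τ x) κ l =
      fun i : Fin (P.depth + 1) => if l ≤ i then none else some (x i) := fun τ x => by
    funext i
    simp [searchRows, setColumn]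
  simp only [hrows, hΦ]
  have hswap : ∀ x : (i : Fin (P.depth + 1)) → Fin (P.k i) → Fin (2 ^ (P.logp + i)),
      (avg fun τ : Tape P K => ex (lookupSim P sh t fun i => if l ≤ i then none else some (x i))
        fun o => Φ o.1 τ) =
      ex (lookupSim P sh t fun i => if l ≤ i then none else some (x i)) fun o => avg (Φ o.1) :=
    fun x => ex_comm _ _ _
  simp only [hswap]
  unfold lookupSim
  simp only [Sim.ex_seq, ex_emit]
  exact ex_loop_presample (gT := fun i x => levelSim P sh i (if l ≤ i then none else some x))
    (fun i F => ex_levelSim sh i l F) (List.nodup_finRange _) _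

end Average

/-! ### Rebuilding a level -/

section Rebuild

variable {K V : Type} (P : Params)

/-- The cells of a level. -/
def levelSlots (sh : ℕ → Option ℕ) (i : ℕ) : List Addr :=
  match sh i with
  | none => []
  | some id => zhtSlots id (P.k i) (P.logp + i) (P.c i)

/-- The cells that are emptied when level `v` is rebuilt. -/
def rebuildSlots (sh : ℕ → Option ℕ) (v : ℕ) : List Addr :=
  listSlots P ++ (List.range (v + 1)).flatMap (levelSlots P sh)

/-- The simulation of the `m`-th rebuild. -/
def rebuildSim (sh : ℕ → Option ℕ) (m : ℕ) : Sim Unit :=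
  buildSim (P.net (rebuildLevel P m)) m (P.logp + rebuildLevel P m) (P.k (rebuildLevel P m))
    (P.c (rebuildLevel P m)) (rebuildSlots P sh (rebuildLevel P m))

variable {P}

lemma mem_zhtSlots {id k d c : ℕ} {x : Addr} : x ∈ zhtSlots id k d c ↔ x ∈ zhtSet id k d c := by
  unfold zhtSlots zhtSet
  simp only [List.mem_flatMap, List.mem_range, mem_tableSlots]
  rfl

lemma mem_rebuildSlots {sh : ℕ → Option ℕ} {v : ℕ} {x : Addr} :
    x ∈ rebuildSlots P sh v ↔ x ∈ listSlots P ∨ ∃ i ≤ v, ∃ id, sh i = some id ∧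
      x ∈ zhtSet id (P.k i) (P.logp + i) (P.c i) := by
  unfold rebuildSlots
  rw [List.mem_append, List.mem_flatMap]
  refine or_congr_right (exists_congr fun i => ?_)
  rw [List.mem_range, Nat.lt_succ_iff]
  refine and_congr_right fun _ => ?_
  unfold levelSlots
  cases sh i <;> simp [mem_zhtSlots]

lemma Located.mem_rebuildSlots {sh : ℕ → Option ℕ} {q : ℕ} (hsh : ShapeOk P sh q) {τ : Tape P K}
    {κ : K} {l v : ℕ} {x : Addr} (h : Located P sh τ κ l x) :
    x ∈ rebuildSlots P sh v ↔ l ≤ v + 1 := by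
  rw [PyramidORAM.mem_rebuildSlots]
  constructor
  · rintro (hx | ⟨i, hi, id, hid, j, -, b, -, s, -, rfl⟩)
    · obtain ⟨i, -, rfl⟩ := mem_listSlots.1 hx
      rw [h.eq_zero]
      exact Nat.zero_le _
    · rw [h.eq_level hsh hid]
      omega
  · intro hl
    cases l with
    | zero => exact Or.inl h
    | succ i =>
      obtain ⟨_, id, h1, h2⟩ := h
      exact Or.inr ⟨i, by omega, id, h1, targetSet_subset _ (pathSlots_subset h2)⟩

lemma notMem_zhtSet_of_mem_rebuildSlots {sh : ℕ → Option ℕ} {q : ℕ} (hsh : ShapeOk P sh q)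
    {v id k d c : ℕ} (hid : q < id) {x : Addr} (hx : x ∈ rebuildSlots P sh v) :
    x ∉ zhtSet id k d c := by
  rintro ⟨j, -, b, -, s, -, rfl⟩
  rcases mem_rebuildSlots.1 hx with hx | ⟨i, -, id', hi, j', -, b', -, s', -, he⟩
  · obtain ⟨i, -, he⟩ := mem_listSlots.1 hx
    cases he
  · simp only [Addr.table.injEq] at he
    have := hsh.le hi
    omega

lemma Good.zht_empty {U : Finset K} {sh : ℕ → Option ℕ} {n q : ℕ} {loc : K → ℕ} {τ : Tape P K}
    {m : Mem K V} (h : Good P U sh n q loc τ m) {id k d c : ℕ} (hid : q < id) :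
    ∀ x ∈ zhtSet id k d c, (m x).elem = none := by
  rintro x ⟨j, -, b, -, s, -, rfl⟩
  exact keyAt_eq_none.1 (h.fresh id j b s hid)

/-- Keys at places up to `v + 1` are swept into the new table, where `placed` puts them on their
paths. The other keys keep their cells, and their levels keep identifiers and hash functions. -/
lemma Good.rebuild {U : Finset K} (hU : U.card ≤ P.N) {sh : ℕ → Option ℕ} {n q : ℕ} {loc : K → ℕ}
    {τ : Tape P K} {m m' : Mem K V} (hsh : ShapeOk P sh q) (h : Good P U sh n q loc τ m)
    (hn : n ≤ P.p) {v : Fin (P.depth + 1)} (hv : (v : ℕ) = rebuildLevel P (q + 1))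
    {f : Fin (P.k v) → K → Fin (2 ^ (P.logp + v))}
    (hb : BuildPost (q + 1) (P.logp + v) (P.k v) (P.c v) (rebuildSlots P sh v) m f m') :
    Good P U (reshape v (q + 1) sh) 0 (q + 1) (rebuildLoc v loc) (Function.update τ v f) m' := by
  have hkeep : ∀ x, x ∉ rebuildSlots P sh v →
      x ∉ zhtSet (q + 1) (P.k v) (P.logp + v) (P.c v) → keyAt m' x = keyAt m x := fun x h1 h2 =>
    hb.moved.keyAt_of_notMem fun hx => hx.elim h1 h2
  refine ⟨hb.moved.uniqueKeys h.unique, fun x κ hx => ?_, fun κ hκ => ?_, fun id j b s hid => ?_,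
    fun i _ => ?_, by rw [hv]; exact h.load.rebuild hn hU⟩
  · obtain ⟨π, -, hπ⟩ := hb.moved
    rw [hπ] at hx
    exact h.keys _ _ hx
  · obtain ⟨x, hx, hl⟩ := h.located κ hκ
    have hmem := hl.mem_rebuildSlots (v := v) hsh
    unfold rebuildLoc
    split_ifs with hle
    · obtain ⟨x', hx', hk⟩ := hb.moved.exists_mem (Or.inl (hmem.2 hle))
      rw [hx] at hk
      refine ⟨x', hk, v.2, q + 1, reshape_self _ _ _, ?_⟩
      rcases hx' with hx' | ⟨j, hj, b, hb', s, hs, rfl⟩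
      · rw [keyAt_eq_none.2 (hb.src_empty x' hx')] at hk
        cases hk
      · have := hb.placed ⟨j, hj⟩ b hb' s hs κ hk
        subst this
        refine mem_pathSlots.2 ⟨⟨j, hj⟩, List.mem_finRange _, s, hs, ?_⟩
        simp
    · refine ⟨x, ?_, ?_⟩
      · rw [hkeep x (fun hc => hle (hmem.1 hc)) fun hc => ?_, hx]
        rw [keyAt_eq_none.2 (h.zht_empty (Nat.lt_succ_self q) x hc)] at hx
        cases hx
      · rcases hlc : loc κ with _ | i
        · omega
        · rw [hlc] at hl hle
          obtain ⟨hi, id, h1, h2⟩ := hl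
          refine ⟨hi, id, by rw [reshape_of_lt (by omega), h1], ?_⟩
          have hne : (⟨i, hi⟩ : Fin (P.depth + 1)) ≠ v := fun hc => by
            rw [← hc] at hle
            exact hle (by simp only; omega)
          simp only [Function.update_of_ne hne]
          exact h2
  · rw [hkeep, h.fresh id j b s (by omega)]
    · intro hc
      rcases mem_rebuildSlots.1 hc with hx | ⟨i, -, id', hi, j', -, b', -, s', -, he⟩
      · obtain ⟨i, -, he⟩ := mem_listSlots.1 hx
        cases he
      · simp only [Addr.table.injEq] at he
        have := hsh.le hi
        omega
    · rintro ⟨j', -, b', -, s', -, he⟩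
      simp only [Addr.table.injEq] at he
      omega
  · by_cases hi : Addr.list i ∈ rebuildSlots P sh v
    · exact keyAt_eq_none.2 (hb.src_empty _ hi)
    · rw [hkeep _ hi, h.list_empty]
      · by_contra hc
        exact hi (mem_rebuildSlots.2 (Or.inl (mem_listSlots.2 ⟨i, by omega, rfl⟩)))
      · rintro ⟨j', -, b', -, s', -, he⟩
        cases he

variable [Fintype K] [DecidableEq K]

lemma rebuild_eq (sh : ℕ → Option ℕ) (τ : Tape P K) (m : ℕ) {v : Fin (P.depth + 1)}
    (hv : (v : ℕ) = rebuildLevel P m) :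
    (rebuild P m (clientState P sh τ) : Prog K V _) = (do
      let f ← build (P.net v) m (P.logp + v) (P.k v) (P.c v) (rebuildSlots P sh v)
      pure (clientState P (reshape v m sh) (Function.update τ v f))) := by
  have hsrc : ((List.range (v + 1)).flatMap fun i =>
      match clientState P sh τ i with
      | none => []
      | some (id, _) => zhtSlots id (P.k i) (P.logp + i) (P.c i)) =
      (List.range (v + 1)).flatMap (levelSlots P sh) := by
    refine List.flatMap_congr fun i hi => ?_
    have hi' : i < P.depth + 1 := by
      have := List.mem_range.1 hi
      omega
    lift i to Fin (P.depth + 1) using hi'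
    rw [clientState_apply, levelSlots]
    cases sh i <;> rfl
  simp only [← clientState_reshape, rebuildSlots, ← hsrc]
  obtain ⟨v, hv'⟩ := v
  simp only at hv
  subst hv
  rfl

lemma W_rebuild_le {U : Finset K} (hU : U.card ≤ P.N) {sh : ℕ → Option ℕ} {n q : ℕ}
    {loc : K → ℕ} {τ : Tape P K} {m : Mem K V} (hsh : ShapeOk P sh q)
    (h : Good P U sh n q loc τ m) (hn : n ≤ P.p) {v : Fin (P.depth + 1)}
    (hv : (v : ℕ) = rebuildLevel P (q + 1)) (F : List Access → ClientState P K → Mem K V → ℝ≥0∞)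
    (G : List Access → Tape P K → ℝ≥0∞)
    (hFG : ∀ tr τ m', Good P U (reshape v (q + 1) sh) 0 (q + 1) (rebuildLoc v loc) τ m' →
      F tr (clientState P (reshape v (q + 1) sh) τ) m' ≤ G tr τ) :
    W (rebuild P (q + 1) (clientState P sh τ) m) 0 F ≤
      avg fun f => ex (rebuildSim P sh (q + 1)) fun o => G o.1 (Function.update τ v f) := by
  rw [rebuild_eq sh τ (q + 1) hv, W_bind, rebuildSim, ← hv]
  refine dom_build (P.net_sorts v (Nat.lt_succ_iff.1 v.2))
    (fun x hx => notMem_zhtSet_of_mem_rebuildSlots hsh (Nat.lt_succ_self q) hx) h.unique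
    (h.zht_empty (Nat.lt_succ_self q)) _ (fun tr f => G tr (Function.update τ v f)) ?_
  intro tr f m' hb
  rw [W_pure, List.append_nil]
  exact hFG _ _ _ (h.rebuild hU hsh hn hv hb)

lemma failProb_rebuild_le {U : Finset K} (hU : U.card ≤ P.N) {sh : ℕ → Option ℕ} {n q s : ℕ}
    {loc : K → ℕ} {τ : Tape P K} {m : Mem K V} (hsh : ShapeOk P sh q)
    (h : Good P U sh n q loc τ m) (hn : n ≤ P.p)
    (hP : ∀ i, i ≤ P.depth → 12 * (s + 1) * (Nat.log 2 (P.logp + i) + 1) ≤ P.k i ∧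
      12 * (s + 1) * (Nat.log 2 (P.logp + i) + 1) ≤ P.c i) :
    failProb (rebuild P (q + 1) (clientState P sh τ) m) ≤ 2⁻¹ ^ s := by
  let v : Fin (P.depth + 1) := ⟨rebuildLevel P (q + 1), rebuildLevel_lt P _⟩
  have hv : (v : ℕ) ≤ P.depth := Nat.lt_succ_iff.1 v.2
  rw [rebuild_eq sh τ (q + 1) (v := v) rfl, failProb_bind]
  have h0 : ∀ (st : ClientState P K) (m' : Mem K V),
      failProb ((pure st : Prog K V (ClientState P K)) m') = 0 := fun st m' => W_pure _ _ _ _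
  simp only [h0]
  rw [show (W (build (P.net v) (q + 1) (P.logp + v) (P.k v) (P.c v) (rebuildSlots P sh v) m) 0
    fun _ _ _ => 0) = 0 from ?_, add_zero]
  -- Only keys at places up to `v + 1` can be stored in the emptied cells, and by the counter bound
  -- these fit into the new table.
  · refine failProb_build_small (P.net_sorts v hv)
      (fun x hx => notMem_zhtSet_of_mem_rebuildSlots hsh (Nat.lt_succ_self q) hx) h.unique
      (h.zht_empty (Nat.lt_succ_self q)) (U := U.filter fun κ => loc κ ≤ v + 1) ?_
      (h.load.card_le hn hU) (hP v hv).1 (hP v hv).2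
    intro x hx κ hκ
    have hκU := h.keys x κ hκ
    obtain ⟨x', hx', hl⟩ := h.located κ hκU
    obtain rfl := h.unique _ _ _ hκ hx'
    exact Finset.mem_filter.2 ⟨hκU, (hl.mem_rebuildSlots hsh).1 hx⟩
  · refine le_antisymm ((ex_mono (g := fun _ => 0) fun o => ?_).trans (ex_const _ _).le) zero_le
    rcases o with ⟨tr, _ | ⟨x, m'⟩⟩ <;> exact le_rfl

end Rebuild

/-! ### The simulator -/

section Simulator

variable (P : Params)

/-- The simulation of the setup. -/
def setupSim : Sim Unit :=
  buildSim (P.net P.depth) 0 (P.logp + P.depth) (P.k P.depth) (P.c P.depth)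
    ((List.range P.N).map Addr.input)

/-- The simulation of access number `t`. -/
def accessSim (t : ℕ) : Sim Unit :=
  (lookupSim P (shape P t) t fun _ => none).seq fun _ =>
    if (t + 1) % P.p = 0 then rebuildSim P (shape P t) (t / P.p + 1) else emit []

/-- The simulator. -/
def simulator : Simulator := fun P n =>
  match n with
  | 0 => (setupSim P).map Prod.fst
  | t + 1 => (accessSim P t).map Prod.fst

end Simulator

/-! ### The real execution and the simulation -/

section Coupling

variable {K V : Type} {P : Params}

/-- The level of the rebuild after access number `t`. -/
def nextLevel (P : Params) (t : ℕ) : Fin (P.depth + 1) :=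
  ⟨rebuildLevel P (t / P.p + 1), rebuildLevel_lt P _⟩

/-- The function `g` depends only on the hash values that the adversary has not seen. -/
def Blind (sh : ℕ → Option ℕ) (loc : K → ℕ) (g : Tape P K → ℝ≥0∞) : Prop :=
  ∀ τ τ' : Tape P K, (∀ (i : Fin (P.depth + 1)) κ, sh i ≠ none → i + 1 ≤ loc κ →
    ∀ j, τ i j κ = τ' i j κ) → g τ = g τ'

/-- The state after `t` accesses is as predicted. -/
abbrev GoodAt (U : Finset K) (t : ℕ) (loc : K → ℕ) (τ : Tape P K) (m : Mem K V) : Prop :=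
  Good P U (shape P t) (t % P.p) (t / P.p) loc τ m

lemma succ_mod_of_ne {t n : ℕ} (h : (t + 1) % n ≠ 0) : (t + 1) % n = t % n + 1 := by
  rcases Nat.eq_zero_or_pos n with rfl | hn
  · simp
  · rw [Nat.add_mod] at h ⊢
    have h1 := Nat.mod_lt t hn
    rcases Nat.lt_or_ge (t % n + 1 % n) n with h2 | h2
    · rw [Nat.mod_eq_of_lt h2] at h ⊢
      rcases Nat.lt_or_ge 1 n with h3 | h3
      · rw [Nat.mod_eq_of_lt h3]
      · interval_cases n
        omega
    · rcases Nat.lt_or_ge 1 n with h3 | h3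
      · rw [Nat.mod_eq_of_lt h3] at h h2
        have : t % n + 1 = n := by omega
        rw [this, Nat.mod_self] at h
        exact absurd rfl h
      · interval_cases n
        omega

lemma GoodAt.succ_of_ne {U : Finset K} {t : ℕ} (ht : (t + 1) % P.p ≠ 0) {loc : K → ℕ}
    {τ : Tape P K} {m : Mem K V} (h : Good P U (shape P t) (t % P.p + 1) (t / P.p) loc τ m) :
    GoodAt U (t + 1) loc τ m := by
  unfold GoodAt
  rw [shape, if_neg ht, succ_mod_of_ne ht,
    Nat.succ_div_of_not_dvd fun hd => ht (Nat.mod_eq_zero_of_dvd hd)]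
  exact h

lemma succ_div_of_mod {t n : ℕ} (ht : (t + 1) % n = 0) : (t + 1) / n = t / n + 1 :=
  Nat.succ_div_of_dvd (Nat.dvd_of_mod_eq_zero ht)

lemma mod_lt_p (t : ℕ) : t % P.p < P.p := Nat.mod_lt _ (by unfold Params.p; positivity)

variable [DecidableEq K]

/-- The effect on `loc` of access number `t`, to the key `κ`. -/
def nextLoc (P : Params) (t : ℕ) (loc : K → ℕ) (κ : K) : K → ℕ :=
  if (t + 1) % P.p = 0 then rebuildLoc (rebuildLevel P (t / P.p + 1)) (touchLoc loc κ)
  else touchLoc loc κ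

/-- The expected value of `G` after a possible rebuild. -/
def afterRebuild [Fintype K] (P : Params) (t : ℕ) (G : List Access → Tape P K → ℝ≥0∞)
    (tr : List Access) (τ : Tape P K) : ℝ≥0∞ :=
  if (t + 1) % P.p = 0 then
    avg fun f => ex (rebuildSim P (shape P t) (t / P.p + 1)) fun o =>
      G (tr ++ o.1) (Function.update τ (nextLevel P t) f)
  else G tr τ

variable [Fintype K]

lemma avg_ex_comm {α β : Type} [Fintype α] [Nonempty α] (ν : PMF β) (f : α → β → ℝ≥0∞) :
    (avg fun a => ex ν (f a)) = ex ν fun b => avg fun a => f a b := ex_comm _ _ _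

/-- The old functions of the rebuilt level are averaged out and new uniform ones take their place,
so the tape is again uniform. -/
lemma avg_afterRebuild (t : ℕ) (G : List Access → Tape P K → ℝ≥0∞) :
    (ex (lookupSim P (shape P t) t fun _ => none) fun o => avg (afterRebuild P t G o.1)) =
      ex (accessSim P t) fun o => avg (G o.1) := by
  unfold accessSim
  rw [Sim.ex_seq]
  congr 1
  funext o
  unfold afterRebuild
  split_ifs with h
  · simp only [avg_update (X := fun i : Fin (P.depth + 1) => Fin (P.k i) → K →
      Fin (2 ^ (P.logp + i))) (nextLevel P t) (G _)]
    simp only [avg_ex_comm]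
    congr 1
    funext o'
    exact ex_comm _ _ _
  · rw [ex_emit, List.append_nil]

/-- What the future may consult after a rebuild of level `v` is either one of the new functions, or
it concerns a level beyond `v` and a key stored there or deeper, whose place has not changed. The
levels before `v` are empty. -/
lemma Blind.afterRebuild {t : ℕ} {loc : K → ℕ} {κ : K} {G : List Access → Tape P K → ℝ≥0∞}
    (hG : ∀ tr, Blind (shape P (t + 1)) (nextLoc P t loc κ) (G tr)) (tr : List Access) :
    Blind (shape P t) (touchLoc loc κ) (afterRebuild P t G tr) := by
  intro τ τ' h
  unfold PyramidORAM.afterRebuild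
  split_ifs with ht
  · congr 1
    funext f
    congr 1
    funext o
    refine hG _ _ _ fun i κ' hi hle j => ?_
    by_cases hiv : i = nextLevel P t
    · subst hiv
      simp only [Function.update_self]
    · simp only [Function.update_of_ne hiv]
      have hne : (i : ℕ) ≠ rebuildLevel P (t / P.p + 1) := fun hc => hiv (Fin.ext hc)
      rw [shape_succ_of_mod ht] at hi
      rw [nextLoc, if_pos ht, rebuildLoc] at hle
      obtain ⟨id, hid⟩ := Option.ne_none_iff_exists'.1 hi
      rcases reshape_eq_some hid with ⟨h1, -⟩ | ⟨h1, h2⟩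
      · exact absurd h1 hne
      · refine h i κ' (by rw [h2]; simp) ?_ j
        split_ifs at hle <;> omega
  · refine hG _ _ _ fun i κ' hi hle j => h i κ' ?_ ?_ j
    · rwa [shape, if_neg ht] at hi
    · rwa [nextLoc, if_neg ht] at hle

lemma W_access_le {U : Finset K} (hU : U.card ≤ P.N) {t : ℕ} {loc : K → ℕ} {τ : Tape P K}
    {m : Mem K V} (h : GoodAt U t loc τ m) {κ : K} (hκ : κ ∈ U) (newVal : Option V)
    (F : List Access → Option V × ClientState P K → Mem K V → ℝ≥0∞)
    (G : List Access → Tape P K → ℝ≥0∞)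
    (hFG : ∀ tr r τ m', GoodAt U (t + 1) (nextLoc P t loc κ) τ m' →
      F tr (r, clientState P (shape P (t + 1)) τ) m' ≤ G tr τ) :
    W (access P t κ newVal (clientState P (shape P t) τ) m) 0 F ≤
      ex (lookupSim P (shape P t) t (searchRows τ κ (loc κ))) fun o =>
        afterRebuild P t G o.1 τ := by
  have hsh := shapeOk_shape (P := P) t
  rw [W_access]
  refine dom_lookup hsh h hκ newVal _ (fun tr _ => afterRebuild P t G tr τ) ?_
  intro tr r m' _ hm'
  unfold afterRebuild
  by_cases ht : (t + 1) % P.p = 0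
  · rw [if_pos ht, if_pos ht, succ_div_of_mod ht]
    refine W_rebuild_le hU hsh hm' (mod_lt_p t) (v := nextLevel P t) rfl _
      (fun tr' τ => G (tr ++ tr') τ) fun tr' τ' m'' hg => ?_
    have hshape := shape_succ_of_mod ht
    change _ = reshape (nextLevel P t : ℕ) _ _ at hshape
    rw [← hshape] at hg ⊢
    refine hFG _ _ _ _ ?_
    unfold GoodAt
    rw [nextLoc, if_pos ht, ht, succ_div_of_mod ht]
    exact hg
  · rw [if_neg ht, if_neg ht]
    have hshape : shape P (t + 1) = shape P t := by rw [shape, if_neg ht]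
    rw [← hshape]
    refine hFG _ _ _ _ ?_
    rw [nextLoc, if_neg ht]
    exact GoodAt.succ_of_ne ht hm'

/-- A lookup cannot fail. `dom_lookup` is used with a constant test function, only to know that the
rebuild starts in a good state. -/
lemma failProb_access_le {U : Finset K} (hU : U.card ≤ P.N) {t s : ℕ} {loc : K → ℕ}
    {τ : Tape P K} {m : Mem K V} (h : GoodAt U t loc τ m) {κ : K} (hκ : κ ∈ U)
    (newVal : Option V)
    (hP : ∀ i, i ≤ P.depth → 12 * (s + 1) * (Nat.log 2 (P.logp + i) + 1) ≤ P.k i ∧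
      12 * (s + 1) * (Nat.log 2 (P.logp + i) + 1) ≤ P.c i) :
    failProb (access P t κ newVal (clientState P (shape P t) τ) m) ≤
      if (t + 1) % P.p = 0 then 2⁻¹ ^ s else 0 := by
  have hsh := shapeOk_shape (P := P) t
  rw [failProb, W_access, W_one_eq, (out_lookup_true _ _ _ _ _).failProb, zero_add]
  refine (dom_lookup hsh h hκ newVal _ (fun _ _ => if (t + 1) % P.p = 0 then 2⁻¹ ^ s else 0)
    ?_).trans (ex_const _ _).le
  intro tr r m' _ hm'
  split_ifs with ht
  · rw [succ_div_of_mod ht]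
    exact failProb_rebuild_le hU hsh hm' (mod_lt_p t) hP
  · exact le_rfl

end Coupling

/-! ### The whole experiment: domination, abort probability and statistical distance -/

section Experiment

variable {K V : Type} {P : Params}

lemma W_zero {α : Type} (μ : PMF (List Access × Option (α × Mem K V))) :
    (W μ 0 fun _ _ _ => 0) = 0 := by
  refine Eq.trans ?_ (ex_const μ 0)
  unfold W
  congr 1
  funext o
  rcases o with ⟨tr, _ | ⟨x, m'⟩⟩ <;> rfl

lemma failProb_ne_top {α : Type} (μ : PMF (List Access × Option (α × Mem K V))) :
    failProb μ ≠ ∞ := by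
  refine (lt_of_le_of_lt ((ex_mono (g := fun _ => 1) fun o => ?_).trans (ex_const μ 1).le)
    ENNReal.one_lt_top).ne
  rcases o with ⟨tr, _ | ⟨x, m'⟩⟩
  · exact le_rfl
  · exact zero_le

lemma toOuterMeasure_eq_ex {α : Type} (μ : PMF α) (E : Set α) :
    μ.toOuterMeasure E = ex μ (E.indicator 1) := by
  rw [PMF.toOuterMeasure_apply]
  refine tsum_congr fun a => ?_
  by_cases ha : a ∈ E <;> simp [ha]

lemma ex_indicator_add_compl {α : Type} (μ : PMF α) (E : Set α) :
    ex μ (E.indicator 1) + ex μ (Eᶜ.indicator 1) = 1 := by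
  rw [← ex_add, ← ex_const μ 1]
  congr 1
  funext a
  by_cases ha : a ∈ E <;> simp [ha]

lemma keyAt_initMem {N : ℕ} (A : Adversary N K V) {x : Addr} {κ : K} :
    keyAt (initMem A) x = some κ ↔ ∃ i : Fin N, x = Addr.input i ∧ (A.elems i).1 = κ := by
  cases x with
  | input i =>
    by_cases hi : i < N
    · have h1 : keyAt (initMem A) (Addr.input i) = some (A.elems ⟨i, hi⟩).1 := by
        simp [keyAt, initMem, hi]
      rw [h1, Option.some.injEq]
      constructor
      · exact fun h => ⟨⟨i, hi⟩, rfl, h⟩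
      · rintro ⟨i', he, h⟩
        rw [Addr.input.injEq] at he
        subst he
        exact h
    · have h1 : keyAt (initMem A) (Addr.input i) = none := by
        simp [keyAt, initMem, hi, Cell.empty]
      rw [h1]
      refine ⟨fun h => by simp at h, ?_⟩
      rintro ⟨i', he, -⟩
      rw [Addr.input.injEq] at he
      exact absurd i'.2 (he ▸ hi)
  | list i => simp [keyAt, initMem, Cell.empty]
  | table id j b s => simp [keyAt, initMem, Cell.empty]

lemma uniqueKeys_initMem {N : ℕ} (A : Adversary N K V) : UniqueKeys (initMem A) := by
  intro x y κ hx hy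
  obtain ⟨i, rfl, hi⟩ := (keyAt_initMem A).1 hx
  obtain ⟨i', rfl, hi'⟩ := (keyAt_initMem A).1 hy
  rw [A.distinct (hi.trans hi'.symm)]

lemma setup_disjoint {N id k d c : ℕ} :
    ∀ x ∈ (List.range N).map Addr.input, x ∉ zhtSet id k d c := by
  rintro x hx ⟨j, -, b, -, s, -, rfl⟩
  simp at hx

lemma initMem_zht_empty {N : ℕ} (A : Adversary N K V) {id k d c : ℕ} :
    ∀ x ∈ zhtSet id k d c, (initMem A x).elem = none := by
  rintro x ⟨j, -, b, -, s, -, rfl⟩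
  rfl

lemma clientState_shape_zero (τ : Tape P K) :
    clientState P (shape P 0) τ =
      Function.update (fun _ => none : ClientState P K) P.depth
        (some (0, (τ (Fin.last P.depth) : Fin (P.k P.depth) → K → _))) := by
  funext i
  by_cases hi : i = P.depth
  · subst hi
    rw [Function.update_self]
    refine (clientState_apply _ τ (Fin.last P.depth)).trans ?_
    simp [shape]
  · rw [Function.update_of_ne hi, clientState, shape, Function.update_of_ne hi]
    split_ifs <;> rfl

variable [DecidableEq K]

/-- The keys stored in the ORAM. -/
def Adversary.keys {N : ℕ} (A : Adversary N K V) : Finset K :=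
  Finset.univ.image fun i => (A.elems i).1

lemma Adversary.card_keys_le {N : ℕ} (A : Adversary N K V) : A.keys.card ≤ N :=
  Finset.card_image_le.trans (by simp)

lemma Adversary.request_mem_keys {N : ℕ} (A : Adversary N K V) (tr : List Access) :
    (A.request tr).1 ∈ A.keys := by
  obtain ⟨i, hi⟩ := A.request_mem tr
  exact Finset.mem_image.2 ⟨i, Finset.mem_univ i, hi⟩

/-- The simulated execution, together with the place of each key in the real execution. -/
def ghost (A : Adversary P.N K V) : ℕ → PMF (List Access × (K → ℕ))
  | 0 => (setupSim P).map fun o => (o.1, fun _ => P.depth + 1)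
  | T + 1 => (ghost A T).bind fun o => (accessSim P T).map fun o' =>
      (o.1 ++ o'.1, nextLoc P T o.2 (A.request o.1).1)

/-- The places depend on the requests and thus on the trace, but never influence it; they exist only
for the proof and can be forgotten. -/
lemma ghost_map_fst (A : Adversary P.N K V) (T : ℕ) :
    (ghost A T).map Prod.fst = simTrace simulator P T := by
  induction T with
  | zero =>
    rw [ghost, PMF.map_comp]
    rfl
  | succ T ih =>
    rw [ghost, simTrace, ← ih, PMF.map_bind, PMF.bind_map]
    congr 1
    funext o
    rw [PMF.map_comp]
    change _ = PMF.map _ (PMF.map _ _)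
    rw [PMF.map_comp]
    rfl

lemma goodAt_setup (A : Adversary P.N K V) {τ : Tape P K} {m : Mem K V}
    (hb : BuildPost 0 (P.logp + P.depth) (P.k P.depth) (P.c P.depth)
      ((List.range P.N).map Addr.input) (initMem A) (τ (Fin.last P.depth)) m) :
    GoodAt A.keys 0 (fun _ => P.depth + 1) τ m := by
  have hkeep : ∀ x, x ∉ (List.range P.N).map Addr.input →
      x ∉ zhtSet 0 (P.k P.depth) (P.logp + P.depth) (P.c P.depth) →
      keyAt m x = keyAt (initMem A) x := fun x h1 h2 =>
    hb.moved.keyAt_of_notMem fun hx => hx.elim h1 h2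
  unfold GoodAt
  rw [Nat.zero_mod, Nat.zero_div]
  refine ⟨hb.moved.uniqueKeys (uniqueKeys_initMem A), fun x κ hx => ?_, fun κ hκ => ?_,
    fun id j b s hid => ?_, fun i _ => ?_, ?_, fun i hi => ?_⟩
  · obtain ⟨π, -, hπ⟩ := hb.moved
    rw [hπ] at hx
    obtain ⟨i, -, hi⟩ := (keyAt_initMem A).1 hx
    exact Finset.mem_image.2 ⟨i, Finset.mem_univ i, hi⟩
  · obtain ⟨i, -, hi⟩ := Finset.mem_image.1 hκ
    have hx : Addr.input i ∈ (List.range P.N).map Addr.input :=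
      List.mem_map_of_mem (List.mem_range.2 i.2)
    obtain ⟨x', hx', hk⟩ := hb.moved.exists_mem (Or.inl hx)
    rw [(keyAt_initMem A).2 ⟨i, rfl, hi⟩] at hk
    refine ⟨x', hk, Nat.lt_succ_self _, 0, by simp [shape], ?_⟩
    rcases hx' with hx' | ⟨j, hj, b, hb', s, hs, rfl⟩
    · rw [keyAt_eq_none.2 (hb.src_empty x' hx')] at hk
      cases hk
    · have := hb.placed ⟨j, hj⟩ b hb' s hs κ hk
      subst this
      exact mem_pathSlots.2 ⟨⟨j, hj⟩, List.mem_finRange _, s, hs, rfl⟩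
  · rw [hkeep]
    · rfl
    · simp
    · rintro ⟨j', -, b', -, s', -, he⟩
      simp only [Addr.table.injEq] at he
      omega
  · rw [hkeep]
    · rfl
    · simp
    · rintro ⟨j', -, b', -, s', -, he⟩
      cases he
  · rw [Finset.filter_eq_empty_iff.2, Finset.card_empty]
    exact fun κ _ => Nat.succ_ne_zero _
  · rw [Finset.filter_eq_empty_iff.2, Finset.card_empty]
    · exact Nat.zero_le _
    · exact fun κ _ hc => hi.ne (Nat.succ_injective hc).symm

variable [Fintype K]

lemma W_experiment_succ (A : Adversary P.N K V) (T : ℕ) (z : ℝ≥0∞)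
    (F : List Access → ClientState P K → Mem K V → ℝ≥0∞) :
    W (experiment P A (T + 1)) z F = W (experiment P A T) z fun tr st m =>
      W (access P T (A.request tr).1 (A.request tr).2 st m) z fun tr' x =>
        F (tr ++ tr') x.2 := by
  rw [experiment]
  unfold W
  rw [ex_bind]
  congr 1
  funext o
  rcases o with ⟨tr, _ | ⟨st, m⟩⟩
  · exact ex_pure _ _
  · simp only [ex_map]
    congr 1
    funext o'
    rcases o' with ⟨tr', _ | ⟨x, m'⟩⟩ <;> rfl

lemma W_setup_le (A : Adversary P.N K V)
    (F : List Access → ClientState P K → Mem K V → ℝ≥0∞)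
    (G : List Access → Tape P K → ℝ≥0∞)
    (hFG : ∀ tr τ m, GoodAt A.keys 0 (fun _ => P.depth + 1) τ m →
      F tr (clientState P (shape P 0) τ) m ≤ G tr τ) :
    W (setup P (initMem A)) 0 F ≤ ex (setupSim P) fun o => avg (G o.1) := by
  unfold setup
  rw [W_bind]
  refine (dom_build (P.net_sorts _ le_rfl) setup_disjoint (uniqueKeys_initMem A)
    (initMem_zht_empty A) _ (fun tr f => avg fun τ : Tape P K =>
      G tr (Function.update τ (Fin.last P.depth) f)) ?_).trans (le_of_eq ?_)
  · intro tr f m hb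
    rw [W_pure, List.append_nil]
    refine (ex_const (PMF.uniformOfFintype (Tape P K)) _).symm.le.trans (ex_mono fun τ => ?_)
    have h1 := hFG tr (Function.update τ (Fin.last P.depth) f) m (goodAt_setup A (by
      rw [Function.update_self]
      exact hb))
    rwa [clientState_shape_zero, Function.update_self] at h1
  · rw [avg_ex_comm]
    congr 1
    funext o
    exact (avg_update (X := fun i : Fin (P.depth + 1) => Fin (P.k i) → K →
      Fin (2 ^ (P.logp + i))) (Fin.last P.depth) (G o.1)).symm

/-- The successful real executions are dominated by the simulation with fresh hash functions
wherever the adversary has not seen the hash values. -/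
lemma W_experiment_le (A : Adversary P.N K V) (T : ℕ)
    (F : List Access → ClientState P K → Mem K V → ℝ≥0∞)
    (G : List Access → (K → ℕ) → Tape P K → ℝ≥0∞)
    (hFG : ∀ tr loc τ m, GoodAt A.keys T loc τ m →
      F tr (clientState P (shape P T) τ) m ≤ G tr loc τ)
    (hG : ∀ tr loc, Blind (shape P T) loc (G tr loc)) :
    W (experiment P A T) 0 F ≤ ex (ghost A T) fun o => avg (G o.1 o.2) := by
  induction T generalizing F G with
  | zero =>
    rw [ghost, ex_map]
    exact W_setup_le A F (fun tr => G tr fun _ => P.depth + 1) fun tr τ m h => hFG _ _ _ _ h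
  | succ T ih =>
    rw [W_experiment_succ, ghost, ex_bind]
    set G₁ : List Access → (K → ℕ) → List Access → Tape P K → ℝ≥0∞ := fun tr loc tr' =>
      G (tr ++ tr') (nextLoc P T loc (A.request tr).1) with hG₁
    have hblind : ∀ tr loc tr', Blind (shape P T) (touchLoc loc (A.request tr).1)
        (afterRebuild P T (G₁ tr loc) tr') := fun tr loc =>
      Blind.afterRebuild fun tr' => hG _ _
    -- The induction hypothesis is applied to the expectation of `G` over the last access, as a
    -- function of trace, places and tape. It has to bound the real access, to be blind, and to
    -- average to the simulated access.
    refine (ih _ (fun tr loc τ => ex (lookupSim P (shape P T) T (searchRows τ (A.request tr).1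
      (loc (A.request tr).1))) fun o => afterRebuild P T (G₁ tr loc) o.1 τ) ?_ ?_).trans
      (ex_mono fun o => le_of_eq ?_)
    · intro tr loc τ m h
      exact W_access_le A.card_keys_le h (A.request_mem_keys tr) _ _ (G₁ tr loc)
        fun tr' r τ' m' h' => hFG _ _ _ _ h'
    -- The lookup consults the requested key only at nonempty levels up to its place, which `Blind`
    -- permits. What follows is blind even with the place of that key set to 0.
    · intro tr loc τ τ' h
      have h1 : ∀ tr', afterRebuild P T (G₁ tr loc) tr' τ =
          afterRebuild P T (G₁ tr loc) tr' τ' := fun tr' =>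
        hblind tr loc tr' τ τ' fun i κ hi hle j => h i κ hi (hle.trans (by
          unfold touchLoc
          by_cases hk : κ = (A.request tr).1
          · rw [hk, Function.update_self]
            exact Nat.zero_le _
          · rw [Function.update_of_ne hk])) j
      have h2 : lookupSim P (shape P T) T (searchRows τ (A.request tr).1
          (loc (A.request tr).1)) = lookupSim P (shape P T) T (searchRows τ' (A.request tr).1
          (loc (A.request tr).1)) := by
        unfold lookupSim
        congr 2
        funext _
        congr 2
        funext i
        unfold levelSim
        split
        · rfl
        · rename_i id hid
          congr 1
          unfold searchRows
          split_ifs with hle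
          · rfl
          · congr 1
            funext j
            exact h i _ (by rw [hid]; simp) (by omega) j
      simp only [h1, h2]
    · rw [ex_map]
      refine (avg_lookup (shape P T) T (A.request o.1).1 (o.2 (A.request o.1).1)
        (afterRebuild P T (G₁ o.1 o.2)) ?_).trans (avg_afterRebuild T (G₁ o.1 o.2))
      -- After the access the key is in the list, at place 0; since `i + 1 ≤ 0` holds for no level,
      -- its hash values have become irrelevant.
      intro tr τ x
      refine hblind o.1 o.2 tr _ _ fun i κ _ hle j => ?_
      unfold setColumn
      refine Function.update_of_ne (fun hk => ?_) _ _
      rw [hk, touchLoc, Function.update_self] at hle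
      omega

/-- Every setup contributes one term. With constant test functions, `W_experiment_le` acts as an
invariant: successful runs are in good states, where the bound for the next rebuild applies. -/
lemma failProb_experiment_le (A : Adversary P.N K V) {s : ℕ}
    (hP : ∀ i, i ≤ P.depth → 12 * (s + 1) * (Nat.log 2 (P.logp + i) + 1) ≤ P.k i ∧
      12 * (s + 1) * (Nat.log 2 (P.logp + i) + 1) ≤ P.c i) (T : ℕ) :
    failProb (experiment P A T) ≤ ((T / P.p + 1 : ℕ) : ℝ≥0∞) * 2⁻¹ ^ s := by
  induction T with
  | zero =>
    rw [experiment, setup, failProb_bind]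
    have h0 : ∀ (st : ClientState P K) (m' : Mem K V),
        failProb ((pure st : Prog K V (ClientState P K)) m') = 0 := fun st m' => W_pure _ _ _ _
    simp only [h0, W_zero, add_zero, Nat.zero_div, zero_add, Nat.cast_one, one_mul]
    refine failProb_build_small (P.net_sorts _ le_rfl) setup_disjoint (uniqueKeys_initMem A)
      (initMem_zht_empty A) (U := A.keys) ?_ A.card_keys_le (hP _ le_rfl).1 (hP _ le_rfl).2
    intro x _ κ hκ
    obtain ⟨i, -, hi⟩ := (keyAt_initMem A).1 hκ
    exact Finset.mem_image.2 ⟨i, Finset.mem_univ i, hi⟩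
  | succ T ih =>
    have hstep : failProb (experiment P A (T + 1)) ≤ failProb (experiment P A T) +
        if (T + 1) % P.p = 0 then 2⁻¹ ^ s else 0 := by
      rw [failProb, W_experiment_succ, W_one_eq]
      refine add_le_add le_rfl ((W_experiment_le A T _ (fun _ _ _ => if (T + 1) % P.p = 0
        then 2⁻¹ ^ s else 0) ?_ fun _ _ _ _ _ => rfl).trans (le_of_eq ?_))
      · intro tr loc τ m h
        exact failProb_access_le A.card_keys_le h (A.request_mem_keys tr) _ hP
      · refine Eq.trans ?_ (ex_const (ghost A T) _)
        congr 1
        funext o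
        exact ex_const _ _
    refine (hstep.trans (add_le_add_left ih _)).trans ?_
    split_ifs with ht
    · rw [succ_div_of_mod ht]
      rw [Nat.cast_add_one (T / P.p + 1), add_mul, one_mul]
    · rw [Nat.succ_div_of_not_dvd fun hd => ht (Nat.mod_eq_zero_of_dvd hd), add_zero]

/-- Any event is at most as likely in the real execution as it is in the simulation or the real
execution fails. -/
lemma ex_realView_le (A : Adversary P.N K V) (T : ℕ) (F : View → ℝ≥0∞) (hF : ∀ v, F v ≤ 1) :
    ex (realView P A T) F ≤ ex (simView simulator P T) F + failProb (experiment P A T) := by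
  have h1 : ex (realView P A T) F ≤ W (experiment P A T) 1 fun tr _ _ => F (tr, true) := by
    rw [realView, ex_map]
    refine ex_mono fun o => ?_
    rcases o with ⟨tr, _ | ⟨st, m⟩⟩
    · exact hF _
    · exact le_rfl
  refine h1.trans ?_
  rw [W_one_eq, add_comm]
  refine add_le_add ((W_experiment_le A T _ (fun tr _ _ => F (tr, true))
    (fun _ _ _ _ _ => le_rfl) fun _ _ _ _ _ => rfl).trans (le_of_eq ?_)) le_rfl
  rw [simView, ← ghost_map_fst A T, ex_map, ex_map]
  congr 1
  funext o
  exact ex_const _ _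

lemma toOuterMeasure_failed (A : Adversary P.N K V) (T : ℕ) :
    (realView P A T).toOuterMeasure failed = failProb (experiment P A T) := by
  rw [toOuterMeasure_eq_ex, realView, ex_map, failProb, W]
  congr 1
  funext o
  rcases o with ⟨tr, _ | ⟨st, m⟩⟩ <;> simp [failed]

/-- The bound of `ex_realView_le` is one-sided. Both views have total mass 1, so the bound for the
complement of `D` is the missing lower bound for `D`. -/
lemma indistinguishable_of_failProb_le (A : Adversary P.N K V) (T : ℕ) {ε : ℝ≥0∞}
    (hε : ε ≠ ∞) (h : failProb (experiment P A T) ≤ ε) :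
    Indistinguishable (realView P A T) (simView simulator P T) ε.toReal := by
  intro D
  have hind : ∀ (E : Set View) v, E.indicator (1 : View → ℝ≥0∞) v ≤ 1 := fun E v =>
    Set.indicator_le_self' (fun _ _ => zero_le) v
  have h1 := (ex_realView_le A T _ (hind D)).trans (add_le_add_right h _)
  have h2 := (ex_realView_le A T _ (hind Dᶜ)).trans (add_le_add_right h _)
  have hr := ex_indicator_add_compl (realView P A T) D
  have hs := ex_indicator_add_compl (simView simulator P T) D
  unfold prob
  rw [toOuterMeasure_eq_ex, toOuterMeasure_eq_ex]
  have hlt : ∀ (μ : PMF View) (E : Set View), ex μ (E.indicator 1) ≠ ∞ := fun μ E =>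
    ((ex_mono (hind E)).trans (ex_const μ 1).le |>.trans_lt ENNReal.one_lt_top).ne
  set a := ex (realView P A T) (D.indicator 1)
  set a' := ex (realView P A T) (Dᶜ.indicator 1)
  set b := ex (simView simulator P T) (D.indicator 1)
  set b' := ex (simView simulator P T) (Dᶜ.indicator 1)
  have ha : a ≠ ∞ := hlt _ _
  have ha' : a' ≠ ∞ := hlt _ _
  have hb : b ≠ ∞ := hlt _ _
  have hb' : b' ≠ ∞ := hlt _ _
  have h1' := ENNReal.toReal_mono (ENNReal.add_ne_top.2 ⟨hb, hε⟩) h1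
  have h2' := ENNReal.toReal_mono (ENNReal.add_ne_top.2 ⟨hb', hε⟩) h2
  have hr' := congrArg ENNReal.toReal hr
  have hs' := congrArg ENNReal.toReal hs
  rw [ENNReal.toReal_add hb hε] at h1'
  rw [ENNReal.toReal_add hb' hε] at h2'
  rw [ENNReal.toReal_add ha ha'] at hr'
  rw [ENNReal.toReal_add hb hb'] at hs'
  rw [abs_le]
  constructor <;> linarith

end Experiment

end PyramidORAM

end

theorem mainTheorem1 :
    ∃ S : PyramidORAM.Simulator,
      (∀ (P : PyramidORAM.Params) (K V : Type) [Fintype K] [DecidableEq K]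
        (A : PyramidORAM.Adversary P.N K V) (T : ℕ),
        PyramidORAM.Indistinguishable (PyramidORAM.realView P A T) (PyramidORAM.simView S P T)
          (PyramidORAM.prob (PyramidORAM.realView P A T) PyramidORAM.failed)) ∧
      ∀ s : ℕ, ∃ C : ℕ, ∀ P : PyramidORAM.Params,
        (∀ i, i ≤ P.depth → C * (Nat.log 2 (P.logp + i) + 1) ≤ P.k i ∧
          C * (Nat.log 2 (P.logp + i) + 1) ≤ P.c i) →
        ∀ (K V : Type) [Fintype K] [DecidableEq K]
          (A : PyramidORAM.Adversary P.N K V) (T : ℕ),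
          PyramidORAM.Indistinguishable (PyramidORAM.realView P A T) (PyramidORAM.simView S P T)
            (((T / P.p + 1 : ℕ) : ℝ) * (1 / 2) ^ s) := by
  -- The constant is dictated by `factorial_large`, for the bucket sizes; for the number of tables
  -- it is more than enough.
  refine ⟨PyramidORAM.simulator, fun P K V _ _ A T => ?_, fun s => ⟨12 * (s + 1), ?_⟩⟩
  · unfold PyramidORAM.prob
    rw [PyramidORAM.toOuterMeasure_failed]
    exact PyramidORAM.indistinguishable_of_failProb_le A T (PyramidORAM.failProb_ne_top _) le_rfl
  · intro P hP K V _ _ A T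
    have h := PyramidORAM.indistinguishable_of_failProb_le A T
      (ENNReal.mul_ne_top (ENNReal.natCast_ne_top _)
        (ENNReal.pow_ne_top (ENNReal.inv_ne_top.2 two_ne_zero)))
      (PyramidORAM.failProb_experiment_le A hP T)
    rw [ENNReal.toReal_mul, ENNReal.toReal_natCast, ENNReal.toReal_pow, ENNReal.toReal_inv,
      ENNReal.toReal_ofNat] at h
    rwa [one_div]
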